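/- For $s\in\mathbb R$ let $\dot H^s(\mathbb R^2)$ be the space of tempered distributions $u$ whose Fourier transform $\hat u$ is a locally integrable function with $\|u\|_{\dot H^s}=\bigl(\int_{\mathbb R^2}|\xi|^{2s}|\hat u(\xi)|^2\,d\xi\bigr)^{1/2}<\infty$; put $\|u\|_{\dot H^s\cap\dot H^{t}}=\|u\|_{\dot H^s}+\|u\|_{\dot H^{t}}$, and let the norm of a vector-valued function be the sum of the norms of its components. **Lemma.** There is a constant $\varepsilon_0>0$ such that for all $\tau_1\in(2,\infty)$ and $\tau_2\in(-1,0)$ there is a function $C=C(\lambda_1,\lambda_2)\ge 0$ of $\lambda_1,\lambda_2\ge 0$ (depending only on $\tau_1,\tau_2$), non-decreasing in both variables, with the following property. Let $\psi_0\in\dot H^{\tau_1+1}(\mathbb R^2)\cap\dot H^{\tau_2+1}(\mathbb R^2)$ and $\tilde\psi_0\in\dot H^{\tau_1+1}(\mathbb R^2)\cap\dot H^{\tau_2+2}(\mathbb R^2)$ be real-valued (identified with their continuous representatives) with $$\|\nabla\psi_0\|_{L^\infty}+\|\nabla\tilde\psi_0\|_{L^\infty}\le\varepsilon_0,$$ and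 suppose that $$\det U_0=1\quad\text{on }\mathbb R^2,\qquad U_0=\begin{pmatrix}1+\partial_{x_2}\psi_0&\partial_{x_2}\tilde\psi_0\\-\partial_{x_1}\psi_0&1-\partial_{x_1}\tilde\psi_0\end{pmatrix}.$$ Then there exists a $C^1$ map $Y_0=(Y_0^1,Y_0^2):\mathbb R^2\to\mathbb R^2$ with $Y_0\in\dot H^{\tau_1+1}(\mathbb R^2)\cap\dot H^{\tau_2+2}(\mathbb R^2)$ and $\partial_1Y_0\in\dot H^{\tau_2}(\mathbb R^2)$ such that $X_0(y)=y+Y_0(y)$ satisfies, for all $y\in\mathbb R^2$, $$U_0\circ X_0(y)=\nabla_yX_0(y)=I+\nabla_yY_0(y),\qquad\text{where }(\nabla_yF)_{ij}=\partial_{y_j}F^i.$$ Moreover, $$\|Y_0\|_{\dot H^{\tau_1+1}\cap\dot H^{\tau_2+2}}+\|\partial_1Y_0\|_{\dot H^{\tau_2}}\le C\bigl(\|\psi_0\|_{\dot H^{\tau_1+1}\cap\dot H^{\tau_2+1}},\|\tilde\psi_0\|_{\dot H^{\tau_1+1}\cap\dot H^{\tau_2+2}}\bigr)\bigl(\|\psi_0\|_{\dot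 H^{\tau_1+1}\cap\dot H^{\tau_2+1}}+\|\tilde\psi_0\|_{\dot H^{\tau_1+1}\cap\dot H^{\tau_2+2}}\bigr).$$ -/

import Mathlib

open MeasureTheory
open scoped SchwartzMap FourierTransform ENNReal NNReal Gradient

noncomputable section

/-- The Euclidean plane `ℝ²`. -/
abbrev Plane : Type := EuclideanSpace ℝ (Fin 2)

/-- The tempered distribution `T` is given by integration against the function `f`. -/
def IsGivenBy (T : 𝓢'(Plane, ℂ)) (f : Plane → ℂ) : Prop :=
  ∀ φ : 𝓢(Plane, ℂ), Integrable (fun x => φ x * f x) ∧ T φ = ∫ x, φ x * f x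

/-- The homogeneous Sobolev norm `(∫ |ξ|^(2s) |û(ξ)|² dξ)^(1/2)` of a tempered distribution `u` whose
Fourier transform `û` is a locally integrable function `g`. Since `g` is unique up to null sets, the
infimum runs over equal values; it is `∞` if `û` is not a locally integrable function. -/
def homSobolevNormDist (s : ℝ) (u : 𝓢'(Plane, ℂ)) : ℝ≥0∞ :=
  ⨅ (g : Plane → ℂ) (_ : LocallyIntegrable g) (_ : IsGivenBy (𝓕 u) g),
    (∫⁻ ξ, ENNReal.ofReal (‖ξ‖ ^ (2 * s)) * ‖g ξ‖ₑ ^ 2) ^ (1 / 2 : ℝ)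

/-- The homogeneous Sobolev norm of a real function on the plane: the norm of the (unique) tempered
distribution that it defines, and `∞` if it does not define one. -/
def homSobolevNorm (s : ℝ) (f : Plane → ℝ) : ℝ≥0∞ :=
  ⨅ (u : 𝓢'(Plane, ℂ)) (_ : IsGivenBy u (fun x => (f x : ℂ))), homSobolevNormDist s u

/-- Membership in the homogeneous Sobolev space `Ḣ^s(ℝ²)`. -/
def MemHomSobolev (s : ℝ) (f : Plane → ℝ) : Prop :=
  homSobolevNorm s f < ∞

/-- The norm of `Ḣ^s ∩ Ḣ^t`: the sum of the two norms. -/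
def homSobolevNorm₂ (s t : ℝ) (f : Plane → ℝ) : ℝ≥0∞ :=
  homSobolevNorm s f + homSobolevNorm t f

/-- The partial derivative `∂ⱼ f` (the coordinates `x₁, x₂` have the indices `0, 1`). -/
def partialDeriv (j : Fin 2) (f : Plane → ℝ) (x : Plane) : ℝ :=
  fderiv ℝ f x (EuclideanSpace.single j 1)

/-- The Jacobian matrix `(∇F)ᵢⱼ = ∂ⱼ Fⁱ`. -/
def jacobian (F : Plane → Plane) (y : Plane) : Matrix (Fin 2) (Fin 2) ℝ :=
  Matrix.of fun i j => partialDeriv j (fun z => F z i) y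

/-- The matrix `U₀` built from `ψ₀` and `ψ̃₀`. -/
def initialDeformation (ψ ψt : Plane → ℝ) (x : Plane) : Matrix (Fin 2) (Fin 2) ℝ :=
  !![1 + partialDeriv 1 ψ x, partialDeriv 1 ψt x;
     -partialDeriv 0 ψ x, 1 - partialDeriv 0 ψt x]

end

/-! Coordinates are numbered 0 and 1; put `s = τ₂ + 1 ∈ (0, 1)` and `τ = τ₁`. The Jacobian matrix of
`x ↦ x + (-ψt x, ψ x)` is the adjugate of `U₀`, hence its inverse because `det U₀ = 1`. Small
gradients make this map a bi-Lipschitz perturbation of the identity. Its inverse `X` therefore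
satisfies `∇X = U₀ ∘ X`, and the displacement is `Y = (ψt ∘ X, -ψ ∘ X)`
(`exists_inverse_displacement`). Everything else is an estimate of `Y`.

Functions are written as `𝓕⁻ G` with an integrable spectrum `G`, and Sobolev norms become the
weighted `L²` norms `wn r G`. For orders in `(0, 1)` the norm is a multiple of the Gagliardo
seminorm, which tolerates bi-Lipschitz changes of variables (`gag_comp_le`). Higher orders follow
from the chain rule, one derivative at a time (`CompBounded.add_one`): the entries of `∇X` are
themselves compositions with `X` of functions of known regularity, so the induction closes. Applied
to the entries of `U₀ - I`, this bounds `∇Y` at the orders `s` and `τ`, hence `Y` at `s + 1` and `τ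
+ 1`.

The bound of `∂₀Y` at the negative order `s - 1` is immediate for the second component, because `ψ ∘
X` has order `s`. For the first, `det ∇X = 1` gives `∂₀Y⁰ = -∂₁Y¹ + (∂₀Y¹ ∂₁Y⁰ - ∂₁Y¹ ∂₀Y⁰)`. The
bracket is a null form, a divergence of products `Y¹ ∂Y⁰`, so a derivative can be pulled out before
products are estimated (`nullForm_ae_eq`, `wn_nullForm_le`).

One qualitative point remains: the Fourier transform of `Y⁰ = ψt ∘ X` must be a function, although
no norm of `ψt` of order at most one is given. The same determinant identity for `U₀` shows `∂₀ψt ∈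
L²` (`wn_zero_dsym_lt_top`). Displacing first along axis 1 and then along axis 0 writes `ψt ∘ X -
ψt` as a term of order `s` plus a term in `L²`, which makes the low frequencies integrable
(`exists_integrable_comp_spectrum`). -/

/-! ### Fourier duality, tempered distributions and their spectra. -/

theorem integral_fourier_mul_eq_integral_mul_fourier {f g : Plane → ℂ} (hf : Integrable f)
    (hg : Integrable g) : ∫ x, 𝓕 f x * g x = ∫ x, f x * 𝓕 g x := by
  simpa using! VectorFourier.integral_fourierIntegral_smul_eq_flip (L := innerₗ Plane)
    Real.continuous_fourierChar continuous_inner hf hg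

theorem integral_fourierInv_mul_eq_integral_mul_fourierInv {f g : Plane → ℂ} (hf : Integrable f)
    (hg : Integrable g) : ∫ x, 𝓕⁻ f x * g x = ∫ x, f x * 𝓕⁻ g x := by
  have h := integral_fourier_mul_eq_integral_mul_fourier (f := fun x => f (-x)) hf.comp_neg hg
  rw [← Real.fourierInv_eq_fourier_comp_neg f] at h
  rw [h, ← integral_neg_eq_self]
  simp [Real.fourierInv_eq_fourier_neg]

theorem schwartz_integrable_mul_of_bound (φ : 𝓢(Plane, ℂ)) {F : Plane → ℂ} (hF : Continuous F)
    {C : ℝ} (hC : ∀ x, ‖F x‖ ≤ C) : Integrable (fun x => φ x * F x) := by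
  exact φ.integrable.mul_bdd hF.aestronglyMeasurable (Filter.Eventually.of_forall hC)

theorem norm_fourierInv_le {G : Plane → ℂ} (x : Plane) : ‖𝓕⁻ G x‖ ≤ ∫ ξ, ‖G ξ‖ := by
  rw [Real.fourierInv_eq]
  refine (norm_integral_le_integral_norm _).trans (le_of_eq ?_)
  simp

theorem continuous_fourier_of_integrable {G : Plane → ℂ} (hG : Integrable G) :
    Continuous (𝓕 G) :=
  VectorFourier.fourierIntegral_continuous Real.continuous_fourierChar
    (by exact continuous_inner) hG

theorem continuous_fourierInv_of_integrable {G : Plane → ℂ} (hG : Integrable G) :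
    Continuous (𝓕⁻ G) := by
  have : 𝓕⁻ G = fun x => 𝓕 G (-x) := by
    ext x; exact Real.fourierInv_eq_fourier_neg G x
  rw [this]
  exact (continuous_fourier_of_integrable hG).comp continuous_neg

/-- Locally integrable functions with the same integrals against Schwartz functions agree. -/
theorem ae_eq_of_integral_schwartz_mul_eq {G H : Plane → ℂ} (hG : LocallyIntegrable G)
    (hH : LocallyIntegrable H)
    (h : ∀ φ : 𝓢(Plane, ℂ), ∫ x, φ x * G x = ∫ x, φ x * H x) : G =ᵐ[volume] H := by
  refine ae_eq_of_integral_contDiff_smul_eq hG hH fun g hg hc => ?_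
  have hg₁ : HasCompactSupport (Complex.ofRealCLM ∘ g) := hc.comp_left rfl
  have hg₂ : ContDiff ℝ (⊤ : ℕ∞) (Complex.ofRealCLM ∘ g) := by fun_prop
  simpa using h (hg₁.toSchwartzMap hg₂)

/-- Duality: test `𝓕 u` against `𝓕⁻ φ` and move the inverse transform onto `G`. -/
theorem isGivenBy_fourierInv {u : 𝓢'(Plane, ℂ)} {G : Plane → ℂ} (hG : Integrable G)
    (hu : IsGivenBy (𝓕 u) G) : IsGivenBy u (𝓕⁻ G) := by
  intro φ
  refine ⟨schwartz_integrable_mul_of_bound φ (continuous_fourierInv_of_integrable hG)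
    norm_fourierInv_le, ?_⟩
  have h := (hu (𝓕⁻ φ)).2
  rw [TemperedDistribution.fourier_apply, FourierTransform.fourier_fourierInv_eq] at h
  rw [h, ← integral_fourierInv_mul_eq_integral_mul_fourierInv φ.integrable hG]
  simp [SchwartzMap.fourierInv_coe]

theorem integrable_schwartz_mul (φ : 𝓢(Plane, ℂ)) {G : Plane → ℂ} (hG : Integrable G) :
    Integrable (fun x => φ x * G x) := by
  obtain ⟨C, hC⟩ := φ.decay 0 0
  refine hG.bdd_mul φ.continuous.aestronglyMeasurable (c := C) ?_
  refine Filter.Eventually.of_forall fun x => ?_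
  simpa using hC.2 x

theorem exists_tempered_fourier_eq {G : Plane → ℂ} (hG : Integrable G) :
    ∃ u : 𝓢'(Plane, ℂ), IsGivenBy u (𝓕⁻ G) ∧ IsGivenBy (𝓕 u) G := by
  have hm : MemLp G 1 volume := memLp_one_iff_integrable.2 hG
  set T : 𝓢'(Plane, ℂ) := Lp.toTemperedDistribution (hm.toLp G)
  have hT : IsGivenBy T G := by
    intro φ
    refine ⟨integrable_schwartz_mul φ hG, ?_⟩
    rw [Lp.toTemperedDistribution_apply]
    refine integral_congr_ae ?_
    filter_upwards [hm.coeFn_toLp] with x hx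
    simp [hx]
  have h2 : IsGivenBy (𝓕 (𝓕⁻ T)) G := by
    rwa [FourierTransform.fourier_fourierInv_eq]
  exact ⟨𝓕⁻ T, isGivenBy_fourierInv hG h2, h2⟩

/-- Turns pointwise identities between functions, such as the expanded determinant equation, into
identities between spectra, where the weighted norms live. -/
theorem ae_eq_of_fourierInv_eq {G H : Plane → ℂ} (hG : Integrable G) (hH : Integrable H)
    (h : 𝓕⁻ G = 𝓕⁻ H) : G =ᵐ[volume] H := by
  refine ae_eq_of_integral_schwartz_mul_eq hG.locallyIntegrable hH.locallyIntegrable fun φ => ?_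
  have e : ∀ K : Plane → ℂ, Integrable K → ∫ x, φ x * K x = ∫ x, (𝓕 φ) x * 𝓕⁻ K x := by
    intro K hK
    rw [← integral_fourierInv_mul_eq_integral_mul_fourierInv (𝓕 φ).integrable hK,
      ← SchwartzMap.fourierInv_coe, FourierTransform.fourierInv_fourier_eq]
  rw [e G hG, e H hH, h]

/-! ### Weighted `L²` norms of spectra. -/

/-- The `L²` norm with the weight `|ξ|^r`. -/
noncomputable def wn (r : ℝ) (G : Plane → ℂ) : ℝ≥0∞ :=
  eLpNorm (fun ξ => ((‖ξ‖ ^ r : ℝ) : ℂ) * G ξ) 2 volume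

theorem eLpNorm_two_eq {E : Type*} [NormedAddCommGroup E] (F : Plane → E) :
    eLpNorm F 2 volume = (∫⁻ x, ‖F x‖ₑ ^ 2) ^ (1 / 2 : ℝ) := by
  rw [eLpNorm_eq_lintegral_rpow_enorm_toReal (by norm_num) (by norm_num)]
  simp

theorem eLpNorm_two_sq {E : Type*} [NormedAddCommGroup E] (F : Plane → E) :
    eLpNorm F 2 volume ^ 2 = ∫⁻ x, ‖F x‖ₑ ^ 2 := by
  rw [eLpNorm_two_eq, ← ENNReal.rpow_natCast, ← ENNReal.rpow_mul]
  simp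

theorem wn_eq (r : ℝ) (G : Plane → ℂ) :
    wn r G = (∫⁻ ξ, ENNReal.ofReal (‖ξ‖ ^ (2 * r)) * ‖G ξ‖ₑ ^ 2) ^ (1 / 2 : ℝ) := by
  rw [wn, eLpNorm_two_eq]
  congr 1
  refine lintegral_congr fun ξ => ?_
  rw [enorm_mul, mul_pow]
  congr 1
  rw [← ofReal_norm, Complex.norm_real, Real.norm_of_nonneg (by positivity),
    ← ENNReal.ofReal_pow (by positivity), mul_comm, Real.rpow_mul (norm_nonneg _)]
  simp

/-- The norm is an infimum, so one spectrum suffices for an upper bound. This is how all norms of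
the displacement are estimated. -/
theorem homSobolevNorm_le_wn (r : ℝ) {f : Plane → ℝ} {G : Plane → ℂ} (hG : Integrable G)
    (hf : (fun x => (f x : ℂ)) = 𝓕⁻ G) : homSobolevNorm r f ≤ wn r G := by
  obtain ⟨u, hu, hu'⟩ := exists_tempered_fourier_eq hG
  rw [← hf] at hu
  refine (iInf₂_le u hu).trans ?_
  refine (iInf_le _ G).trans ((iInf_le _ hG.locallyIntegrable).trans ((iInf_le _ hu').trans ?_))
  rw [wn_eq]

theorem IsGivenBy.ae_eq {T : 𝓢'(Plane, ℂ)} {f g : Plane → ℂ} (hf : IsGivenBy T f)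
    (hg : IsGivenBy T g) (hf' : LocallyIntegrable f) (hg' : LocallyIntegrable g) :
    f =ᵐ[volume] g :=
  ae_eq_of_integral_schwartz_mul_eq hf' hg' fun φ => by rw [← (hf φ).2, ← (hg φ).2]

theorem IsGivenBy.unique {T S : 𝓢'(Plane, ℂ)} {f : Plane → ℂ} (hT : IsGivenBy T f)
    (hS : IsGivenBy S f) : T = S := by
  ext φ
  rw [(hT φ).2, (hS φ).2]

theorem wn_congr_ae {r : ℝ} {G H : Plane → ℂ} (h : G =ᵐ[volume] H) : wn r G = wn r H := by
  refine eLpNorm_congr_ae ?_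
  filter_upwards [h] with x hx
  rw [hx]

/-- A function in a homogeneous Sobolev space is given by a locally integrable spectrum, which
computes all its Sobolev norms. -/
theorem MemHomSobolev.exists_spectrum {r : ℝ} {f : Plane → ℝ} (h : MemHomSobolev r f) :
    ∃ (u : 𝓢'(Plane, ℂ)) (G : Plane → ℂ), IsGivenBy u (fun x => (f x : ℂ)) ∧
      LocallyIntegrable G ∧ IsGivenBy (𝓕 u) G ∧ ∀ t, homSobolevNorm t f = wn t G := by
  simp only [MemHomSobolev, homSobolevNorm, iInf_lt_iff] at h
  obtain ⟨u, hu, h⟩ := h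
  simp only [homSobolevNormDist, iInf_lt_iff] at h
  obtain ⟨G, hG, hG', -⟩ := h
  refine ⟨u, G, hu, hG, hG', fun t => le_antisymm ?_ ?_⟩
  · refine (iInf₂_le u hu).trans ?_
    refine (iInf_le _ G).trans ((iInf_le _ hG).trans ((iInf_le _ hG').trans ?_))
    rw [wn_eq]
  · refine le_iInf₂ fun v hv => ?_
    rw [hv.unique hu]
    refine le_iInf fun g => le_iInf fun hg => le_iInf fun hg' => ?_
    rw [← wn_eq]
    exact (wn_congr_ae (hG'.ae_eq hg' hG hg)).le

/-- Plancherel's theorem for integrable, square integrable functions. -/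
theorem eLpNorm_fourier_eq {F : Plane → ℂ} (h1 : Integrable F) (h2 : MemLp F 2 volume) :
    eLpNorm (𝓕 F) 2 volume = eLpNorm F 2 volume := by
  let f : Lp ℂ 2 (volume : Measure Plane) := h2.toLp F
  have key : ((𝓕 f : Lp ℂ 2 (volume : Measure Plane)) : Plane → ℂ) =ᵐ[volume] 𝓕 F := by
    refine ae_eq_of_integral_schwartz_mul_eq ((Lp.memLp (𝓕 f)).locallyIntegrable (by norm_num))
      (continuous_fourier_of_integrable h1).locallyIntegrable fun φ => ?_
    have e := congrArg (fun T : 𝓢'(Plane, ℂ) => T φ) (Lp.fourier_toTemperedDistribution_eq f)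
    simp only [TemperedDistribution.fourier_apply, Lp.toTemperedDistribution_apply,
      smul_eq_mul] at e
    rw [← e, ← integral_fourier_mul_eq_integral_mul_fourier φ.integrable h1]
    refine integral_congr_ae ?_
    filter_upwards [h2.coeFn_toLp] with x hx
    simp [f, hx, SchwartzMap.fourier_coe]
  rw [← eLpNorm_congr_ae key, ← eLpNorm_congr_ae h2.coeFn_toLp]
  have := Lp.norm_fourier_eq f
  rw [Lp.norm_def, Lp.norm_def] at this
  exact (ENNReal.toReal_eq_toReal_iff' (Lp.eLpNorm_ne_top _) (Lp.eLpNorm_ne_top _)).1 this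

theorem eLpNorm_fourierInv_eq {G : Plane → ℂ} (h1 : Integrable G) (h2 : MemLp G 2 volume) :
    eLpNorm (𝓕⁻ G) 2 volume = eLpNorm G 2 volume := by
  rw [← eLpNorm_fourier_eq h1 h2]
  have : 𝓕⁻ G = 𝓕 G ∘ (fun x => -x) := by
    ext x; exact Real.fourierInv_eq_fourier_neg G x
  rw [this]
  exact eLpNorm_comp_measurePreserving
    (continuous_fourier_of_integrable h1).aestronglyMeasurable (Measure.measurePreserving_neg _)

theorem sq_lintegral_mul_le {α : Type*} [MeasurableSpace α] (μ : Measure α) {f g : α → ℝ≥0∞}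
    (hf : AEMeasurable f μ) (hg : AEMeasurable g μ) :
    (∫⁻ a, f a * g a ∂μ) ^ 2 ≤ (∫⁻ a, f a ^ 2 ∂μ) * ∫⁻ a, g a ^ 2 ∂μ := by
  have h := ENNReal.lintegral_mul_le_Lp_mul_Lq μ Real.HolderConjugate.two_two hf hg
  have h2 := pow_le_pow_left' h 2
  rw [mul_pow, ← ENNReal.rpow_natCast (_ ^ (1 / (2 : ℝ))), ← ENNReal.rpow_natCast (_ ^ (1 / (2 : ℝ))),
    ← ENNReal.rpow_mul, ← ENNReal.rpow_mul] at h2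
  simpa using h2

theorem eLpNorm_two_const_mul_norm {E : Type*} [NormedAddCommGroup E] (c : ℝ≥0) (g : Plane → E) :
    eLpNorm (fun x => (c : ℝ) * ‖g x‖) 2 volume = c * eLpNorm g 2 volume := by
  have := eLpNorm_const_smul (c : ℝ) (fun x => ‖g x‖) 2 (volume : Measure Plane)
  rw [eLpNorm_norm] at this
  rw [← show ‖(c : ℝ)‖ₑ = (c : ℝ≥0∞) by simp, ← this]
  rfl

theorem eLpNorm_two_le_add {E F G : Type*} [NormedAddCommGroup E] [NormedAddCommGroup F]
    [NormedAddCommGroup G] {f : Plane → E} {g : Plane → F} {h : Plane → G}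
    (hg : AEStronglyMeasurable g) (hh : AEStronglyMeasurable h) {c d : ℝ≥0}
    (H : ∀ᵐ x, ‖f x‖ ≤ c * ‖g x‖ + d * ‖h x‖) :
    eLpNorm f 2 volume ≤ c * eLpNorm g 2 volume + d * eLpNorm h 2 volume := by
  have h1 : eLpNorm f 2 volume ≤
      eLpNorm ((fun x => (c : ℝ) * ‖g x‖) + fun x => (d : ℝ) * ‖h x‖) 2 volume := by
    refine eLpNorm_mono_ae ?_
    filter_upwards [H] with x hx
    refine hx.trans (le_abs_self _)
  refine h1.trans ((eLpNorm_add_le (hg.norm.const_mul _) (hh.norm.const_mul _)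
    (by norm_num)).trans (le_of_eq ?_))
  rw [eLpNorm_two_const_mul_norm, eLpNorm_two_const_mul_norm]

theorem eLpNorm_two_le_mul {E F : Type*} [NormedAddCommGroup E] [NormedAddCommGroup F]
    {f : Plane → E} {g : Plane → F} (c : ℝ≥0) (H : ∀ᵐ x, ‖f x‖ ≤ c * ‖g x‖) :
    eLpNorm f 2 volume ≤ c * eLpNorm g 2 volume := by
  have := eLpNorm_le_nnreal_smul_eLpNorm_of_ae_le_mul (μ := volume) (c := c) H 2
  simpa [ENNReal.smul_def] using this

theorem aestronglyMeasurable_weight {r : ℝ} {G : Plane → ℂ} (hG : AEStronglyMeasurable G) :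
    AEStronglyMeasurable (fun ξ => ((‖ξ‖ ^ r : ℝ) : ℂ) * G ξ) := by
  refine AEStronglyMeasurable.mul ?_ hG
  exact (by fun_prop : Measurable fun ξ : Plane => ((‖ξ‖ ^ r : ℝ) : ℂ)).aestronglyMeasurable

theorem ae_norm_pos : ∀ᵐ ξ : Plane, 0 < ‖ξ‖ := by
  have : ∀ᵐ ξ : Plane, ξ ≠ 0 := by
    simp [ae_iff]
  filter_upwards [this] with ξ h using norm_pos_iff.2 h

theorem norm_weight_mul (r : ℝ) (ξ : Plane) (z : ℂ) :
    ‖((‖ξ‖ ^ r : ℝ) : ℂ) * z‖ = ‖ξ‖ ^ r * ‖z‖ := by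
  rw [norm_mul, Complex.norm_real, Real.norm_of_nonneg (by positivity)]

/-- Crude interpolation: `t ^ r ≤ t ^ a + t ^ b` for `t > 0`, by comparing `t` with 1. -/
theorem wn_le_wn_add_wn {a r b : ℝ} (har : a ≤ r) (hrb : r ≤ b) {G : Plane → ℂ}
    (hG : AEStronglyMeasurable G) : wn r G ≤ wn a G + wn b G := by
  have := eLpNorm_two_le_add (f := fun ξ => ((‖ξ‖ ^ r : ℝ) : ℂ) * G ξ) (c := 1) (d := 1)
    (aestronglyMeasurable_weight (r := a) hG) (aestronglyMeasurable_weight (r := b) hG) (by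
      filter_upwards [ae_norm_pos] with ξ hξ
      simp only [norm_weight_mul, NNReal.coe_one, one_mul]
      rw [← add_mul]
      gcongr
      rcases le_total ‖ξ‖ 1 with h | h
      · have := Real.rpow_le_rpow_of_exponent_ge hξ h har
        have := Real.rpow_nonneg (norm_nonneg ξ) b
        linarith
      · have := Real.rpow_le_rpow_of_exponent_le h hrb
        have := Real.rpow_nonneg (norm_nonneg ξ) a
        linarith)
  simpa [wn] using this

theorem wn_add_le {r : ℝ} {G H : Plane → ℂ} (hG : AEStronglyMeasurable G)
    (hH : AEStronglyMeasurable H) : wn r (fun ξ => G ξ + H ξ) ≤ wn r G + wn r H := by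
  have := eLpNorm_two_le_add (f := fun ξ => ((‖ξ‖ ^ r : ℝ) : ℂ) * (G ξ + H ξ)) (c := 1) (d := 1)
    (aestronglyMeasurable_weight (r := r) hG) (aestronglyMeasurable_weight (r := r) hH) (by
      refine Filter.Eventually.of_forall fun ξ => ?_
      simp only [norm_weight_mul, NNReal.coe_one, one_mul]
      rw [← mul_add]
      gcongr
      exact norm_add_le _ _)
  simpa [wn] using this

theorem wn_sub_le {r : ℝ} {G H : Plane → ℂ} (hG : AEStronglyMeasurable G)
    (hH : AEStronglyMeasurable H) : wn r (fun ξ => G ξ - H ξ) ≤ wn r G + wn r H := by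
  have := eLpNorm_two_le_add (f := fun ξ => ((‖ξ‖ ^ r : ℝ) : ℂ) * (G ξ - H ξ)) (c := 1) (d := 1)
    (aestronglyMeasurable_weight (r := r) hG) (aestronglyMeasurable_weight (r := r) hH) (by
      refine Filter.Eventually.of_forall fun ξ => ?_
      simp only [norm_weight_mul, NNReal.coe_one, one_mul]
      rw [← mul_add]
      gcongr
      exact norm_sub_le _ _)
  simpa [wn] using this

theorem wn_mono_mul {r t : ℝ} {G H : Plane → ℂ} (c : ℝ≥0)
    (h : ∀ᵐ ξ, ‖ξ‖ ^ r * ‖G ξ‖ ≤ c * (‖ξ‖ ^ t * ‖H ξ‖)) : wn r G ≤ c * wn t H := by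
  refine eLpNorm_two_le_mul c ?_
  filter_upwards [h] with ξ hξ
  simpa only [norm_weight_mul] using hξ

theorem wn_mono {r : ℝ} {G H : Plane → ℂ} (c : ℝ≥0) (h : ∀ᵐ ξ, ‖G ξ‖ ≤ c * ‖H ξ‖) :
    wn r G ≤ c * wn r H := by
  refine wn_mono_mul c ?_
  filter_upwards [h] with ξ hξ
  calc ‖ξ‖ ^ r * ‖G ξ‖ ≤ ‖ξ‖ ^ r * (c * ‖H ξ‖) := by gcongr
    _ = _ := by ring

theorem wn_zero_eq (G : Plane → ℂ) : wn 0 G = eLpNorm G 2 volume := by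
  simp [wn]

/-! ### Derivatives as symbols, and shifts of the order by one. -/

/-- Multiplication of a spectrum by the symbol `2πi ξⱼ` of the derivative `∂ⱼ`. -/
noncomputable def dsym (j : Fin 2) (G : Plane → ℂ) (ξ : Plane) : ℂ :=
  2 * Real.pi * Complex.I * (ξ j : ℂ) * G ξ

theorem norm_dsym (j : Fin 2) (G : Plane → ℂ) (ξ : Plane) :
    ‖dsym j G ξ‖ = 2 * Real.pi * |ξ j| * ‖G ξ‖ := by
  simp [dsym, abs_of_pos Real.pi_pos]

theorem norm_dsym_le (j : Fin 2) (G : Plane → ℂ) (ξ : Plane) :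
    ‖dsym j G ξ‖ ≤ 7 * (‖ξ‖ * ‖G ξ‖) := by
  rw [norm_dsym]
  have h1 : |ξ j| ≤ ‖ξ‖ := by simpa using PiLp.norm_apply_le ξ j
  have h2 : 2 * Real.pi ≤ 7 := by linarith [Real.pi_lt_d2]
  calc 2 * Real.pi * |ξ j| * ‖G ξ‖ ≤ 7 * ‖ξ‖ * ‖G ξ‖ := by gcongr
    _ = _ := by ring

theorem norm_mul_le_dsym (G : Plane → ℂ) (ξ : Plane) :
    ‖ξ‖ * ‖G ξ‖ ≤ ‖dsym 0 G ξ‖ + ‖dsym 1 G ξ‖ := by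
  rw [norm_dsym, norm_dsym]
  have h1 : ‖ξ‖ ≤ |ξ 0| + |ξ 1| := by
    rw [EuclideanSpace.norm_eq, Fin.sum_univ_two]
    refine Real.sqrt_le_iff.2 ⟨by positivity, ?_⟩
    simp only [Real.norm_eq_abs]
    nlinarith [abs_nonneg (ξ 0), abs_nonneg (ξ 1)]
  have h2 : 1 ≤ 2 * Real.pi := by linarith [Real.pi_gt_three]
  calc ‖ξ‖ * ‖G ξ‖ ≤ 1 * (|ξ 0| + |ξ 1|) * ‖G ξ‖ := by rw [one_mul]; gcongr
    _ ≤ 2 * Real.pi * (|ξ 0| + |ξ 1|) * ‖G ξ‖ := by gcongr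
    _ = _ := by ring

theorem aestronglyMeasurable_dsym (j : Fin 2) {G : Plane → ℂ} (hG : AEStronglyMeasurable G) :
    AEStronglyMeasurable (dsym j G) := by
  refine AEStronglyMeasurable.mul ?_ hG
  exact (by fun_prop : Continuous fun ξ : Plane =>
    2 * Real.pi * Complex.I * (ξ j : ℂ)).aestronglyMeasurable

theorem wn_dsym_le (r : ℝ) (j : Fin 2) (G : Plane → ℂ) : wn r (dsym j G) ≤ 7 * wn (r + 1) G := by
  refine wn_mono_mul (c := 7) ?_
  filter_upwards [ae_norm_pos] with ξ hξ
  rw [Real.rpow_add hξ, Real.rpow_one]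
  calc ‖ξ‖ ^ r * ‖dsym j G ξ‖ ≤ ‖ξ‖ ^ r * (7 * (‖ξ‖ * ‖G ξ‖)) := by gcongr; exact norm_dsym_le j G ξ
    _ = _ := by push_cast; ring

theorem wn_add_one_le (r : ℝ) {G : Plane → ℂ} (hG : AEStronglyMeasurable G) :
    wn (r + 1) G ≤ wn r (dsym 0 G) + wn r (dsym 1 G) := by
  have := eLpNorm_two_le_add (f := fun ξ => ((‖ξ‖ ^ (r + 1) : ℝ) : ℂ) * G ξ) (c := 1) (d := 1)
    (aestronglyMeasurable_weight (r := r) (aestronglyMeasurable_dsym 0 hG))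
    (aestronglyMeasurable_weight (r := r) (aestronglyMeasurable_dsym 1 hG)) (by
      filter_upwards [ae_norm_pos] with ξ hξ
      simp only [norm_weight_mul, NNReal.coe_one, one_mul]
      rw [← mul_add, Real.rpow_add hξ, Real.rpow_one, mul_assoc]
      gcongr
      exact norm_mul_le_dsym G ξ)
  simpa [wn] using this

/-! ### Integrability of spectra from weighted norms. -/

theorem lintegral_rpow_norm_ball_lt_top {p : ℝ} (hp : -2 < p) :
    ∫⁻ ξ in Metric.ball (0 : Plane) 1, ENNReal.ofReal (‖ξ‖ ^ p) < ∞ := by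
  have h : IntegrableOn (fun x : Plane => (fun t : ℝ => t ^ p) ‖x‖) (Metric.ball 0 1) volume := by
    refine (integrableOn_fun_norm_addHaar volume (f := fun t : ℝ => t ^ p) (r := 1)).2 ?_
    have : IntegrableOn (fun y : ℝ => y ^ (p + 1)) (Set.Ioo 0 1) := by
      exact (intervalIntegral.integrableOn_Ioo_rpow_iff zero_lt_one).2 (by linarith)
    refine this.congr_fun (fun y hy => ?_) measurableSet_Ioo
    simp [Real.rpow_add hy.1, mul_comm]
  exact (hasFiniteIntegral_iff_ofReal (Filter.Eventually.of_forall fun x =>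
    Real.rpow_nonneg (norm_nonneg x) p)).1 h.2

theorem lintegral_rpow_norm_compl_ball_lt_top {p : ℝ} (hp : p < -2) :
    ∫⁻ ξ in (Metric.ball (0 : Plane) 1)ᶜ, ENNReal.ofReal (‖ξ‖ ^ p) < ∞ := by
  have h : Integrable (fun x : Plane => (Set.Ici (1 : ℝ)).indicator (fun t : ℝ => t ^ p) ‖x‖) := by
    rw [integrable_fun_norm_addHaar volume]
    have : IntegrableOn (fun y : ℝ => y ^ (p + 1)) (Set.Ici 1) := by
      rw [integrableOn_Ici_iff_integrableOn_Ioi]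
      exact integrableOn_Ioi_rpow_of_lt (by linarith) zero_lt_one
    have h3 := (integrable_indicator_iff measurableSet_Ici).2 this
    refine (h3.integrableOn (s := Set.Ioi 0)).congr_fun (fun y hy => ?_) measurableSet_Ioi
    by_cases h : 1 ≤ y
    · simp [h, Real.rpow_add (Set.mem_Ioi.1 hy), mul_comm]
    · simp [h]
  have h2 : IntegrableOn (fun x : Plane => ‖x‖ ^ p) (Metric.ball (0 : Plane) 1)ᶜ := by
    rw [← integrable_indicator_iff Metric.isOpen_ball.measurableSet.compl]
    refine h.congr (Filter.Eventually.of_forall fun x => ?_)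
    by_cases hx : 1 ≤ ‖x‖
    · simp [Set.indicator, hx]
    · simp [Set.indicator, hx]
  exact (hasFiniteIntegral_iff_ofReal (Filter.Eventually.of_forall fun x =>
    Real.rpow_nonneg (norm_nonneg x) p)).1 h2.2

/-- Cauchy–Schwarz with `‖G‖ = ‖ξ‖ ^ (-a) * (‖ξ‖ ^ a * ‖G‖)`. In the plane the first factor is
square integrable near the origin for `a < 1` and near infinity for `a > 1`. -/
theorem exists_setLIntegral_le_wn {a : ℝ} {S : Set Plane}
    (h : ∫⁻ ξ in S, ENNReal.ofReal (‖ξ‖ ^ (-2 * a)) < ∞) :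
    ∃ K : ℝ≥0, ∀ G : Plane → ℂ, AEStronglyMeasurable G → ∫⁻ ξ in S, ‖G ξ‖ₑ ≤ K * wn a G := by
  refine ⟨((∫⁻ ξ in S, ENNReal.ofReal (‖ξ‖ ^ (-2 * a))) ^ (1 / 2 : ℝ)).toNNReal, fun G hG => ?_⟩
  rw [ENNReal.coe_toNNReal (ENNReal.rpow_lt_top_of_nonneg (by norm_num) h.ne).ne]
  have h1 := ENNReal.lintegral_mul_le_Lp_mul_Lq (volume.restrict S) Real.HolderConjugate.two_two
    (f := fun ξ => ENNReal.ofReal (‖ξ‖ ^ (-a))) (g := fun ξ => ‖((‖ξ‖ ^ a : ℝ) : ℂ) * G ξ‖ₑ)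
    (by fun_prop) (aestronglyMeasurable_weight hG).enorm.restrict
  refine le_trans (le_of_eq ?_) (h1.trans ?_)
  · refine lintegral_congr_ae ?_
    filter_upwards [ae_restrict_of_ae ae_norm_pos] with ξ hξ
    simp only [Pi.mul_apply]
    rw [← ofReal_norm, ← ofReal_norm, norm_weight_mul, ← ENNReal.ofReal_mul (by positivity),
      ← mul_assoc, ← Real.rpow_add hξ]
    simp
  · refine mul_le_mul' ?_ ?_
    · refine ENNReal.rpow_le_rpow (le_of_eq (lintegral_congr fun ξ => ?_)) (by norm_num)
      rw [ENNReal.ofReal_rpow_of_nonneg (by positivity) (by norm_num),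
        ← Real.rpow_mul (norm_nonneg _)]
      ring_nf
    · rw [wn, eLpNorm_two_eq]
      refine ENNReal.rpow_le_rpow ?_ (by norm_num)
      refine (setLIntegral_le_lintegral _ _).trans (le_of_eq ?_)
      simp

theorem exists_lintegral_ball_le_wn {a : ℝ} (ha : a < 1) :
    ∃ K : ℝ≥0, ∀ G : Plane → ℂ, AEStronglyMeasurable G →
      ∫⁻ ξ in Metric.ball (0 : Plane) 1, ‖G ξ‖ₑ ≤ K * wn a G :=
  exists_setLIntegral_le_wn (lintegral_rpow_norm_ball_lt_top (by linarith))

theorem exists_lintegral_compl_ball_le_wn {b : ℝ} (hb : 1 < b) :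
    ∃ K : ℝ≥0, ∀ G : Plane → ℂ, AEStronglyMeasurable G →
      ∫⁻ ξ in (Metric.ball (0 : Plane) 1)ᶜ, ‖G ξ‖ₑ ≤ K * wn b G :=
  exists_setLIntegral_le_wn
    (lintegral_rpow_norm_compl_ball_lt_top (by linarith))

theorem exists_lintegral_le_wn {a b : ℝ} (ha : a < 1) (hb : 1 < b) :
    ∃ K : ℝ≥0, ∀ G : Plane → ℂ, AEStronglyMeasurable G →
      ∫⁻ ξ, ‖G ξ‖ₑ ≤ K * (wn a G + wn b G) := by
  obtain ⟨K, hK⟩ := exists_lintegral_ball_le_wn ha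
  obtain ⟨L, hL⟩ := exists_lintegral_compl_ball_le_wn hb
  refine ⟨K + L, fun G hG => ?_⟩
  rw [← lintegral_add_compl _ (measurableSet_ball (x := (0 : Plane)) (ε := 1))]
  push_cast
  calc _ ≤ K * wn a G + L * wn b G := add_le_add (hK G hG) (hL G hG)
    _ ≤ (K + L) * wn a G + (K + L) * wn b G := by gcongr <;> simp
    _ = _ := by ring

theorem integrable_of_wn {a b : ℝ} (ha : a < 1) (hb : 1 < b) {G : Plane → ℂ}
    (hG : AEStronglyMeasurable G) (h1 : wn a G < ∞) (h2 : wn b G < ∞) : Integrable G := by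
  obtain ⟨K, hK⟩ := exists_lintegral_le_wn ha hb
  refine ⟨hG, (hK G hG).trans_lt ?_⟩
  exact ENNReal.mul_lt_top ENNReal.coe_lt_top (ENNReal.add_lt_top.2 ⟨h1, h2⟩)

theorem integrable_dsym {j : Fin 2} {a b : ℝ} (ha : a < 2) (hb : 2 < b) {G : Plane → ℂ}
    (hG : AEStronglyMeasurable G) (h1 : wn a G < ∞) (h2 : wn b G < ∞) :
    Integrable (dsym j G) := by
  refine integrable_of_wn (a := a - 1) (b := b - 1) (by linarith) (by linarith)
    (aestronglyMeasurable_dsym j hG) ?_ ?_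
  · refine (wn_dsym_le _ j G).trans_lt (ENNReal.mul_lt_top (by simp) ?_)
    simpa using h1
  · refine (wn_dsym_le _ j G).trans_lt (ENNReal.mul_lt_top (by simp) ?_)
    simpa using h2

/-! ### Convolutions and the product estimate. -/

/-- The convolution of functions with values in `[0, ∞]`. -/
noncomputable def econv (f g : Plane → ℝ≥0∞) (ξ : Plane) : ℝ≥0∞ := ∫⁻ η, f η * g (ξ - η)

theorem econv_comm (f g : Plane → ℝ≥0∞) (ξ : Plane) : econv f g ξ = econv g f ξ := by
  rw [econv, econv, ← lintegral_sub_left_eq_self _ ξ]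
  refine lintegral_congr fun η => ?_
  rw [sub_sub_cancel, mul_comm]

theorem aemeasurable_econv_integrand {f g : Plane → ℝ≥0∞} (hf : AEMeasurable f)
    (hg : AEMeasurable g) : AEMeasurable (fun p : Plane × Plane => f p.2 * g (p.1 - p.2))
      (volume.prod volume) := by
  refine AEMeasurable.mul ?_ ?_
  · exact hf.comp_quasiMeasurePreserving Measure.quasiMeasurePreserving_snd
  · exact hg.comp_quasiMeasurePreserving
      (quasiMeasurePreserving_sub_of_right_invariant volume volume)

theorem aemeasurable_econv {f g : Plane → ℝ≥0∞} (hf : AEMeasurable f)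
    (hg : AEMeasurable g) : AEMeasurable (econv f g) :=
  (aemeasurable_econv_integrand hf hg).lintegral_prod_right'

/-- Young's inequality `L¹ * L² ⊂ L²`: Cauchy–Schwarz with respect to the measure with density `f`,
followed by Tonelli and translation invariance. -/
theorem lintegral_econv_sq_le {f g : Plane → ℝ≥0∞} (hf : AEMeasurable f) (hg : AEMeasurable g) :
    ∫⁻ ξ, econv f g ξ ^ 2 ≤ (∫⁻ η, f η) ^ 2 * ∫⁻ η, g η ^ 2 := by
  have hsub : ∀ ξ : Plane, AEMeasurable (fun η => g (ξ - η)) := fun ξ =>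
    hg.comp_quasiMeasurePreserving (quasiMeasurePreserving_sub_left volume ξ)
  have h1 : ∀ ξ, econv f g ξ ^ 2 ≤ (∫⁻ η, f η) * econv f (fun x => g x ^ 2) ξ := by
    intro ξ
    have hd := withDensity_absolutelyContinuous (volume : Measure Plane) f
    have h := sq_lintegral_mul_le (volume.withDensity f) (f := fun _ => 1)
      (g := fun η => g (ξ - η)) aemeasurable_const ((hsub ξ).mono_ac hd)
    simp only [one_mul, one_pow, lintegral_const, withDensity_apply _ MeasurableSet.univ,
      Measure.restrict_univ] at h
    rw [lintegral_withDensity_eq_lintegral_mul₀ hf (hsub ξ),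
      lintegral_withDensity_eq_lintegral_mul₀ hf ((hsub ξ).pow_const 2)] at h
    exact h
  calc ∫⁻ ξ, econv f g ξ ^ 2 ≤ ∫⁻ ξ, (∫⁻ η, f η) * econv f (fun x => g x ^ 2) ξ :=
        lintegral_mono h1
    _ = (∫⁻ η, f η) * ∫⁻ ξ, econv f (fun x => g x ^ 2) ξ :=
        lintegral_const_mul'' _ (aemeasurable_econv hf (hg.pow_const 2))
    _ = (∫⁻ η, f η) * ∫⁻ η, ∫⁻ ξ, f η * g (ξ - η) ^ 2 := by
        rw [← lintegral_lintegral_swap (aemeasurable_econv_integrand hf (hg.pow_const 2))]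
        rfl
    _ = (∫⁻ η, f η) * ∫⁻ η, f η * ∫⁻ ξ, g ξ ^ 2 := by
        congr 1
        refine lintegral_congr fun η => ?_
        rw [lintegral_const_mul'', lintegral_sub_right_eq_self (fun x => g x ^ 2) η]
        exact (hg.pow_const 2).comp_quasiMeasurePreserving
          (measurePreserving_sub_right volume η).quasiMeasurePreserving
    _ = _ := by
        rw [lintegral_mul_const'' _ hf]
        ring

theorem l2_econv_le {f g : Plane → ℝ≥0∞} (hf : AEMeasurable f) (hg : AEMeasurable g) :
    (∫⁻ ξ, econv f g ξ ^ (2 : ℝ)) ^ (1 / 2 : ℝ) ≤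
      (∫⁻ η, f η) * (∫⁻ η, g η ^ (2 : ℝ)) ^ (1 / 2 : ℝ) := by
  simp only [ENNReal.rpow_two]
  refine (ENNReal.rpow_le_rpow (lintegral_econv_sq_le hf hg) (by norm_num)).trans (le_of_eq ?_)
  rw [ENNReal.mul_rpow_of_nonneg _ _ (by norm_num), ← ENNReal.rpow_natCast, ← ENNReal.rpow_mul]
  simp

theorem add_rpow_le_two_rpow_mul {x y r : ℝ} (hx : 0 ≤ x) (hy : 0 ≤ y) (hr : 0 ≤ r) :
    (x + y) ^ r ≤ 2 ^ r * (x ^ r + y ^ r) := by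
  wlog h : x ≤ y generalizing x y
  · rw [add_comm x, add_comm (x ^ r)]
    exact this hy hx (le_of_not_ge h)
  calc (x + y) ^ r ≤ (2 * y) ^ r := by gcongr; linarith
    _ = 2 ^ r * y ^ r := Real.mul_rpow (by norm_num) hy
    _ ≤ _ := by gcongr; linarith [Real.rpow_nonneg hx r]

/-- A weighted `L²` bound for a spectrum dominated by a convolution. -/
theorem wn_le_of_le_econv {r : ℝ} (hr : 0 ≤ r) {F G K : Plane → ℂ} (hF : AEStronglyMeasurable F)
    (hG : AEStronglyMeasurable G)
    (hK : ∀ ξ, ‖K ξ‖ₑ ≤ econv (fun η => ‖F η‖ₑ) (fun η => ‖G η‖ₑ) ξ) :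
    wn r K ≤ ENNReal.ofReal (2 ^ r) *
      (wn r F * (∫⁻ η, ‖G η‖ₑ) + (∫⁻ η, ‖F η‖ₑ) * wn r G) := by
  set w : Plane → ℝ≥0∞ := fun ξ => ENNReal.ofReal (‖ξ‖ ^ r) with hw
  have hwm : Measurable w := by fun_prop
  set f : Plane → ℝ≥0∞ := fun η => ‖F η‖ₑ
  set g : Plane → ℝ≥0∞ := fun η => ‖G η‖ₑ
  have hf : AEMeasurable f := hF.enorm
  have hg : AEMeasurable g := hG.enorm
  have hwn : ∀ H : Plane → ℂ, wn r H = (∫⁻ ξ, (w ξ * ‖H ξ‖ₑ) ^ (2 : ℝ)) ^ (1 / 2 : ℝ) := by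
    intro H
    rw [wn, eLpNorm_two_eq]
    congr 1
    refine lintegral_congr fun ξ => ?_
    rw [ENNReal.rpow_two, ← ofReal_norm, norm_weight_mul, ENNReal.ofReal_mul (by positivity),
      ofReal_norm]
  have hpt : ∀ ξ, w ξ * ‖K ξ‖ₑ ≤ ENNReal.ofReal (2 ^ r) *
      (econv g (fun η => w η * f η) ξ + econv f (fun η => w η * g η) ξ) := by
    intro ξ
    -- As `r ≥ 0`, the triangle inequality distributes the weight at `ξ` over `η` and `ξ - η`.
    have h1 : ∀ η, w ξ * (f η * g (ξ - η)) ≤ ENNReal.ofReal (2 ^ r) *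
        ((w η * f η) * g (ξ - η) + f η * (w (ξ - η) * g (ξ - η))) := by
      intro η
      have : w ξ ≤ ENNReal.ofReal (2 ^ r) * (w η + w (ξ - η)) := by
        rw [hw, ← ENNReal.ofReal_add (by positivity) (by positivity),
          ← ENNReal.ofReal_mul (by positivity)]
        refine ENNReal.ofReal_le_ofReal (le_trans ?_
          (add_rpow_le_two_rpow_mul (norm_nonneg η) (norm_nonneg (ξ - η)) hr))
        gcongr
        simpa using norm_add_le η (ξ - η)
      calc w ξ * (f η * g (ξ - η)) ≤ (ENNReal.ofReal (2 ^ r) * (w η + w (ξ - η))) *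
            (f η * g (ξ - η)) := by gcongr
        _ = _ := by ring
    have hsub : ∀ {h : Plane → ℝ≥0∞}, AEMeasurable h → AEMeasurable (fun η => h (ξ - η)) :=
      fun hh => hh.comp_quasiMeasurePreserving (quasiMeasurePreserving_sub_left volume ξ)
    have hm : AEMeasurable (fun η => (w η * f η) * g (ξ - η)) :=
      (hwm.aemeasurable.mul hf).mul (hsub hg)
    have hfg : AEMeasurable (fun η => f η * g (ξ - η)) := hf.mul (hsub hg)
    have hm' : AEMeasurable (fun η => f η * (w (ξ - η) * g (ξ - η))) :=
      hf.mul (hsub (h := fun η => w η * g η) (hwm.aemeasurable.mul hg))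
    calc w ξ * ‖K ξ‖ₑ ≤ w ξ * econv f g ξ := by gcongr; exact hK ξ
      _ = ∫⁻ η, w ξ * (f η * g (ξ - η)) := (lintegral_const_mul'' _ hfg).symm
      _ ≤ ∫⁻ η, ENNReal.ofReal (2 ^ r) *
        ((w η * f η) * g (ξ - η) + f η * (w (ξ - η) * g (ξ - η))) := lintegral_mono h1
      _ = ENNReal.ofReal (2 ^ r) * ((∫⁻ η, (w η * f η) * g (ξ - η)) +
            ∫⁻ η, f η * (w (ξ - η) * g (ξ - η))) := by
          rw [lintegral_const_mul' _ _ ENNReal.ofReal_ne_top, lintegral_add_left' hm]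
      _ = _ := by
          rw [econv_comm g]; rfl
  have hA : AEMeasurable (econv g fun η => w η * f η) := aemeasurable_econv hg (hwm.aemeasurable.mul hf)
  have hB : AEMeasurable (econv f fun η => w η * g η) := aemeasurable_econv hf (hwm.aemeasurable.mul hg)
  rw [hwn K, hwn F, hwn G]
  calc _ ≤ (∫⁻ ξ, (ENNReal.ofReal (2 ^ r)) ^ (2 : ℝ) *
        ((econv g (fun η => w η * f η) + econv f (fun η => w η * g η)) ξ) ^ (2 : ℝ)) ^
          (1 / 2 : ℝ) := by
        refine ENNReal.rpow_le_rpow (lintegral_mono fun ξ => ?_) (by norm_num)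
        rw [← ENNReal.mul_rpow_of_nonneg _ _ (by norm_num)]
        exact ENNReal.rpow_le_rpow (hpt ξ) (by norm_num)
    _ = ENNReal.ofReal (2 ^ r) * (∫⁻ ξ, ((econv g (fun η => w η * f η) +
          econv f (fun η => w η * g η)) ξ) ^ (2 : ℝ)) ^ (1 / 2 : ℝ) := by
        rw [lintegral_const_mul' _ _ (by simp),
          ENNReal.mul_rpow_of_nonneg _ _ (by norm_num), ← ENNReal.rpow_mul]
        simp
    _ ≤ ENNReal.ofReal (2 ^ r) * ((∫⁻ ξ, (econv g (fun η => w η * f η) ξ) ^ (2 : ℝ)) ^ (1 / 2 : ℝ) +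
          (∫⁻ ξ, (econv f (fun η => w η * g η) ξ) ^ (2 : ℝ)) ^ (1 / 2 : ℝ)) := by
        gcongr
        exact ENNReal.lintegral_Lp_add_le hA hB (by norm_num)
    _ ≤ _ := by
        gcongr
        · rw [mul_comm]
          exact l2_econv_le hg (hwm.aemeasurable.mul hf)
        · exact l2_econv_le hf (hwm.aemeasurable.mul hg)

/-- The convolution of two spectra. -/
noncomputable def sconv (F G : Plane → ℂ) : Plane → ℂ :=
  convolution F G (ContinuousLinearMap.mul ℂ ℂ) volume

theorem integrable_sconv {F G : Plane → ℂ} (hF : Integrable F) (hG : Integrable G) :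
    Integrable (sconv F G) :=
  hF.integrable_convolution (ContinuousLinearMap.mul ℂ ℂ) hG

theorem fourierInv_sconv {F G : Plane → ℂ} (hF : Integrable F) (hG : Integrable G) (x : Plane) :
    𝓕⁻ (sconv F G) x = 𝓕⁻ F x * 𝓕⁻ G x := by
  simp only [Real.fourierInv_eq_fourier_neg]
  exact Real.fourier_mul_convolution_eq hF hG (-x)

theorem enorm_sconv_le (F G : Plane → ℂ) (ξ : Plane) :
    ‖sconv F G ξ‖ₑ ≤ econv (fun η => ‖F η‖ₑ) (fun η => ‖G η‖ₑ) ξ := by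
  refine (enorm_integral_le_lintegral_enorm _).trans (le_of_eq ?_)
  simp [econv]

theorem wn_sconv_le {r : ℝ} (hr : 0 ≤ r) {F G : Plane → ℂ} (hF : AEStronglyMeasurable F)
    (hG : AEStronglyMeasurable G) :
    wn r (sconv F G) ≤ ENNReal.ofReal (2 ^ r) *
      (wn r F * (∫⁻ η, ‖G η‖ₑ) + (∫⁻ η, ‖F η‖ₑ) * wn r G) :=
  wn_le_of_le_econv hr hF hG (enorm_sconv_le F G)

/-! ### Differentiation of inverse Fourier transforms. -/

theorem contDiff_one_of_partials {E : Type*} [NormedAddCommGroup E] [NormedSpace ℝ E]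
    {f : Plane → E} (hf : Differentiable ℝ f)
    (h : ∀ j : Fin 2, Continuous fun x => fderiv ℝ f x (EuclideanSpace.single j 1)) :
    ContDiff ℝ 1 f := by
  refine contDiff_one_iff_fderiv.2 ⟨hf, ?_⟩
  have e : fderiv ℝ f = fun x => ∑ j : Fin 2, (EuclideanSpace.proj j : Plane →L[ℝ] ℝ).smulRight
      (fderiv ℝ f x (EuclideanSpace.single j 1)) := by
    ext x v
    simp only [sum_apply, ContinuousLinearMap.smulRight_apply]
    conv_lhs => rw [← (EuclideanSpace.basisFun (Fin 2) ℝ).sum_repr v]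
    simp
  rw [e]
  refine continuous_finsetSum _ fun j _ => ?_
  exact (ContinuousLinearMap.smulRightL ℝ Plane E (EuclideanSpace.proj j)).continuous.comp (h j)

theorem norm_le_of_partials {E : Type*} [NormedAddCommGroup E] [NormedSpace ℝ E]
    (L : Plane →L[ℝ] E) :
    ‖L‖ ≤ ‖L (EuclideanSpace.single 0 1)‖ + ‖L (EuclideanSpace.single 1 1)‖ := by
  refine L.opNorm_le_bound (by positivity) fun v => ?_
  conv_lhs => rw [← (EuclideanSpace.basisFun (Fin 2) ℝ).sum_repr v]
  simp only [Fin.sum_univ_two, map_add, map_smul, EuclideanSpace.basisFun_repr,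
    EuclideanSpace.basisFun_apply]
  have h0 : |v 0| ≤ ‖v‖ := by simpa using PiLp.norm_apply_le v 0
  have h1 : |v 1| ≤ ‖v‖ := by simpa using PiLp.norm_apply_le v 1
  refine (norm_add_le _ _).trans ?_
  rw [norm_smul, norm_smul, add_mul, Real.norm_eq_abs, Real.norm_eq_abs, mul_comm ‖_‖ ‖v‖,
    mul_comm ‖_‖ ‖v‖]
  gcongr

theorem inner_single_one (v : Plane) (j : Fin 2) :
    inner ℝ v (EuclideanSpace.single j (1 : ℝ)) = v j := by
  simp [EuclideanSpace.inner_single_right]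

theorem integrable_norm_mul_of_dsym {G : Plane → ℂ} (hG : Integrable G)
    (h : ∀ j, Integrable (dsym j G)) : Integrable (fun ξ => ‖ξ‖ * ‖G ξ‖) := by
  refine ((h 0).norm.add (h 1).norm).mono'
    (continuous_norm.aestronglyMeasurable.mul hG.1.norm) (Filter.Eventually.of_forall fun ξ => ?_)
  rw [Real.norm_of_nonneg (by positivity)]
  exact norm_mul_le_dsym G ξ

/-- Differentiation of an inverse Fourier transform. -/
theorem differentiable_fourierInv {G : Plane → ℂ} (hG : Integrable G)
    (h : ∀ j, Integrable (dsym j G)) : Differentiable ℝ (𝓕⁻ G) ∧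
      ∀ x j, fderiv ℝ (𝓕⁻ G) x (EuclideanSpace.single j 1) = 𝓕⁻ (dsym j G) x := by
  have hi := (integrable_norm_mul_of_dsym hG h).comp_neg
  simp only [norm_neg] at hi
  have hd := fun x => Real.hasFDerivAt_fourier hG.comp_neg hi x
  rw [← Real.fourierInv_eq_fourier_comp_neg G] at hd
  refine ⟨fun x => (hd x).differentiableAt, fun x j => ?_⟩
  rw [(hd x).fderiv, Real.fourier_continuousLinearMap_apply, Real.fourierInv_eq_fourier_comp_neg]
  · refine congrArg (fun F : Plane → ℂ => 𝓕 F x) (funext fun v => ?_)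
    have hi : innerSL ℝ v (EuclideanSpace.single j 1) = v j := inner_single_one v j
    simp [VectorFourier.fourierSMulRight_apply, dsym, hi]
    ring
  · refine Integrable.mono' (hi.const_mul (2 * Real.pi)) ?_ (Filter.Eventually.of_forall fun v => ?_)
    · exact VectorFourier.fourierSMulRight_apply (innerSL ℝ) (fun v => G (-v)) |> fun _ => by
        exact AEStronglyMeasurable.fourierSMulRight (L := innerSL ℝ) hG.comp_neg.1
    · refine (VectorFourier.norm_fourierSMulRight_le (innerSL ℝ) (fun v => G (-v)) v).trans ?_
      have := norm_innerSL_le ℝ (E := Plane)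
      have h2 : 0 ≤ 2 * Real.pi * (‖v‖ * ‖G (-v)‖) := by positivity
      calc _ = ‖innerSL ℝ (E := Plane)‖ * (2 * Real.pi * (‖v‖ * ‖G (-v)‖)) := by ring
        _ ≤ 1 * (2 * Real.pi * (‖v‖ * ‖G (-v)‖)) := by gcongr
        _ = _ := by ring

theorem contDiff_fourierInv {G : Plane → ℂ} (hG : Integrable G)
    (h : ∀ j, Integrable (dsym j G)) : ContDiff ℝ 1 (𝓕⁻ G) := by
  obtain ⟨h1, h2⟩ := differentiable_fourierInv hG h
  refine contDiff_one_of_partials h1 fun j => ?_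
  simp only [h2]
  exact continuous_fourierInv_of_integrable (h j)

/-- If the partial derivative of `𝓕⁻ H` has an integrable spectrum `K`, then `K` is the derivative
symbol times `H`. -/
theorem dsym_ae_eq_of_fderiv {H K : Plane → ℂ} (hH : Integrable H) (hK : Integrable K)
    (hd : Differentiable ℝ (𝓕⁻ H)) {j : Fin 2}
    (h : ∀ x, fderiv ℝ (𝓕⁻ H) x (EuclideanSpace.single j 1) = 𝓕⁻ K x) :
    dsym j H =ᵐ[volume] K := by
  refine ae_eq_of_integral_schwartz_mul_eq (LocallyIntegrable.continuous_mul (by fun_prop)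
    hH.locallyIntegrable) hK.locallyIntegrable fun φ => ?_
  set m : Plane := EuclideanSpace.single j 1
  have hφ : ∀ x, fderiv ℝ (𝓕 φ : 𝓢(Plane, ℂ)) x m = (LineDeriv.lineDerivOp m (𝓕 φ) : 𝓢(Plane, ℂ)) x := by
    intro x; rw [SchwartzMap.lineDerivOp_apply_eq_fderiv]
  have hb := fun x => norm_fourierInv_le (G := H) x
  have hbK := fun x => norm_fourierInv_le (G := K) x
  have hcH := continuous_fourierInv_of_integrable hH
  have hcK := continuous_fourierInv_of_integrable hK
  -- Integration by parts moves the derivative to the Schwartz function `𝓕 φ`, where Fourier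
  -- inversion turns it into the symbol. No integrability of `dsym j H` is needed.
  have ibp := integral_mul_fderiv_eq_neg_fderiv_mul_of_integrable (μ := volume)
    (f := (𝓕 φ : 𝓢(Plane, ℂ))) (g := 𝓕⁻ H) (v := m)
    (by simp only [hφ]; exact schwartz_integrable_mul_of_bound _ hcH hb)
    (by simp only [h]; exact schwartz_integrable_mul_of_bound _ hcK hbK)
    (schwartz_integrable_mul_of_bound _ hcH hb)
    (fun x _ => (𝓕 φ : 𝓢(Plane, ℂ)).differentiableAt) (fun x _ => hd x)
  simp only [h, hφ] at ibp
  rw [← integral_fourierInv_mul_eq_integral_mul_fourierInv (SchwartzMap.integrable _) hK,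
    ← integral_fourierInv_mul_eq_integral_mul_fourierInv (SchwartzMap.integrable _) hH,
    ← SchwartzMap.fourierInv_coe, ← SchwartzMap.fourierInv_coe,
    FourierTransform.fourierInv_fourier_eq, SchwartzMap.fourierInv_lineDerivOp_eq,
    FourierTransform.fourierInv_fourier_eq, ← integral_neg] at ibp
  rw [ibp]
  refine integral_congr_ae (Filter.Eventually.of_forall fun ξ => ?_)
  have ht : (inner ℝ · m : Plane → ℝ).HasTemperateGrowth := by fun_prop
  beta_reduce
  rw [smul_apply, SchwartzMap.smulLeftCLM_apply_apply ht, inner_single_one]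
  simp [dsym]
  ring

/-! ### Limits and approximation of spectra. -/

theorem enorm_fourierInv_sub_le {G H : Plane → ℂ} (hG : Integrable G) (hH : Integrable H)
    (x : Plane) : ‖𝓕⁻ G x - 𝓕⁻ H x‖ₑ ≤ ∫⁻ ξ, ‖G ξ - H ξ‖ₑ := by
  have h : 𝓕⁻ G x - 𝓕⁻ H x = 𝓕⁻ (fun ξ => G ξ - H ξ) x := by
    simp only [Real.fourierInv_eq, smul_sub]
    rw [integral_sub]
    · simpa using (Real.fourierIntegral_convergent_iff (-x)).2 hG
    · simpa using (Real.fourierIntegral_convergent_iff (-x)).2 hH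
  rw [h, Real.fourierInv_eq]
  refine (enorm_integral_le_lintegral_enorm _).trans (le_of_eq (lintegral_congr fun ξ => ?_))
  rw [← ofReal_norm, Circle.norm_smul, ofReal_norm]

theorem tendsto_two_inv_pow_ennreal : Filter.Tendsto (fun n : ℕ => (2⁻¹ : ℝ≥0∞) ^ n) Filter.atTop
    (nhds 0) := ENNReal.tendsto_pow_atTop_nhds_zero_of_lt_one (by simp [ENNReal.inv_lt_one])

/-- Limits of spectra of compositions `𝓕⁻ (g n) ∘ X`. -/
theorem exists_limit_spectrum {X : Plane → Plane} {G : Plane → ℂ} (hG : Integrable G)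
    {g H : ℕ → Plane → ℂ} (hg : ∀ n, Integrable (g n)) (hH : ∀ n, Integrable (H n))
    (heq : ∀ n y, 𝓕⁻ (H n) y = 𝓕⁻ (g n) (X y))
    (hlim : ∀ n, ∫⁻ ξ, ‖g n ξ - G ξ‖ₑ ≤ 2⁻¹ ^ n) (K : ℝ≥0)
    (hC : ∀ n m, ∫⁻ ξ, ‖H n ξ - H m ξ‖ₑ ≤ K * (2⁻¹ ^ n + 2⁻¹ ^ m)) :
    ∃ L : Plane → ℂ, Integrable L ∧ (∀ y, 𝓕⁻ L y = 𝓕⁻ G (X y)) ∧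
      ∀ (r : ℝ) (B : ℕ → ℝ≥0∞) (b : ℝ≥0∞), (∀ n, wn r (H n) ≤ B n) →
        Filter.Tendsto B Filter.atTop (nhds b) → wn r L ≤ b := by
  obtain ⟨L, hL, hlimL⟩ := Lp.cauchy_complete_eLpNorm (μ := (volume : Measure Plane)) (p := 1)
    le_rfl (f := H) (fun n => memLp_one_iff_integrable.2 (hH n))
    -- The Cauchy criterion asks for a strict inequality; the `+ 1` provides it.
    (B := fun N => (2 * K + 1 : ℝ≥0) * 2⁻¹ ^ N) (by
      rw [ENNReal.tsum_mul_left]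
      refine ENNReal.mul_ne_top ENNReal.coe_ne_top ?_
      rw [ENNReal.tsum_geometric]
      simp) (by
      intro N n m hn hm
      rw [eLpNorm_one_eq_lintegral_enorm]
      have hp : ∀ {k : ℕ}, N ≤ k → (2⁻¹ : ℝ≥0∞) ^ k ≤ 2⁻¹ ^ N := fun h =>
        pow_le_pow_right_of_le_one' (by simp [ENNReal.inv_le_one]) h
      calc _ ≤ (K : ℝ≥0∞) * (2⁻¹ ^ n + 2⁻¹ ^ m) := hC n m
        _ ≤ (K : ℝ≥0∞) * (2⁻¹ ^ N + 2⁻¹ ^ N) := mul_le_mul_right (add_le_add (hp hn) (hp hm)) _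
        _ = (K * 2) * (2⁻¹ ^ N) := by ring
        _ < _ := by
          refine (ENNReal.mul_lt_mul_iff_left (by simp) (by
            exact ENNReal.pow_ne_top (by simp))).2 ?_
          norm_cast
          rw [mul_comm]
          exact lt_add_one _)
  have hLi := memLp_one_iff_integrable.1 hL
  refine ⟨L, hLi, fun y => ?_, fun r B b hB hb => ?_⟩
  · have h1 : Filter.Tendsto (fun n => 𝓕⁻ (H n) y) Filter.atTop (nhds (𝓕⁻ L y)) := by
      rw [tendsto_iff_edist_tendsto_0]
      refine tendsto_of_tendsto_of_tendsto_of_le_of_le tendsto_const_nhds hlimL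
        (fun n => bot_le) fun n => ?_
      rw [edist_eq_enorm_sub, eLpNorm_one_eq_lintegral_enorm]
      exact enorm_fourierInv_sub_le (hH n) hLi y
    have h2 : Filter.Tendsto (fun n => 𝓕⁻ (g n) (X y)) Filter.atTop (nhds (𝓕⁻ G (X y))) := by
      rw [tendsto_iff_edist_tendsto_0]
      refine tendsto_of_tendsto_of_tendsto_of_le_of_le tendsto_const_nhds
        tendsto_two_inv_pow_ennreal (fun n => bot_le) fun n => ?_
      rw [edist_eq_enorm_sub]
      exact (enorm_fourierInv_sub_le (hg n) hG _).trans (hlim n)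
    simp only [heq] at h1
    exact tendsto_nhds_unique h1 h2
  -- The convergence is only in `L¹`, so the weighted bound passes to the limit by Fatou's lemma
  -- along an almost everywhere convergent subsequence.
  · obtain ⟨ns, hns, hae⟩ := (tendstoInMeasure_of_tendsto_eLpNorm one_ne_zero
      (fun n => (hH n).1) hLi.1 hlimL).exists_seq_tendsto_ae
    have hf := Lp.eLpNorm_lim_le_liminf_eLpNorm (p := 2) (μ := volume)
      (f := fun n ξ => ((‖ξ‖ ^ r : ℝ) : ℂ) * H (ns n) ξ)
      (fun n => aestronglyMeasurable_weight (hH _).1) (fun ξ => ((‖ξ‖ ^ r : ℝ) : ℂ) * L ξ) (by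
        filter_upwards [hae] with ξ hξ
        exact hξ.const_mul _)
    refine hf.trans ?_
    have hb' := (hb.comp hns.tendsto_atTop).liminf_eq
    rw [← hb']
    exact Filter.liminf_le_liminf (Filter.Eventually.of_forall fun n => hB _)

/-- Simultaneous approximation of a spectrum by Schwartz functions in `L¹` and in a weighted
`L²` space. -/
theorem exists_schwartz_approx {b : ℝ} (hb : 1 < b) {w : Plane → ℝ} (hw : Measurable w)
    {C : ℝ} (h1 : ∀ ξ, ‖ξ‖ ^ b ≤ w ξ) (h2 : ∀ ξ, w ξ ≤ C * (1 + ‖ξ‖ ^ b)) {G : Plane → ℂ}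
    (hG : Integrable G) (hGw : eLpNorm (fun ξ => (w ξ : ℂ) * G ξ) 2 volume < ∞)
    {ε : ℝ≥0∞} (hε : 0 < ε) :
    ∃ φ : 𝓢(Plane, ℂ), ∫⁻ ξ, ‖φ ξ - G ξ‖ₑ ≤ ε ∧
      eLpNorm (fun ξ => (w ξ : ℂ) * (φ ξ - G ξ)) 2 volume ≤ ε := by
  have hwm : Measurable fun ξ => (w ξ : ℂ) := by fun_prop
  have hw0 : ∀ ξ, 0 ≤ w ξ := fun ξ => (Real.rpow_nonneg (norm_nonneg ξ) b).trans (h1 ξ)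
  have hC0 : 0 ≤ C := by
    have := (h1 0).trans (h2 0)
    simp only [norm_zero, Real.zero_rpow (by linarith : b ≠ 0)] at this
    linarith
  -- cutting off the low frequencies
  obtain ⟨δ, hδ, hδ1, hδ2⟩ : ∃ δ : ℝ, 0 < δ ∧ ∫⁻ ξ in Metric.ball (0 : Plane) δ, ‖G ξ‖ₑ ≤ ε / 2 ∧
      ∫⁻ ξ in Metric.ball (0 : Plane) δ, ‖(w ξ : ℂ) * G ξ‖ₑ ^ 2 ≤ (ε / 2) ^ 2 := by
    have hvol : Filter.Tendsto (fun δ : ℝ => volume (Metric.ball (0 : Plane) δ))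
        (nhdsWithin 0 (Set.Ioi 0)) (nhds 0) := by
      have h := tendsto_measure_biInter_gt (μ := (volume : Measure Plane))
        (s := fun δ : ℝ => Metric.ball (0 : Plane) δ) (a := 0)
        (fun r _ => measurableSet_ball.nullMeasurableSet)
        (fun i j _ hij => Metric.ball_subset_ball hij) ⟨1, one_pos, measure_ball_lt_top.ne⟩
      have : (⋂ r > (0 : ℝ), Metric.ball (0 : Plane) r) = {0} := by
        ext x
        simp only [Set.mem_iInter, Metric.mem_ball, dist_zero_right, Set.mem_singleton_iff]
        refine ⟨fun h => norm_le_zero_iff.1 (le_of_forall_gt fun c hc => h c hc), ?_⟩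
        rintro rfl c hc
        simpa using hc
      rw [this, measure_singleton] at h
      exact h
    have t1 := tendsto_setLIntegral_zero (f := fun ξ => ‖G ξ‖ₑ) hG.2.ne hvol
    have hG2 : ∫⁻ ξ, ‖(w ξ : ℂ) * G ξ‖ₑ ^ 2 ≠ ∞ := by
      rw [← eLpNorm_two_sq]
      exact ENNReal.pow_ne_top hGw.ne
    have t2 := tendsto_setLIntegral_zero (f := fun ξ => ‖(w ξ : ℂ) * G ξ‖ₑ ^ 2) hG2 hvol
    have hε2 : 0 < ε / 2 := ENNReal.half_pos hε.ne'
    have hε2' : (0 : ℝ≥0∞) < (ε / 2) ^ 2 := ENNReal.pow_pos hε2 2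
    obtain ⟨δ, ⟨hA, hB⟩, hδ⟩ := (((t1.eventually_le_const hε2).and
      (t2.eventually_le_const hε2')).and self_mem_nhdsWithin).exists
    exact ⟨δ, hδ, hA, hB⟩
  set B := Metric.ball (0 : Plane) δ with hB
  have hBm : MeasurableSet B := measurableSet_ball
  set G' : Plane → ℂ := Bᶜ.indicator G with hG'
  have hG'm : AEStronglyMeasurable G' := hG.1.indicator hBm.compl
  -- the truncated spectrum lies in the smaller space with weight `1 + |ξ|^b`
  set v : Plane → ℝ := fun ξ => 1 + ‖ξ‖ ^ b with hv
  have hvc : Continuous v := continuous_const.add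
    (continuous_norm.rpow_const fun _ => Or.inr (by linarith))
  have hv1 : ∀ ξ, 1 ≤ v ξ := fun ξ => by
    have := Real.rpow_nonneg (norm_nonneg ξ) b
    simp only [hv]; linarith
  have hG'v : eLpNorm (fun ξ => (v ξ : ℂ) * G' ξ) 2 volume < ∞ := by
    have hδb : 0 < δ ^ b := Real.rpow_pos_of_pos hδ b
    have hle := eLpNorm_two_le_mul (f := fun ξ => (v ξ : ℂ) * G' ξ)
      (g := fun ξ => (w ξ : ℂ) * G ξ) (Real.toNNReal ((δ ^ b)⁻¹ + 1)) (by
        refine Filter.Eventually.of_forall fun ξ => ?_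
        rw [Real.coe_toNNReal _ (by positivity)]
        by_cases hξ : ξ ∈ B
        · have : G' ξ = 0 := by simp [hG', hξ]
          rw [this]
          simp only [mul_zero, norm_zero]
          positivity
        · have : G' ξ = G ξ := by simp [hG', hξ]
          rw [this, norm_mul, norm_mul, Complex.norm_real, Complex.norm_real,
            Real.norm_of_nonneg (hw0 ξ), Real.norm_of_nonneg (by linarith [hv1 ξ]), ← mul_assoc]
          gcongr
          have hξ' : δ ≤ ‖ξ‖ := by simpa [hB] using hξ
          have h3 : δ ^ b ≤ ‖ξ‖ ^ b := by gcongr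
          have h4 : 1 ≤ (δ ^ b)⁻¹ * ‖ξ‖ ^ b := by
            rw [inv_mul_eq_div, le_div_iff₀ hδb]; linarith
          calc v ξ = 1 + ‖ξ‖ ^ b := rfl
            _ ≤ ((δ ^ b)⁻¹ + 1) * ‖ξ‖ ^ b := by linarith
            _ ≤ _ := by gcongr; exact h1 ξ)
    exact hle.trans_lt (ENNReal.mul_lt_top ENNReal.coe_lt_top hGw)
  -- Smooth compactly supported functions are dense in `L²(μ)`. Closeness there controls the `L¹`
  -- norm, through the orders 0 and `b`, and also the weight `w ≤ C * v`.
  set μ : Measure Plane := volume.withDensity fun ξ => ENNReal.ofReal (v ξ ^ 2) with hμ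
  have : IsLocallyFiniteMeasure μ := .withDensity_ofReal (hvc.pow 2)
  have hnorm : ∀ F : Plane → ℂ, AEStronglyMeasurable F →
      eLpNorm F 2 μ = eLpNorm (fun ξ => (v ξ : ℂ) * F ξ) 2 volume := by
    intro F hF
    rw [eLpNorm_two_eq, eLpNorm_eq_lintegral_rpow_enorm_toReal (by norm_num) (by norm_num), hμ,
      lintegral_withDensity_eq_lintegral_mul₀ (by fun_prop) (by
        exact hF.enorm.pow_const _)]
    norm_num
    congr 1
    refine lintegral_congr fun ξ => ?_
    rw [mul_pow, ENNReal.ofReal_pow (by linarith [hv1 ξ]), ← ofReal_norm (v ξ : ℂ),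
      Complex.norm_real, Real.norm_of_nonneg (by linarith [hv1 ξ])]
  have hG'μ : MemLp G' 2 μ := ⟨hG'm.mono_ac (withDensity_absolutelyContinuous _ _), by
    rw [hnorm G' hG'm]; exact hG'v⟩
  obtain ⟨K, hK⟩ := exists_lintegral_le_wn (a := 0) (b := b) one_pos hb
  obtain ⟨κ, hκ, hκK, hκC⟩ : ∃ κ : ℝ, 0 < κ ∧ K * (2 * ENNReal.ofReal κ) ≤ ε / 2 ∧
      ENNReal.ofReal C * ENNReal.ofReal κ ≤ ε / 2 := by
    have hε2 : 0 < ε / 2 := ENNReal.half_pos hε.ne'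
    have c1 : Filter.Tendsto (fun κ : ℝ => (K : ℝ≥0∞) * (2 * ENNReal.ofReal κ))
        (nhdsWithin 0 (Set.Ioi 0)) (nhds 0) := by
      have : Filter.Tendsto (fun κ : ℝ => (K : ℝ≥0∞) * (2 * ENNReal.ofReal κ)) (nhds 0)
          (nhds ((K : ℝ≥0∞) * (2 * ENNReal.ofReal 0))) := by
        refine ENNReal.Tendsto.const_mul (ENNReal.Tendsto.const_mul
          (ENNReal.tendsto_ofReal Filter.tendsto_id) (Or.inr (by simp))) (Or.inr (by simp))
      simp only [ENNReal.ofReal_zero, mul_zero] at this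
      exact this.mono_left nhdsWithin_le_nhds
    have c2 : Filter.Tendsto (fun κ : ℝ => ENNReal.ofReal C * ENNReal.ofReal κ)
        (nhdsWithin 0 (Set.Ioi 0)) (nhds 0) := by
      have : Filter.Tendsto (fun κ : ℝ => ENNReal.ofReal C * ENNReal.ofReal κ) (nhds 0)
          (nhds (ENNReal.ofReal C * ENNReal.ofReal 0)) :=
        ENNReal.Tendsto.const_mul (ENNReal.tendsto_ofReal Filter.tendsto_id) (Or.inr (by simp))
      simp only [ENNReal.ofReal_zero, mul_zero] at this
      exact this.mono_left nhdsWithin_le_nhds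
    obtain ⟨κ, ⟨hA, hB⟩, hδ⟩ := (((c1.eventually_le_const hε2).and
      (c2.eventually_le_const hε2)).and self_mem_nhdsWithin).exists
    exact ⟨κ, hδ, hA, hB⟩
  obtain ⟨g, hgc, hgs, hg⟩ := MemLp.exist_eLpNorm_sub_le (p := 2) (by norm_num) (by norm_num)
    hG'μ hκ
  have hgm : AEStronglyMeasurable g := hgs.continuous.aestronglyMeasurable
  set D : Plane → ℂ := fun ξ => g ξ - G' ξ with hD
  have hDm : AEStronglyMeasurable D := hgm.sub hG'm
  have hDv : eLpNorm (fun ξ => (v ξ : ℂ) * D ξ) 2 volume ≤ ENNReal.ofReal κ := by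
    rw [← hnorm D hDm]
    rw [eLpNorm_sub_comm] at hg
    exact hg
  have hDw : ∀ (c : ℝ≥0) (u : Plane → ℝ), (∀ ξ, |u ξ| ≤ c * v ξ) →
      eLpNorm (fun ξ => (u ξ : ℂ) * D ξ) 2 volume ≤ c * ENNReal.ofReal κ := by
    intro c u hu
    refine (eLpNorm_two_le_mul (g := fun ξ => (v ξ : ℂ) * D ξ) c
      (Filter.Eventually.of_forall fun ξ => ?_)).trans (by gcongr)
    rw [norm_mul, norm_mul, Complex.norm_real, Complex.norm_real, Real.norm_eq_abs,
      Real.norm_of_nonneg (by linarith [hv1 ξ]), ← mul_assoc]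
    gcongr
    exact hu ξ
  have hD1 : ∫⁻ ξ, ‖D ξ‖ₑ ≤ ε / 2 := by
    refine (hK D hDm).trans (le_trans ?_ hκK)
    rw [two_mul]
    gcongr
    · have := hDw 1 (fun ξ => ‖ξ‖ ^ (0 : ℝ)) (fun ξ => by simpa using hv1 ξ)
      simpa [wn] using this
    · have := hDw 1 (fun ξ => ‖ξ‖ ^ b) (fun ξ => by
        rw [abs_of_nonneg (by positivity)]; simp [hv])
      simpa [wn] using this
  have hsplit : ∀ ξ, g ξ - G ξ = D ξ - B.indicator G ξ := by
    intro ξ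
    have : G ξ = G' ξ + B.indicator G ξ := (Set.indicator_compl_add_self_apply B G ξ).symm
    rw [this, hD]; ring
  refine ⟨hgc.toSchwartzMap hgs, ?_, ?_⟩
  · simp only [HasCompactSupport.toSchwartzMap_toFun, hsplit]
    calc ∫⁻ ξ, ‖D ξ - B.indicator G ξ‖ₑ ≤ ∫⁻ ξ, (‖D ξ‖ₑ + ‖B.indicator G ξ‖ₑ) :=
          lintegral_mono fun ξ => enorm_sub_le
      _ = (∫⁻ ξ, ‖D ξ‖ₑ) + ∫⁻ ξ, ‖B.indicator G ξ‖ₑ := lintegral_add_left' hDm.enorm _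
      _ ≤ ε / 2 + ε / 2 := by
          gcongr
          simp only [enorm_indicator_eq_indicator_enorm]
          rw [lintegral_indicator hBm]
          exact hδ1
      _ = ε := ENNReal.add_halves ε
  · simp only [HasCompactSupport.toSchwartzMap_toFun, hsplit]
    have hle := eLpNorm_two_le_add (f := fun ξ => (w ξ : ℂ) * (D ξ - B.indicator G ξ))
      (g := fun ξ => (w ξ : ℂ) * D ξ) (h := fun ξ => (w ξ : ℂ) * B.indicator G ξ) (c := 1) (d := 1)
      (hwm.aestronglyMeasurable.mul hDm) (hwm.aestronglyMeasurable.mul (hG.1.indicator hBm))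
      (Filter.Eventually.of_forall fun ξ => by
        simp only [NNReal.coe_one, one_mul, mul_sub]
        exact norm_sub_le _ _)
    refine hle.trans ?_
    simp only [ENNReal.coe_one, one_mul]
    rw [← ENNReal.add_halves ε]
    gcongr
    · refine (hDw C.toNNReal w (fun ξ => ?_)).trans ?_
      · rw [abs_of_nonneg (hw0 ξ), Real.coe_toNNReal _ hC0]
        exact h2 ξ
      · exact hκC
    · rw [← ENNReal.rpow_le_rpow_iff (z := 2) (by norm_num), ENNReal.rpow_two, ENNReal.rpow_two,
        eLpNorm_two_sq]
      refine le_trans (le_of_eq ?_) hδ2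
      rw [← lintegral_indicator hBm]
      refine lintegral_congr fun ξ => ?_
      by_cases hξ : ξ ∈ B <;> simp [hξ]

/-! ### The Gagliardo seminorm and its Fourier symbol. -/

/-- The squared Gagliardo seminorm of order `θ`. -/
noncomputable def gag (θ : ℝ) (F : Plane → ℂ) : ℝ≥0∞ :=
  ∫⁻ h : Plane, ENNReal.ofReal (‖h‖ ^ (-(2 + 2 * θ))) * ∫⁻ x, ‖F (x + h) - F x‖ₑ ^ 2

theorem norm_fourierChar_sub_one (t : ℝ) :
    ‖(Real.fourierChar t : ℂ) - 1‖ = |2 * Real.sin (Real.pi * t)| := by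
  have h : (Real.fourierChar t : ℂ) = Complex.exp (Complex.I * ((2 * Real.pi * t : ℝ) : ℂ)) := by
    rw [Real.fourierChar_apply]; congr 1; ring
  rw [h, Complex.norm_exp_I_mul_ofReal_sub_one, Real.norm_eq_abs]
  congr 3; ring

theorem enorm_fourierChar_sub_one_sq (t : ℝ) :
    ‖(Real.fourierChar t : ℂ) - 1‖ₑ ^ 2 = ENNReal.ofReal ((2 * Real.sin (Real.pi * t)) ^ 2) := by
  rw [← ofReal_norm, norm_fourierChar_sub_one, ← ENNReal.ofReal_pow (abs_nonneg _), sq_abs]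

theorem fourier_comp_add_right (F : Plane → ℂ) (h ξ : Plane) :
    𝓕 (fun x => F (x + h)) ξ = (Real.fourierChar (inner ℝ h ξ) : ℂ) * 𝓕 F ξ := by
  have := congrFun (VectorFourier.fourierIntegral_comp_add_right Real.fourierChar volume
    (innerₗ Plane) F h) ξ
  simpa [Circle.smul_def] using! this

theorem integrable_fourierInv_integrand {G : Plane → ℂ} (hG : Integrable G) (x : Plane) :
    Integrable fun v => Real.fourierChar (inner ℝ v x) • G v := by
  simpa using (Real.fourierIntegral_convergent_iff (-x)).2 hG

theorem fourierInv_translate_sub {G : Plane → ℂ} (hG : Integrable G) (h x : Plane) :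
    𝓕⁻ G (x + h) - 𝓕⁻ G x = 𝓕⁻ (fun ξ => ((Real.fourierChar (inner ℝ h ξ) : ℂ) - 1) * G ξ) x := by
  simp only [Real.fourierInv_eq]
  rw [← integral_sub]
  · refine integral_congr_ae (Filter.Eventually.of_forall fun ξ => ?_)
    simp only [Circle.smul_def, smul_eq_mul, inner_add_right, AddChar.map_add_eq_mul,
      Circle.coe_mul, real_inner_comm h ξ]
    ring
  · exact integrable_fourierInv_integrand hG (x + h)
  · exact integrable_fourierInv_integrand hG x

theorem continuous_fourierChar_inner (h : Plane) :
    Continuous fun ξ : Plane => (Real.fourierChar (inner ℝ h ξ) : ℂ) := by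
  have := Real.continuous_fourierChar
  fun_prop

/-- Plancherel, since translation multiplies the Fourier transform by a character. -/
theorem lintegral_translate_sub_sq {F : Plane → ℂ} (h1 : Integrable F) (h2 : MemLp F 2 volume)
    (h : Plane) : ∫⁻ x, ‖F (x + h) - F x‖ₑ ^ 2 =
      ∫⁻ ξ, ENNReal.ofReal ((2 * Real.sin (Real.pi * inner ℝ h ξ)) ^ 2) * ‖𝓕 F ξ‖ₑ ^ 2 := by
  have i1 : Integrable fun x => F (x + h) := h1.comp_add_right h
  have i2 : MemLp (fun x => F (x + h)) 2 volume :=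
    h2.comp_measurePreserving (measurePreserving_add_right volume h)
  have e := eLpNorm_fourier_eq (i1.sub h1) (i2.sub h2)
  rw [← eLpNorm_two_sq (fun x => F (x + h) - F x)]
  change eLpNorm ((fun x => F (x + h)) - F) 2 volume ^ 2 = _
  rw [← e, eLpNorm_two_sq]
  refine lintegral_congr fun ξ => ?_
  have : 𝓕 ((fun x => F (x + h)) - F) ξ = ((Real.fourierChar (inner ℝ h ξ) : ℂ) - 1) * 𝓕 F ξ := by
    rw [sub_mul, one_mul, ← fourier_comp_add_right]
    simp only [Real.fourier_eq, Pi.sub_apply, smul_sub]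
    rw [integral_sub]
    · exact (Real.fourierIntegral_convergent_iff ξ).2 i1
    · exact (Real.fourierIntegral_convergent_iff ξ).2 h1
  rw [this, enorm_mul, mul_pow, enorm_fourierChar_sub_one_sq]

/-- Square integrability is asked only of the spectrum of the difference, whose symbol vanishes at
the origin. `G` itself may fail to be in `L²` at low frequencies. -/
theorem lintegral_translate_sub_sq' {G : Plane → ℂ} (hG : Integrable G) (h : Plane)
    (h2 : MemLp (fun ξ => ((Real.fourierChar (inner ℝ h ξ) : ℂ) - 1) * G ξ) 2 volume) :
    ∫⁻ x, ‖𝓕⁻ G (x + h) - 𝓕⁻ G x‖ₑ ^ 2 =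
      ∫⁻ ξ, ENNReal.ofReal ((2 * Real.sin (Real.pi * inner ℝ h ξ)) ^ 2) * ‖G ξ‖ₑ ^ 2 := by
  simp only [fourierInv_translate_sub hG]
  rw [← eLpNorm_two_sq, eLpNorm_fourierInv_eq _ h2, eLpNorm_two_sq]
  · refine lintegral_congr fun ξ => ?_
    rw [enorm_mul, mul_pow, enorm_fourierChar_sub_one_sq]
  · refine hG.bdd_mul (c := 2)
      ((continuous_fourierChar_inner h).sub continuous_const).aestronglyMeasurable
      (Filter.Eventually.of_forall fun ξ => ?_)
    rw [norm_fourierChar_sub_one, abs_mul, abs_two]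
    linarith [Real.abs_sin_le_one (Real.pi * inner ℝ h ξ)]

/-- The symbol of the squared Gagliardo seminorm. -/
noncomputable def gagSymbol (θ : ℝ) (ξ : Plane) : ℝ≥0∞ :=
  ∫⁻ h : Plane, ENNReal.ofReal (‖h‖ ^ (-(2 + 2 * θ))) *
    ENNReal.ofReal ((2 * Real.sin (Real.pi * inner ℝ h ξ)) ^ 2)

theorem exists_isometry_map_eq {e ξ : Plane} (h : ‖e‖ = ‖ξ‖) :
    ∃ R : Plane ≃ₗᵢ[ℝ] Plane, R e = ξ :=
  ⟨_, Submodule.reflection_sub h⟩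

theorem lintegral_smul_eq (f : Plane → ℝ≥0∞) {c : ℝ} (hc : 0 < c) :
    ∫⁻ h, f h = ENNReal.ofReal (c ^ 2) * ∫⁻ h, f (c • h) := by
  have hm : MeasurableEmbedding fun h : Plane => c • h :=
    (Homeomorph.smulOfNeZero c hc.ne').measurableEmbedding
  have e : ∫⁻ h, f (c • h) = ∫⁻ h, f h ∂(Measure.map (c • ·) volume) :=
    (hm.lintegral_map _).symm
  rw [e, Measure.map_addHaar_smul _ hc.ne', lintegral_smul_measure, smul_eq_mul, ← mul_assoc,
    ← ENNReal.ofReal_mul (by positivity), abs_of_pos (by positivity)]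
  simp [hc.ne']

/-- The substitution `h ↦ ‖ξ‖⁻¹ • R h`, with an isometry `R` taking the unit vector to the direction
of `ξ`, reduces to that unit vector. -/
theorem gagSymbol_eq (θ : ℝ) {ξ : Plane} (hξ : 0 < ‖ξ‖) :
    gagSymbol θ ξ = ENNReal.ofReal (‖ξ‖ ^ (2 * θ)) *
      gagSymbol θ (EuclideanSpace.single 0 1) := by
  set e : Plane := EuclideanSpace.single 0 1
  have he : ‖e‖ = 1 := by simp [e]
  obtain ⟨R, hR⟩ := exists_isometry_map_eq (e := e) (ξ := ‖ξ‖⁻¹ • ξ) (by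
    rw [he, norm_smul, norm_inv, norm_norm, inv_mul_cancel₀ hξ.ne'])
  rw [gagSymbol, lintegral_smul_eq _ (inv_pos.2 hξ),
    ← R.measurePreserving.lintegral_comp_emb R.toHomeomorph.measurableEmbedding, gagSymbol,
    ← lintegral_const_mul' _ _ ENNReal.ofReal_ne_top,
    ← lintegral_const_mul' _ _ ENNReal.ofReal_ne_top]
  refine lintegral_congr fun h => ?_
  have hin : inner ℝ (‖ξ‖⁻¹ • R h) ξ = inner ℝ h e := by
    have h1 : inner ℝ (R h) (R e) = inner ℝ h e := R.inner_map_map h e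
    rw [hR, inner_smul_right] at h1
    rw [inner_smul_left, ← h1]
    simp
  rw [hin, ← mul_assoc, ← mul_assoc]
  congr 1
  rw [← ENNReal.ofReal_mul (by positivity), ← ENNReal.ofReal_mul (by positivity), norm_smul,
    R.norm_map, norm_inv, norm_norm, Real.mul_rpow (by positivity) (norm_nonneg _), ← mul_assoc]
  congr 2
  rw [Real.inv_rpow hξ.le, ← Real.rpow_neg hξ.le, neg_neg, Real.rpow_add hξ, Real.rpow_two]
  field_simp

/-- Near the origin the sine squared is quadratic, which beats the kernel for `θ < 1`; at infinity
it is bounded, which suffices for `θ > 0`. -/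
theorem gagSymbol_lt_top {θ : ℝ} (h0 : 0 < θ) (h1 : θ < 1) :
    gagSymbol θ (EuclideanSpace.single 0 1) < ∞ := by
  rw [gagSymbol, ← lintegral_add_compl _ (measurableSet_ball (x := (0 : Plane)) (ε := 1))]
  refine ENNReal.add_lt_top.2 ⟨?_, ?_⟩
  · refine lt_of_le_of_lt (b := ∫⁻ ξ in Metric.ball (0 : Plane) 1,
      ENNReal.ofReal ((2 * Real.pi) ^ 2) * ENNReal.ofReal (‖ξ‖ ^ (-2 * θ))) ?_ ?_
    · refine lintegral_mono_ae (ae_restrict_of_ae ?_)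
      filter_upwards [ae_norm_pos] with h hh
      rw [← ENNReal.ofReal_mul (by positivity), ← ENNReal.ofReal_mul (by positivity)]
      refine ENNReal.ofReal_le_ofReal ?_
      have hs : (2 * Real.sin (Real.pi * inner ℝ h (EuclideanSpace.single 0 1))) ^ 2 ≤
          (2 * Real.pi) ^ 2 * ‖h‖ ^ 2 := by
        rw [inner_single_one, ← mul_pow, sq_le_sq, abs_mul, abs_two,
          abs_of_nonneg (by positivity : 0 ≤ 2 * Real.pi * ‖h‖), mul_assoc]
        gcongr
        refine Real.abs_sin_le_abs.trans ?_
        rw [abs_mul, abs_of_pos Real.pi_pos]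
        gcongr
        simpa using PiLp.norm_apply_le h 0
      calc _ ≤ ‖h‖ ^ (-(2 + 2 * θ)) * ((2 * Real.pi) ^ 2 * ‖h‖ ^ 2) := by gcongr
        _ = (2 * Real.pi) ^ 2 * (‖h‖ ^ (-(2 + 2 * θ)) * ‖h‖ ^ (2 : ℝ)) := by
            rw [Real.rpow_two]; ring
        _ = _ := by
            rw [← Real.rpow_add hh]; ring_nf
    · rw [lintegral_const_mul' _ _ ENNReal.ofReal_ne_top]
      exact ENNReal.mul_lt_top ENNReal.ofReal_lt_top
        (lintegral_rpow_norm_ball_lt_top (by linarith))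
  · refine lt_of_le_of_lt (b := ∫⁻ ξ in (Metric.ball (0 : Plane) 1)ᶜ,
      ENNReal.ofReal 4 * ENNReal.ofReal (‖ξ‖ ^ (-(2 + 2 * θ)))) ?_ ?_
    · refine lintegral_mono fun h => ?_
      rw [mul_comm]
      gcongr
      nlinarith [Real.sin_sq_le_one (Real.pi * inner ℝ h (EuclideanSpace.single 0 1 : Plane))]
    · rw [lintegral_const_mul' _ _ ENNReal.ofReal_ne_top]
      exact ENNReal.mul_lt_top ENNReal.ofReal_lt_top
        (lintegral_rpow_norm_compl_ball_lt_top (by linarith))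

theorem gagSymbol_pos (θ : ℝ) : 0 < gagSymbol θ (EuclideanSpace.single 0 1) := by
  rw [gagSymbol, lintegral_pos_iff_support (by fun_prop)]
  have hopen : IsOpen {h : Plane | h 0 ∈ Set.Ioo (0 : ℝ) 1} :=
    isOpen_Ioo.preimage (by fun_prop)
  refine lt_of_lt_of_le (hopen.measure_pos volume ⟨EuclideanSpace.single 0 (1 / 2), ?_⟩)
    (measure_mono fun h hh => ?_)
  · norm_num
  · have hh' : 0 < h 0 ∧ h 0 < 1 := hh
    have hne : h ≠ 0 := by rintro rfl; simp at hh'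
    have hsin : 0 < Real.sin (Real.pi * h 0) := Real.sin_pos_of_pos_of_lt_pi
      (mul_pos Real.pi_pos hh'.1) (by nlinarith [Real.pi_pos])
    rw [Function.mem_support, inner_single_one]
    refine (ENNReal.mul_pos ?_ ?_).ne'
    · simp only [ne_eq, ENNReal.ofReal_eq_zero, not_le]
      exact Real.rpow_pos_of_pos (norm_pos_iff.2 hne) _
    · simp only [ne_eq, ENNReal.ofReal_eq_zero, not_le]
      positivity

theorem wn_sq (r : ℝ) (G : Plane → ℂ) :
    wn r G ^ 2 = ∫⁻ ξ, ENNReal.ofReal (‖ξ‖ ^ (2 * r)) * ‖G ξ‖ₑ ^ 2 := by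
  rw [wn_eq, ← ENNReal.rpow_natCast, ← ENNReal.rpow_mul]
  simp

/-- Tonelli, then the homogeneity of the symbol. -/
theorem lintegral_symbol_swap (θ : ℝ) {G : Plane → ℂ} (hG : AEStronglyMeasurable G) :
    ∫⁻ h : Plane, ENNReal.ofReal (‖h‖ ^ (-(2 + 2 * θ))) *
      ∫⁻ ξ, ENNReal.ofReal ((2 * Real.sin (Real.pi * inner ℝ h ξ)) ^ 2) * ‖G ξ‖ₑ ^ 2 =
    gagSymbol θ (EuclideanSpace.single 0 1) * wn θ G ^ 2 := by
  calc _ = ∫⁻ h : Plane, ∫⁻ ξ, ENNReal.ofReal (‖h‖ ^ (-(2 + 2 * θ))) *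
        (ENNReal.ofReal ((2 * Real.sin (Real.pi * inner ℝ h ξ)) ^ 2) * ‖G ξ‖ₑ ^ 2) := by
        refine lintegral_congr fun h => ?_
        rw [lintegral_const_mul' _ _ ENNReal.ofReal_ne_top]
    _ = ∫⁻ ξ, ∫⁻ h : Plane, ENNReal.ofReal (‖h‖ ^ (-(2 + 2 * θ))) *
        (ENNReal.ofReal ((2 * Real.sin (Real.pi * inner ℝ h ξ)) ^ 2) * ‖G ξ‖ₑ ^ 2) := by
        refine lintegral_lintegral_swap ?_
        have h1 : Measurable fun p : Plane × Plane => ENNReal.ofReal (‖p.1‖ ^ (-(2 + 2 * θ))) := by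
          fun_prop
        have h2 : Measurable fun p : Plane × Plane =>
          ENNReal.ofReal ((2 * Real.sin (Real.pi * inner ℝ p.1 p.2)) ^ 2) := by fun_prop
        have h3 : AEMeasurable (fun p : Plane × Plane => ‖G p.2‖ₑ ^ 2) (volume.prod volume) :=
          (hG.enorm.pow_const 2).comp_quasiMeasurePreserving Measure.quasiMeasurePreserving_snd
        exact h1.aemeasurable.mul (h2.aemeasurable.mul h3)
    _ = ∫⁻ ξ, gagSymbol θ ξ * ‖G ξ‖ₑ ^ 2 := by
        refine lintegral_congr fun ξ => ?_
        simp only [← mul_assoc]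
        rw [lintegral_mul_const' _ _ (by simp), gagSymbol]
    _ = ∫⁻ ξ, gagSymbol θ (EuclideanSpace.single 0 1) *
          (ENNReal.ofReal (‖ξ‖ ^ (2 * θ)) * ‖G ξ‖ₑ ^ 2) := by
        refine lintegral_congr_ae ?_
        filter_upwards [ae_norm_pos] with ξ hξ
        rw [gagSymbol_eq θ hξ]
        ring
    _ = _ := by
        rw [lintegral_const_mul'', wn_sq]
        exact AEMeasurable.mul (by fun_prop) (hG.enorm.pow_const 2)

theorem gag_eq_wn_fourier (θ : ℝ) {F : Plane → ℂ} (h1 : Integrable F) (h2 : MemLp F 2 volume) :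
    gag θ F = gagSymbol θ (EuclideanSpace.single 0 1) * wn θ (𝓕 F) ^ 2 := by
  rw [← lintegral_symbol_swap θ (continuous_fourier_of_integrable h1).aestronglyMeasurable, gag]
  simp only [lintegral_translate_sub_sq h1 h2]

theorem gag_fourierInv_eq {θ : ℝ} (h0 : 0 < θ) (hθ : θ < 1) {G : Plane → ℂ} (hG : Integrable G)
    (hw : wn θ G < ∞) :
    gag θ (𝓕⁻ G) = gagSymbol θ (EuclideanSpace.single 0 1) * wn θ G ^ 2 := by
  rw [← lintegral_symbol_swap θ hG.1, gag]
  refine lintegral_congr fun h => ?_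
  rw [lintegral_translate_sub_sq' hG h]
  refine ⟨((continuous_fourierChar_inner h).sub continuous_const).aestronglyMeasurable.mul hG.1, ?_⟩
  refine (eLpNorm_two_le_mul (g := fun ξ => ((‖ξ‖ ^ θ : ℝ) : ℂ) * G ξ)
    (Real.toNNReal (2 * (2 * Real.pi * ‖h‖) ^ θ)) (Filter.Eventually.of_forall fun ξ => ?_)).trans_lt
    (ENNReal.mul_lt_top ENNReal.coe_lt_top hw)
  rw [Real.coe_toNNReal _ (by positivity), norm_weight_mul, norm_mul, norm_fourierChar_sub_one,
    ← mul_assoc, mul_assoc 2 _ (‖ξ‖ ^ θ), ← Real.mul_rpow (by positivity) (norm_nonneg ξ)]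
  gcongr
  -- The symbol is at most `min u 2`, and `min u 2 ≤ 2 * u ^ θ` for `0 < θ < 1`.
  set u := 2 * Real.pi * ‖h‖ * ‖ξ‖ with hu
  have hu0 : 0 ≤ u := by positivity
  have hle : |2 * Real.sin (Real.pi * inner ℝ h ξ)| ≤ u := by
    rw [abs_mul, abs_two, hu]
    have h3 := abs_real_inner_le_norm h ξ
    have h4 := (Real.abs_sin_le_abs (x := Real.pi * inner ℝ h ξ))
    rw [abs_mul, abs_of_pos Real.pi_pos] at h4
    nlinarith [Real.pi_pos, mul_le_mul_of_nonneg_left h3 Real.pi_pos.le]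
  have hle2 : |2 * Real.sin (Real.pi * inner ℝ h ξ)| ≤ 2 := by
    rw [abs_mul, abs_two]
    linarith [Real.abs_sin_le_one (Real.pi * inner ℝ h ξ)]
  rcases le_total u 1 with hu1 | hu1
  · rcases hu0.eq_or_lt with h5 | h5
    · rw [← h5] at hle ⊢
      rw [Real.zero_rpow h0.ne']
      linarith
    · have := Real.rpow_le_rpow_of_exponent_ge h5 hu1 hθ.le
      rw [Real.rpow_one] at this
      linarith
  · have := Real.one_le_rpow hu1 h0.le
    linarith

/-! ### Bi-Lipschitz changes of variables. -/

/-- Volume is a multiple of two-dimensional Hausdorff measure, which scales by at most `K ^ 2` under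
such preimages. No Jacobian determinant is involved. -/
theorem volume_preimage_le_of_antilipschitz {Z : Plane → Plane} {K : ℝ≥0}
    (hZ : AntilipschitzWith K Z) (S : Set Plane) :
    volume (Z ⁻¹' S) ≤ (K : ℝ≥0∞) ^ 2 * volume S := by
  have e : (volume : Measure Plane) =
      (volume : Measure Plane).addHaarScalarFactor (Measure.hausdorffMeasure (2 : ℕ)) •
        Measure.hausdorffMeasure (2 : ℕ) := Measure.isAddLeftInvariant_eq_smul _ _
  rw [e]
  simp only [Measure.smul_apply, ENNReal.smul_def, smul_eq_mul]
  have h := hZ.hausdorffMeasure_preimage_le (d := ((2 : ℕ) : ℝ)) (by norm_num) S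
  rw [ENNReal.rpow_natCast] at h
  calc _ ≤ _ * ((K : ℝ≥0∞) ^ 2 * _) := mul_le_mul_right h _
    _ = _ := by ring

/-- Change of variables inequality for antilipschitz maps. -/
theorem lintegral_comp_le_of_antilipschitz {Z : Plane → Plane} {K : ℝ≥0}
    (hZ : AntilipschitzWith K Z) (hZm : Measurable Z) {q : Plane → ℝ≥0∞} (hq : Measurable q) :
    ∫⁻ y, q (Z y) ≤ (K : ℝ≥0∞) ^ 2 * ∫⁻ z, q z := by
  have hle : Measure.map Z volume ≤ ((K : ℝ≥0∞) ^ 2) • (volume : Measure Plane) := by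
    refine Measure.le_iff.2 fun S hS => ?_
    rw [Measure.map_apply hZm hS]
    exact volume_preimage_le_of_antilipschitz hZ S
  rw [← lintegral_map hq hZm, ← smul_eq_mul, ← lintegral_smul_measure]
  exact lintegral_mono' hle le_rfl

theorem eLpNorm_comp_le_of_antilipschitz {Z : Plane → Plane} {K : ℝ≥0}
    (hZ : AntilipschitzWith K Z) (hZc : Continuous Z) {F : Plane → ℂ} (hF : Continuous F) :
    eLpNorm (fun y => F (Z y)) 2 volume ≤ K * eLpNorm F 2 volume := by
  rw [← ENNReal.rpow_le_rpow_iff (z := 2) (by norm_num), ENNReal.rpow_two, ENNReal.rpow_two,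
    mul_pow, eLpNorm_two_sq, eLpNorm_two_sq]
  exact lintegral_comp_le_of_antilipschitz hZ hZc.measurable
    (q := fun z => ‖F z‖ₑ ^ 2) (by fun_prop)

theorem integrable_comp_of_antilipschitz {Z : Plane → Plane} {K : ℝ≥0}
    (hZ : AntilipschitzWith K Z) (hZc : Continuous Z) {F : Plane → ℂ} (hF : Continuous F)
    (hi : Integrable F) : Integrable fun y => F (Z y) := by
  refine ⟨(hF.comp hZc).aestronglyMeasurable, ?_⟩
  exact (lintegral_comp_le_of_antilipschitz hZ hZc.measurable (q := fun z => ‖F z‖ₑ)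
    (by fun_prop)).trans_lt (ENNReal.mul_lt_top (by simp) hi.2)

theorem memLp_comp_of_antilipschitz {Z : Plane → Plane} {K : ℝ≥0}
    (hZ : AntilipschitzWith K Z) (hZc : Continuous Z) {F : Plane → ℂ} (hF : Continuous F)
    (hi : MemLp F 2 volume) : MemLp (fun y => F (Z y)) 2 volume :=
  ⟨(hF.comp hZc).aestronglyMeasurable, (eLpNorm_comp_le_of_antilipschitz hZ hZc hF).trans_lt
    (ENNReal.mul_lt_top (by simp) hi.2)⟩

theorem gag_eq_double (θ : ℝ) {F : Plane → ℂ} (hF : Continuous F) :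
    gag θ F = ∫⁻ x, ∫⁻ y, ENNReal.ofReal (‖y - x‖ ^ (-(2 + 2 * θ))) * ‖F y - F x‖ₑ ^ 2 := by
  rw [gag]
  calc _ = ∫⁻ h : Plane, ∫⁻ x, ENNReal.ofReal (‖h‖ ^ (-(2 + 2 * θ))) * ‖F (x + h) - F x‖ₑ ^ 2 := by
        refine lintegral_congr fun h => ?_
        rw [lintegral_const_mul' _ _ ENNReal.ofReal_ne_top]
    _ = ∫⁻ x, ∫⁻ h : Plane, ENNReal.ofReal (‖h‖ ^ (-(2 + 2 * θ))) * ‖F (x + h) - F x‖ₑ ^ 2 := by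
        refine lintegral_lintegral_swap (Measurable.aemeasurable ?_)
        have h1 : Measurable fun p : Plane × Plane => ENNReal.ofReal (‖p.1‖ ^ (-(2 + 2 * θ))) := by
          fun_prop
        have h2 : Measurable fun p : Plane × Plane => ‖F (p.2 + p.1) - F p.2‖ₑ ^ 2 := by
          fun_prop
        exact h1.mul h2
    _ = _ := by
        refine lintegral_congr fun x => ?_
        rw [← lintegral_add_left_eq_self
          (fun y => ENNReal.ofReal (‖y - x‖ ^ (-(2 + 2 * θ))) * ‖F y - F x‖ₑ ^ 2) x]
        simp

/-- The Lipschitz bound compares the kernels at `(x, y)` and `(X x, X y)`. Then both variables are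
substituted, each at the cost `K ^ 2`. -/
theorem gag_comp_le (θ : ℝ) (hθ : 0 < θ) {X : Plane → Plane} {K L : ℝ≥0} (hX : AntilipschitzWith K X)
    (hL : LipschitzWith L X) {F : Plane → ℂ} (hF : Continuous F) :
    gag θ (fun y => F (X y)) ≤
      ENNReal.ofReal ((L : ℝ) ^ (2 + 2 * θ)) * ((K : ℝ≥0∞) ^ 2 * ((K : ℝ≥0∞) ^ 2 * gag θ F)) := by
  have hFX : Continuous fun y => F (X y) := hF.comp hL.continuous
  rw [gag_eq_double θ hF, gag_eq_double θ hFX]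
  have hXm := hL.continuous.measurable
  set q : Plane → Plane → ℝ≥0∞ := fun a z =>
    ENNReal.ofReal (‖z - a‖ ^ (-(2 + 2 * θ))) * ‖F z - F a‖ₑ ^ 2 with hq
  have hqm : Measurable (Function.uncurry q) := by
    have h1 : Measurable fun p : Plane × Plane =>
      ENNReal.ofReal (‖p.2 - p.1‖ ^ (-(2 + 2 * θ))) := by fun_prop
    have h2 : Measurable fun p : Plane × Plane => ‖F p.2 - F p.1‖ₑ ^ 2 := by fun_prop
    exact h1.mul h2
  have hpt : ∀ x y, ENNReal.ofReal (‖y - x‖ ^ (-(2 + 2 * θ))) * ‖F (X y) - F (X x)‖ₑ ^ 2 ≤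
      ENNReal.ofReal ((L : ℝ) ^ (2 + 2 * θ)) * q (X x) (X y) := by
    intro x y
    rcases eq_or_ne (X y) (X x) with h | h
    · rw [h]; simp
    · rw [hq, ← mul_assoc, ← ENNReal.ofReal_mul (by positivity)]
      gcongr
      have hpos : 0 < ‖X y - X x‖ := norm_pos_iff.2 (sub_ne_zero.2 h)
      have hlip : ‖X y - X x‖ ≤ L * ‖y - x‖ := by
        simpa [dist_eq_norm] using hL.dist_le_mul y x
      have hpos2 : 0 < ‖y - x‖ := by
        rcases (norm_nonneg (y - x)).eq_or_lt with h0 | h0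
        · rw [← h0, mul_zero] at hlip; linarith
        · exact h0
      have hp : 0 < 2 + 2 * θ := by linarith
      rw [Real.rpow_neg hpos2.le, Real.rpow_neg hpos.le, ← div_eq_mul_inv, inv_eq_one_div,
        div_le_div_iff₀ (Real.rpow_pos_of_pos hpos2 _) (Real.rpow_pos_of_pos hpos _), one_mul,
        ← Real.mul_rpow L.coe_nonneg hpos2.le]
      gcongr
  change _ ≤ ENNReal.ofReal ((L : ℝ) ^ (2 + 2 * θ)) *
    ((K : ℝ≥0∞) ^ 2 * ((K : ℝ≥0∞) ^ 2 * ∫⁻ x, ∫⁻ y, q x y))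
  clear_value q
  have hQm : Measurable fun a => ∫⁻ z, q a z := hqm.lintegral_prod_right'
  calc _ ≤ ∫⁻ x, ∫⁻ y, ENNReal.ofReal ((L : ℝ) ^ (2 + 2 * θ)) * q (X x) (X y) :=
        lintegral_mono fun x => lintegral_mono fun y => hpt x y
    _ = ENNReal.ofReal ((L : ℝ) ^ (2 + 2 * θ)) * ∫⁻ x, ∫⁻ y, q (X x) (X y) := by
        simp only [lintegral_const_mul' _ _ ENNReal.ofReal_ne_top]
    _ ≤ ENNReal.ofReal ((L : ℝ) ^ (2 + 2 * θ)) * ∫⁻ x, (K : ℝ≥0∞) ^ 2 * ∫⁻ z, q (X x) z := by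
        refine mul_le_mul_right (lintegral_mono fun x => ?_) _
        exact lintegral_comp_le_of_antilipschitz hX hXm (q := q (X x)) hqm.of_uncurry_left
    _ = ENNReal.ofReal ((L : ℝ) ^ (2 + 2 * θ)) *
          ((K : ℝ≥0∞) ^ 2 * ∫⁻ x, ∫⁻ z, q (X x) z) := by
        rw [lintegral_const_mul' _ _ (by simp)]
    _ ≤ _ := by
        refine mul_le_mul_right (mul_le_mul_right ?_ _) _
        exact lintegral_comp_le_of_antilipschitz hX hXm (q := fun a => ∫⁻ z, q a z) hQm

/-! ### Products in the Gagliardo seminorm. -/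

theorem enorm_sq_le_two_mul_add {x y z : ℂ} {a b : ℝ≥0} (h : ‖x‖ ≤ a * ‖y‖ + b * ‖z‖) :
    ‖x‖ₑ ^ 2 ≤ 2 * a ^ 2 * ‖y‖ₑ ^ 2 + 2 * b ^ 2 * ‖z‖ₑ ^ 2 := by
  have h' : ‖x‖₊ ^ 2 ≤ 2 * a ^ 2 * ‖y‖₊ ^ 2 + 2 * b ^ 2 * ‖z‖₊ ^ 2 := by
    rw [← NNReal.coe_le_coe]
    push_cast
    have h1 := pow_le_pow_left₀ (norm_nonneg x) h 2
    nlinarith [sq_nonneg (a * ‖y‖ - b * ‖z‖)]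
  simp only [enorm_eq_nnnorm]
  exact_mod_cast h'

theorem gag_le_add (θ : ℝ) {F G H : Plane → ℂ} (hG : Continuous G) {a b : ℝ≥0}
    (h : ∀ x y, ‖F y - F x‖ ≤ a * ‖G y - G x‖ + b * ‖H y - H x‖) :
    gag θ F ≤ 2 * a ^ 2 * gag θ G + 2 * b ^ 2 * gag θ H := by
  simp only [gag]
  rw [← lintegral_const_mul' _ _ (by finiteness), ← lintegral_const_mul' _ _ (by finiteness),
    ← lintegral_add_left]
  · refine lintegral_mono fun t => ?_
    calc _ ≤ ENNReal.ofReal (‖t‖ ^ (-(2 + 2 * θ))) * ∫⁻ x,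
          (2 * a ^ 2 * ‖G (x + t) - G x‖ₑ ^ 2 + 2 * b ^ 2 * ‖H (x + t) - H x‖ₑ ^ 2) := by
          gcongr with x
          exact enorm_sq_le_two_mul_add (h x (x + t))
      _ = _ := by
          rw [lintegral_add_left (by fun_prop), lintegral_const_mul' _ _ (by finiteness),
            lintegral_const_mul' _ _ (by finiteness)]
          ring
  · refine Measurable.const_mul (Measurable.mul (by fun_prop) ?_) _
    exact Measurable.lintegral_prod_right' (f := fun p : Plane × Plane =>
      ‖G (p.2 + p.1) - G p.2‖ₑ ^ 2) (by fun_prop)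

/-- This is meant for multipliers that have a finite seminorm themselves; no `L²` norm of `F`
enters. -/
theorem gag_mul_le (θ : ℝ) {F m : Plane → ℂ} (hF : Continuous F) {a b : ℝ≥0}
    (ha : ∀ x, ‖m x‖ ≤ a) (hb : ∀ x, ‖F x‖ ≤ b) :
    gag θ (fun x => F x * m x) ≤ 2 * a ^ 2 * gag θ F + 2 * b ^ 2 * gag θ m := by
  refine gag_le_add θ hF fun x y => ?_
  have : F y * m y - F x * m x = m y * (F y - F x) + F x * (m y - m x) := by ring
  rw [this]
  refine (norm_add_le _ _).trans ?_
  rw [norm_mul, norm_mul]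
  gcongr
  · exact ha y
  · exact hb x

theorem lintegral_gagKernel_min_lt_top {θ : ℝ} (h0 : 0 < θ) (h1 : θ < 1) :
    ∫⁻ h : Plane, ENNReal.ofReal (‖h‖ ^ (-(2 + 2 * θ))) * ENNReal.ofReal (min 1 ‖h‖ ^ 2) < ∞ := by
  rw [← lintegral_add_compl _ (measurableSet_ball (x := (0 : Plane)) (ε := 1))]
  refine ENNReal.add_lt_top.2 ⟨?_, ?_⟩
  · refine lt_of_le_of_lt ?_ (lintegral_rpow_norm_ball_lt_top (p := -2 * θ) (by linarith))
    refine lintegral_mono_ae (ae_restrict_of_ae ?_)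
    filter_upwards [ae_norm_pos] with h hh
    rw [← ENNReal.ofReal_mul (by positivity)]
    refine ENNReal.ofReal_le_ofReal ?_
    calc _ ≤ ‖h‖ ^ (-(2 + 2 * θ)) * ‖h‖ ^ 2 := by gcongr; exact min_le_right _ _
      _ = ‖h‖ ^ (-(2 + 2 * θ)) * ‖h‖ ^ (2 : ℝ) := by rw [Real.rpow_two]
      _ = _ := by rw [← Real.rpow_add hh]; ring_nf
  · refine lt_of_le_of_lt ?_ (lintegral_rpow_norm_compl_ball_lt_top (p := -(2 + 2 * θ))
      (by linarith))
    refine lintegral_mono fun h => ?_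
    refine mul_le_of_le_one_right' ?_
    rw [← ENNReal.ofReal_one]
    refine ENNReal.ofReal_le_ofReal (pow_le_one₀ (le_min zero_le_one (norm_nonneg _))
      (min_le_left _ _))

/-- Multiplication by a bounded Lipschitz function. -/
theorem exists_gag_mul_lipschitz_le {θ : ℝ} (h0 : 0 < θ) (h1 : θ < 1) (B : ℝ≥0) :
    ∃ C : ℝ≥0, ∀ F m : Plane → ℂ, Continuous F → (∀ x, ‖m x‖ ≤ B) → LipschitzWith B m →
      gag θ (fun x => F x * m x) ≤ 2 * B ^ 2 * gag θ F + C * eLpNorm F 2 volume ^ 2 := by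
  set J := ∫⁻ h : Plane, ENNReal.ofReal (‖h‖ ^ (-(2 + 2 * θ))) * ENNReal.ofReal (min 1 ‖h‖ ^ 2)
    with hJ
  have hJt : J < ∞ := lintegral_gagKernel_min_lt_top h0 h1
  refine ⟨2 * (2 * B) ^ 2 * J.toNNReal, fun F m hF hB hL => ?_⟩
  have hm := hL.continuous
  push_cast
  rw [ENNReal.coe_toNNReal hJt.ne, eLpNorm_two_sq, hJ, mul_assoc _ (lintegral _ _),
    ← lintegral_mul_const _ (by fun_prop), gag, gag,
    ← lintegral_const_mul' _ _ (by finiteness), ← lintegral_const_mul' _ _ (by finiteness),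
    ← lintegral_add_right _ (by fun_prop)]
  refine lintegral_mono fun t => ?_
  calc _ ≤ ENNReal.ofReal (‖t‖ ^ (-(2 + 2 * θ))) * ∫⁻ x,
        (2 * B ^ 2 * ‖F (x + t) - F x‖ₑ ^ 2 +
          2 * (2 * B) ^ 2 * ENNReal.ofReal (min 1 ‖t‖ ^ 2) * ‖F x‖ₑ ^ 2) := by
        gcongr with x
        -- The sup bound serves large `t` and the Lipschitz bound small `t`; the minimum makes the
        -- kernel integrable at both ends.
        have hmt : ‖m (x + t) - m x‖ ≤ 2 * B * min 1 ‖t‖ := by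
          rw [mul_min_of_nonneg _ _ (by positivity)]
          refine le_min ?_ ?_
          · have := norm_sub_le (m (x + t)) (m x)
            linarith [hB x, hB (x + t)]
          · have := hL.dist_le_mul (x + t) x
            rw [dist_eq_norm, dist_eq_norm, add_sub_cancel_left] at this
            have h2 : 0 ≤ (B : ℝ) * ‖t‖ := by positivity
            linarith
        have hmin : 0 ≤ min 1 ‖t‖ := le_min zero_le_one (norm_nonneg _)
        have key := enorm_sq_le_two_mul_add (x := F (x + t) * m (x + t) - F x * m x)
          (y := F (x + t) - F x) (z := F x) (a := B) (b := 2 * B * (min 1 ‖t‖).toNNReal) (by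
            have : F (x + t) * m (x + t) - F x * m x =
              m (x + t) * (F (x + t) - F x) + F x * (m (x + t) - m x) := by ring
            rw [this]
            refine (norm_add_le _ _).trans ?_
            rw [norm_mul, norm_mul, mul_comm ‖F x‖]
            push_cast
            rw [Real.coe_toNNReal _ hmin]
            gcongr
            exact hB _)
        refine key.trans (le_of_eq ?_)
        rw [ENNReal.ofReal_pow hmin]
        push_cast
        simp only [ENNReal.ofReal]
        ring
    _ = _ := by
        rw [lintegral_add_left (by fun_prop), lintegral_const_mul' _ _ (by finiteness),
          lintegral_const_mul' _ _ (by finiteness)]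
        ring

theorem le_mul_add_of_sq_le {x y z A B : ℝ≥0∞} (h : x ^ 2 ≤ A * y ^ 2 + B * z ^ 2) :
    x ≤ (A + B + 1) * (y + z) := by
  rw [← ENNReal.rpow_le_rpow_iff (z := 2) (by norm_num), ENNReal.rpow_two, ENNReal.rpow_two]
  refine h.trans ?_
  rw [mul_pow]
  have h1 : A + B ≤ (A + B + 1) ^ 2 := by
    rw [sq]
    calc A + B ≤ A + B + 1 := le_self_add
      _ = (A + B + 1) * 1 := (mul_one _).symm
      _ ≤ _ := by gcongr; exact le_add_self
  calc A * y ^ 2 + B * z ^ 2 ≤ (A + B) * y ^ 2 + (A + B) * z ^ 2 := by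
        gcongr
        · exact le_self_add
        · exact le_add_self
    _ = (A + B) * (y ^ 2 + z ^ 2) := by ring
    _ ≤ (A + B + 1) ^ 2 * (y + z) ^ 2 := by
        gcongr
        calc y ^ 2 + z ^ 2 ≤ y ^ 2 + z ^ 2 + 2 * y * z := le_self_add
          _ = _ := by ring

/-- The symbol at the unit vector is positive and finite, so it can be divided out to return from
the seminorm to the weighted norm. -/
theorem wn_fourier_sq_le {θ : ℝ} (h0 : 0 < θ) (h1 : θ < 1) {F : Plane → ℂ} (hF : Integrable F)
    (hF2 : MemLp F 2 volume) {T : ℝ≥0∞} (h : gag θ F ≤ T) :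
    wn θ (𝓕 F) ^ 2 ≤ (gagSymbol θ (EuclideanSpace.single 0 1))⁻¹ * T := by
  rw [gag_eq_wn_fourier θ hF hF2] at h
  have hne := (gagSymbol_pos θ).ne'
  have hnt := (gagSymbol_lt_top h0 h1).ne
  calc wn θ (𝓕 F) ^ 2 = (gagSymbol θ (EuclideanSpace.single 0 1))⁻¹ *
        (gagSymbol θ (EuclideanSpace.single 0 1) * wn θ (𝓕 F) ^ 2) := by
        rw [← mul_assoc, ENNReal.inv_mul_cancel hne hnt, one_mul]
    _ ≤ _ := by gcongr

theorem exists_schwartz_dsym (φ : 𝓢(Plane, ℂ)) (j : Fin 2) :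
    ∃ ψ : 𝓢(Plane, ℂ), (ψ : Plane → ℂ) = dsym j φ := by
  set m : Plane := EuclideanSpace.single j 1
  refine ⟨(2 * Real.pi * Complex.I) • SchwartzMap.smulLeftCLM ℂ (inner ℝ · m : Plane → ℝ) φ, ?_⟩
  funext ξ
  have ht : (inner ℝ · m : Plane → ℝ).HasTemperateGrowth := by fun_prop
  rw [smul_apply, SchwartzMap.smulLeftCLM_apply_apply ht, inner_single_one]
  simp [dsym]
  ring

theorem integrable_fderiv_of_partials {F : Plane → ℂ}
    (h : ∀ j : Fin 2, Integrable fun x => fderiv ℝ F x (EuclideanSpace.single j 1)) :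
    Integrable (fderiv ℝ F) := by
  refine ((h 0).norm.add (h 1).norm).mono' (measurable_fderiv ℝ F).aestronglyMeasurable
    (Filter.Eventually.of_forall fun x => norm_le_of_partials _)

theorem fourier_partial {F : Plane → ℂ} (hF : Integrable F) (hd : Differentiable ℝ F)
    (h : ∀ j : Fin 2, Integrable fun x => fderiv ℝ F x (EuclideanSpace.single j 1)) (j : Fin 2) :
    𝓕 (fun x => fderiv ℝ F x (EuclideanSpace.single j 1)) = dsym j (𝓕 F) := by
  have hi := integrable_fderiv_of_partials h
  funext ξ
  rw [← Real.fourier_continuousLinearMap_apply hi, Real.fourier_fderiv hF hd hi]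
  have hi : innerSL ℝ ξ (EuclideanSpace.single j 1) = ξ j := inner_single_one ξ j
  simp [VectorFourier.fourierSMulRight_apply, dsym, hi]
  ring

/-! ### Deformations and their Jacobian entries. -/

/-- A bi-Lipschitz change of variables `X` with `∂ⱼXᵃ = δ + 𝓕⁻ (V a j) ∘ X`, where the spectra
`V a j` are bounded by `M` in the norms of order `s` and `τ`. -/
structure IsDeformation (s τ : ℝ) (M : ℝ≥0) (X : Plane → Plane)
    (V : Fin 2 → Fin 2 → Plane → ℂ) : Prop where
  lip : LipschitzWith 2 X
  anti : AntilipschitzWith 2 X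
  diff : Differentiable ℝ X
  int : ∀ a j, Integrable (V a j)
  wn_s : ∀ a j, wn s (V a j) ≤ M
  wn_t : ∀ a j, wn τ (V a j) ≤ M
  deriv : ∀ y a j, ((fderiv ℝ X y (EuclideanSpace.single j 1) a : ℝ) : ℂ) =
    (if a = j then 1 else 0) + 𝓕⁻ (V a j) (X y)

/-- The entries of the Jacobian matrix of a deformation. -/
noncomputable def jac (X : Plane → Plane) (V : Fin 2 → Fin 2 → Plane → ℂ) (a j : Fin 2)
    (y : Plane) : ℂ := (if a = j then 1 else 0) + 𝓕⁻ (V a j) (X y)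

theorem fderiv_comp_partial {X : Plane → Plane} {f : Plane → ℂ} {y : Plane}
    (hX : DifferentiableAt ℝ X y) (hf : DifferentiableAt ℝ f (X y)) (j : Fin 2) :
    fderiv ℝ (fun y => f (X y)) y (EuclideanSpace.single j 1) =
      ∑ a : Fin 2, fderiv ℝ f (X y) (EuclideanSpace.single a 1) *
        ((fderiv ℝ X y (EuclideanSpace.single j 1) a : ℝ) : ℂ) := by
  have h := fderiv_comp y hf hX
  change fderiv ℝ (f ∘ X) y _ = _
  rw [h, ContinuousLinearMap.comp_apply]
  set v := fderiv ℝ X y (EuclideanSpace.single j 1)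
  conv_lhs => rw [← (EuclideanSpace.basisFun (Fin 2) ℝ).sum_repr v]
  simp only [map_sum, map_smul, EuclideanSpace.basisFun_repr, EuclideanSpace.basisFun_apply,
    Complex.real_smul]
  exact Finset.sum_congr rfl fun a _ => mul_comm _ _

theorem IsDeformation.fderiv_comp {s τ : ℝ} {M : ℝ≥0} {X : Plane → Plane}
    {V : Fin 2 → Fin 2 → Plane → ℂ} (h : IsDeformation s τ M X V) {f : Plane → ℂ}
    (hf : Differentiable ℝ f) (y : Plane) (j : Fin 2) :
    fderiv ℝ (fun y => f (X y)) y (EuclideanSpace.single j 1) =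
      ∑ a : Fin 2, fderiv ℝ f (X y) (EuclideanSpace.single a 1) * jac X V a j y := by
  rw [fderiv_comp_partial (h.diff y) (hf _)]
  exact Finset.sum_congr rfl fun a _ => by rw [h.deriv, jac]

theorem lipschitzWith_of_partials {f : Plane → ℂ} (hf : Differentiable ℝ f) {B : ℝ≥0}
    (h : ∀ x j, ‖fderiv ℝ f x (EuclideanSpace.single j 1)‖ ≤ B) : LipschitzWith (2 * B) f := by
  refine lipschitzWith_of_nnnorm_fderiv_le hf fun x => ?_
  rw [← NNReal.coe_le_coe, coe_nnnorm]
  refine (norm_le_of_partials _).trans ?_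
  push_cast
  linarith [h x 0, h x 1]

theorem norm_fourierInv_le_of_lintegral {G : Plane → ℂ} (hG : Integrable G) {B : ℝ≥0}
    (h : ∫⁻ ξ, ‖G ξ‖ₑ ≤ B) (x : Plane) : ‖𝓕⁻ G x‖ ≤ B := by
  refine (norm_fourierInv_le x).trans ?_
  rw [integral_norm_eq_lintegral_enorm hG.1]
  exact ENNReal.toReal_le_of_le_ofReal B.coe_nonneg (by simpa using h)

/-- The orders `s < 1 < τ` bound the `L¹` norm of the spectrum, and `s - 1 < 1 < τ - 1` that of the
gradient's spectrum. The condition `τ > 2` thus makes the Jacobian entries Lipschitz. -/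
theorem exists_bound_fourierInv {s τ : ℝ} (hs1 : s < 1) (hτ : 2 < τ) (M : ℝ≥0) :
    ∃ B : ℝ≥0, ∀ G : Plane → ℂ, Integrable G → wn s G ≤ M → wn τ G ≤ M →
      (∀ j, Integrable (dsym j G)) ∧ (∀ x, ‖𝓕⁻ G x‖ ≤ B) ∧ (∀ x j, ‖𝓕⁻ (dsym j G) x‖ ≤ B) ∧
      LipschitzWith B (𝓕⁻ G) := by
  obtain ⟨K, hK⟩ := exists_lintegral_le_wn hs1 (by linarith : 1 < τ)
  obtain ⟨K', hK'⟩ := exists_lintegral_le_wn (a := s - 1) (b := τ - 1) (by linarith) (by linarith)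
  set B := K * (M + M) + K' * (7 * M + 7 * M) with hB
  have h1 : K * (M + M) ≤ B := le_self_add
  have h2 : K' * (7 * M + 7 * M) ≤ B := le_add_self
  refine ⟨2 * B, fun G hG hGs hGt => ?_⟩
  have hi : ∀ j, Integrable (dsym j G) := fun j => integrable_dsym (a := s) (b := τ)
    (by linarith) hτ hG.1 (hGs.trans_lt ENNReal.coe_lt_top) (hGt.trans_lt ENNReal.coe_lt_top)
  have hB2 : (B : ℝ) ≤ (2 * B : ℝ≥0) := by push_cast; linarith [B.coe_nonneg]
  have b1 : ∀ x, ‖𝓕⁻ G x‖ ≤ B := norm_fourierInv_le_of_lintegral hG (by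
    refine (hK G hG.1).trans (le_trans ?_ (ENNReal.coe_le_coe.2 h1))
    push_cast
    gcongr)
  have b2 : ∀ x j, ‖𝓕⁻ (dsym j G) x‖ ≤ B := fun x j => norm_fourierInv_le_of_lintegral (hi j) (by
    refine (hK' _ (hi j).1).trans (le_trans ?_ (ENNReal.coe_le_coe.2 h2))
    push_cast
    gcongr
    · refine (wn_dsym_le _ j G).trans ?_
      gcongr
      simpa using hGs
    · refine (wn_dsym_le _ j G).trans ?_
      gcongr
      simpa using hGt) x
  obtain ⟨hd, hd'⟩ := differentiable_fourierInv hG hi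
  exact ⟨hi, fun x => (b1 x).trans hB2, fun x j => (b2 x j).trans hB2,
    lipschitzWith_of_partials hd fun x j => by rw [hd']; exact b2 x j⟩

theorem exists_bound_jac {s τ : ℝ} (hs1 : s < 1) (hτ : 2 < τ) (M : ℝ≥0) :
    ∃ B : ℝ≥0, ∀ X V, IsDeformation s τ M X V → ∀ a j,
      (∀ y, ‖jac X V a j y‖ ≤ B) ∧ LipschitzWith B (jac X V a j) ∧
      Differentiable ℝ (jac X V a j) ∧
      ∀ y k, ‖fderiv ℝ (jac X V a j) y (EuclideanSpace.single k 1)‖ ≤ B := by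
  obtain ⟨B, hB⟩ := exists_bound_fourierInv hs1 hτ M
  refine ⟨1 + B * 2, fun X V h a j => ?_⟩
  obtain ⟨hi, h1, h2, h3⟩ := hB (V a j) (h.int a j) (h.wn_s a j) (h.wn_t a j)
  obtain ⟨hd, hd'⟩ := differentiable_fourierInv (h.int a j) hi
  have hL : LipschitzWith (1 + B * 2) (jac X V a j) := by
    have := (LipschitzWith.const (α := Plane) (if a = j then (1 : ℂ) else 0)).add (h3.comp h.lip)
    exact LipschitzWith.weaken this (by simp)
  have hdj : Differentiable ℝ (jac X V a j) := by
    have := (hd.comp h.diff).const_add (if a = j then (1 : ℂ) else 0)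
    exact this
  refine ⟨fun y => ?_, hL, hdj, fun y k => ?_⟩
  · have h4 : ‖(if a = j then (1 : ℂ) else 0)‖ ≤ 1 := by split_ifs <;> simp
    refine (norm_add_le _ _).trans ?_
    push_cast
    linarith [h1 (X y), B.coe_nonneg]
  · refine ((fderiv ℝ (jac X V a j) y).le_opNorm _).trans ?_
    have := norm_fderiv_le_of_lipschitz ℝ hL (x₀ := y)
    simpa using this

/-! ### Compositions with Schwartz spectra, up to order two. -/

theorem schwartz_spectrum_props (φ : 𝓢(Plane, ℂ)) :
    Continuous (𝓕⁻ (φ : Plane → ℂ)) ∧ Integrable (𝓕⁻ (φ : Plane → ℂ)) ∧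
      MemLp (𝓕⁻ (φ : Plane → ℂ)) 2 volume ∧ Differentiable ℝ (𝓕⁻ (φ : Plane → ℂ)) ∧
      ∀ x j, fderiv ℝ (𝓕⁻ (φ : Plane → ℂ)) x (EuclideanSpace.single j 1) =
        𝓕⁻ (dsym j φ) x := by
  rw [← SchwartzMap.fourierInv_coe]
  refine ⟨(𝓕⁻ φ).continuous, (𝓕⁻ φ).integrable, (𝓕⁻ φ).memLp 2 volume, (𝓕⁻ φ).differentiable, ?_⟩
  rw [SchwartzMap.fourierInv_coe]
  refine (differentiable_fourierInv φ.integrable fun j => ?_).2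
  obtain ⟨ψ, hψ⟩ := exists_schwartz_dsym φ j
  rw [← hψ]
  exact ψ.integrable

theorem comp_schwartz_props {X : Plane → Plane} (hX : AntilipschitzWith 2 X) (hc : Continuous X)
    (φ : 𝓢(Plane, ℂ)) :
    Continuous (fun y => 𝓕⁻ (φ : Plane → ℂ) (X y)) ∧
      Integrable (fun y => 𝓕⁻ (φ : Plane → ℂ) (X y)) ∧
      MemLp (fun y => 𝓕⁻ (φ : Plane → ℂ) (X y)) 2 volume ∧
      eLpNorm (fun y => 𝓕⁻ (φ : Plane → ℂ) (X y)) 2 volume ≤ 2 * wn 0 φ := by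
  obtain ⟨h1, h2, h3, -⟩ := schwartz_spectrum_props φ
  refine ⟨h1.comp hc, integrable_comp_of_antilipschitz hX hc h1 h2,
    memLp_comp_of_antilipschitz hX hc h1 h3, ?_⟩
  refine (eLpNorm_comp_le_of_antilipschitz hX hc h1).trans (le_of_eq ?_)
  rw [eLpNorm_fourierInv_eq φ.integrable (φ.memLp 2 volume), wn_zero_eq]
  rfl

theorem exists_gag_comp_schwartz_le {θ : ℝ} (h0 : 0 < θ) (h1 : θ < 1) :
    ∃ C : ℝ≥0, ∀ X : Plane → Plane, LipschitzWith 2 X → AntilipschitzWith 2 X →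
      ∀ G : Plane → ℂ, Integrable G → wn θ G < ∞ →
        gag θ (fun y => 𝓕⁻ G (X y)) ≤ C * wn θ G ^ 2 := by
  have hc := (gagSymbol_lt_top h0 h1).ne
  refine ⟨(ENNReal.ofReal (((2 : ℝ≥0) : ℝ) ^ (2 + 2 * θ)) * (((2 : ℝ≥0) : ℝ≥0∞) ^ 2 *
    (((2 : ℝ≥0) : ℝ≥0∞) ^ 2 * gagSymbol θ (EuclideanSpace.single 0 1)))).toNNReal,
    fun X hL hA G hG hw => ?_⟩
  rw [ENNReal.coe_toNNReal (by finiteness)]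
  refine (gag_comp_le θ h0 hA hL (continuous_fourierInv_of_integrable hG)).trans (le_of_eq ?_)
  rw [gag_fourierInv_eq h0 h1 hG hw]
  ring

theorem wn_schwartz_lt_top {r : ℝ} (hr : 0 ≤ r) (φ : 𝓢(Plane, ℂ)) : wn r φ < ∞ := by
  obtain ⟨n, hn⟩ := exists_nat_ge r
  refine (wn_le_wn_add_wn hr hn φ.integrable.1).trans_lt (ENNReal.add_lt_top.2 ⟨?_, ?_⟩)
  · rw [wn_zero_eq]
    exact (φ.memLp 2 volume).2
  · clear hn
    induction n generalizing φ with
    | zero => rw [Nat.cast_zero, wn_zero_eq]; exact (φ.memLp 2 volume).2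
    | succ n ih =>
      push_cast
      refine (wn_add_one_le n φ.integrable.1).trans_lt (ENNReal.add_lt_top.2 ⟨?_, ?_⟩)
      · obtain ⟨ψ, hψ⟩ := exists_schwartz_dsym φ 0
        rw [← hψ]; exact ih ψ
      · obtain ⟨ψ, hψ⟩ := exists_schwartz_dsym φ 1
        rw [← hψ]; exact ih ψ

theorem exists_wn_comp_schwartz_le {θ : ℝ} (h0 : 0 < θ) (h1 : θ < 1) :
    ∃ C : ℝ≥0, ∀ X : Plane → Plane, LipschitzWith 2 X → AntilipschitzWith 2 X →
      ∀ φ : 𝓢(Plane, ℂ), wn θ (𝓕 fun y => 𝓕⁻ (φ : Plane → ℂ) (X y)) ≤ C * wn θ φ := by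
  obtain ⟨C, hC⟩ := exists_gag_comp_schwartz_le h0 h1
  have hc := (gagSymbol_pos θ).ne'
  refine ⟨((gagSymbol θ (EuclideanSpace.single 0 1))⁻¹ * C + 0 + 1).toNNReal,
    fun X hL hA φ => ?_⟩
  rw [ENNReal.coe_toNNReal (by finiteness)]
  obtain ⟨-, hi, hm, -⟩ := comp_schwartz_props hA hL.continuous φ
  have h := wn_fourier_sq_le h0 h1 hi hm
    (hC X hL hA φ φ.integrable (wn_schwartz_lt_top h0.le φ))
  have := le_mul_add_of_sq_le (x := wn θ (𝓕 fun y => 𝓕⁻ (φ : Plane → ℂ) (X y))) (y := wn θ φ)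
    (z := 0) (A := (gagSymbol θ (EuclideanSpace.single 0 1))⁻¹ * C) (B := 0) (by
      refine h.trans (le_of_eq ?_)
      ring)
  simpa using this

/-- The Jacobian entry is a bounded Lipschitz multiplier; `wn 0 φ` pays for its increments. -/
theorem exists_wn_comp_mul_jac_le_of_lt_one {s τ θ : ℝ} (hs1 : s < 1) (hτ : 2 < τ) (M : ℝ≥0)
    (h0 : 0 < θ) (h1 : θ < 1) :
    ∃ C : ℝ≥0, ∀ X V, IsDeformation s τ M X V → ∀ (φ : 𝓢(Plane, ℂ)) (a j : Fin 2),
      wn θ (𝓕 fun y => 𝓕⁻ (φ : Plane → ℂ) (X y) * jac X V a j y) ≤ C * (wn θ φ + wn 0 φ) := by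
  obtain ⟨B, hB⟩ := exists_bound_jac hs1 hτ M
  obtain ⟨C₁, hC₁⟩ := exists_gag_comp_schwartz_le h0 h1
  obtain ⟨C₂, hC₂⟩ := exists_gag_mul_lipschitz_le h0 h1 B
  have hc := (gagSymbol_pos θ).ne'
  set c := (gagSymbol θ (EuclideanSpace.single 0 1))⁻¹ with hcdef
  have hct : c ≠ ∞ := by simp [hcdef, hc]
  refine ⟨(c * (2 * B ^ 2 * C₁) + c * (C₂ * 4) + 1).toNNReal, fun X V h φ a j => ?_⟩
  rw [ENNReal.coe_toNNReal (by finiteness)]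
  obtain ⟨hFc, hi, hm, h2⟩ := comp_schwartz_props h.anti h.lip.continuous φ
  obtain ⟨b1, b2, -, -⟩ := hB X V h a j
  have hg := hC₂ _ _ hFc b1 b2
  have hg2 := hC₁ X h.lip h.anti φ φ.integrable (wn_schwartz_lt_top h0.le φ)
  refine le_mul_add_of_sq_le ?_
  refine (wn_fourier_sq_le h0 h1
    (hi.mul_bdd b2.continuous.aestronglyMeasurable (Filter.Eventually.of_forall b1))
    (MemLp.mul (p := 2) (q := ∞)
      (memLp_top_of_bound b2.continuous.aestronglyMeasurable B (Filter.Eventually.of_forall b1))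
      hm) hg).trans ?_
  rw [← hcdef]
  calc _ ≤ c * (2 * B ^ 2 * (C₁ * wn θ φ ^ 2) + C₂ * (2 * wn 0 φ) ^ 2) := by gcongr
    _ = _ := by ring

/-- At order one the Gagliardo kernel diverges; the product and chain rules with Plancherel replace
it. -/
theorem exists_wn_one_comp_mul_jac_le {s τ : ℝ} (hs1 : s < 1) (hτ : 2 < τ) (M : ℝ≥0) :
    ∃ C : ℝ≥0, ∀ X V, IsDeformation s τ M X V → ∀ (φ : 𝓢(Plane, ℂ)) (a j : Fin 2),
      wn 1 (𝓕 fun y => 𝓕⁻ (φ : Plane → ℂ) (X y) * jac X V a j y) ≤ C * (wn 1 φ + wn 0 φ) := by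
  obtain ⟨B, hB⟩ := exists_bound_jac hs1 hτ M
  refine ⟨2 * (B * 2 + B ^ 2 * 28), fun X V h φ a j => ?_⟩
  set g : Plane → ℂ := fun y => 𝓕⁻ (φ : Plane → ℂ) (X y) with hg
  obtain ⟨hFc, hi, hm, h2⟩ := comp_schwartz_props h.anti h.lip.continuous φ
  obtain ⟨-, -, -, hd, hd'⟩ := schwartz_spectrum_props φ
  have hgd : Differentiable ℝ g := hd.comp h.diff
  obtain ⟨b1, b2, b3, b4⟩ := hB X V h a j
  have hb : ∀ b : Fin 2, Continuous (fun y => 𝓕⁻ (dsym b φ) (X y)) ∧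
      Integrable (fun y => 𝓕⁻ (dsym b φ) (X y)) ∧ MemLp (fun y => 𝓕⁻ (dsym b φ) (X y)) 2 volume ∧
      eLpNorm (fun y => 𝓕⁻ (dsym b φ) (X y)) 2 volume ≤ 14 * wn 1 φ := by
    intro b
    obtain ⟨ψ, hψ⟩ := exists_schwartz_dsym φ b
    have := comp_schwartz_props h.anti h.lip.continuous ψ
    rw [hψ] at this
    refine ⟨this.1, this.2.1, this.2.2.1, this.2.2.2.trans ?_⟩
    calc 2 * wn 0 (dsym b φ) ≤ 2 * (7 * wn (0 + 1) φ) := by gcongr; exact wn_dsym_le _ _ _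
      _ = _ := by rw [zero_add]; ring
  set P : Plane → ℂ := fun y => g y * jac X V a j y with hP
  have hPd : Differentiable ℝ P := hgd.mul b3
  have hPi : Integrable P :=
    hi.mul_bdd b2.continuous.aestronglyMeasurable (Filter.Eventually.of_forall b1)
  -- In the first summand the derivative of the entry is bounded; in the second both Jacobian
  -- entries are. Only `L²` norms of the composed function and of its gradient are left.
  have hPk : ∀ y k, fderiv ℝ P y (EuclideanSpace.single k 1) =
      g y * fderiv ℝ (jac X V a j) y (EuclideanSpace.single k 1) +
        jac X V a j y * ∑ b, 𝓕⁻ (dsym b φ) (X y) * jac X V b k y := by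
    intro y k
    have e := h.fderiv_comp hd y k
    simp only [hd'] at e
    rw [← e]
    have := fderiv_mul (hgd y) (b3 y)
    change fderiv ℝ (g * jac X V a j) y _ = _
    rw [this]
    simp [hg]
  have hmeas : ∀ k, AEStronglyMeasurable
      (fun y => fderiv ℝ (jac X V a j) y (EuclideanSpace.single k 1)) := fun k =>
    (measurable_fderiv_apply_const ℝ _ _).aestronglyMeasurable
  have hPki : ∀ k, Integrable fun y => fderiv ℝ P y (EuclideanSpace.single k 1) := by
    intro k
    simp only [hPk]
    refine (hi.mul_bdd (hmeas k) (Filter.Eventually.of_forall fun y => b4 y k)).add ?_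
    refine Integrable.bdd_mul (c := B) ?_ b2.continuous.aestronglyMeasurable
      (Filter.Eventually.of_forall b1)
    exact integrable_finsetSum _ fun b _ => (hb b).2.1.mul_bdd
      (hB X V h b k).2.1.continuous.aestronglyMeasurable
      (Filter.Eventually.of_forall (hB X V h b k).1)
  have hPkn : ∀ k, eLpNorm (fun y => fderiv ℝ P y (EuclideanSpace.single k 1)) 2 volume ≤
      (B * 2 + B ^ 2 * 28) * (wn 1 φ + wn 0 φ) := by
    intro k
    have hle := eLpNorm_two_le_add (f := fun y => fderiv ℝ P y (EuclideanSpace.single k 1))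
      (g := g) (h := fun y => ‖𝓕⁻ (dsym 0 φ) (X y)‖ + ‖𝓕⁻ (dsym 1 φ) (X y)‖) (c := B) (d := B ^ 2)
      hi.1 ((hb 0).2.1.1.norm.add (hb 1).2.1.1.norm) (Filter.Eventually.of_forall fun y => by
        rw [hPk]
        refine (norm_add_le _ _).trans ?_
        rw [norm_mul, norm_mul, mul_comm ‖g y‖]
        rw [NNReal.coe_pow, sq, mul_assoc (B : ℝ) B _, Real.norm_of_nonneg (by positivity)]
        refine add_le_add (mul_le_mul_of_nonneg_right (b4 y k) (norm_nonneg _))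
          (mul_le_mul (b1 y) ?_ (norm_nonneg _) B.coe_nonneg)
        rw [Fin.sum_univ_two]
        refine (norm_add_le _ _).trans ?_
        rw [norm_mul, norm_mul, mul_add, mul_comm (B : ℝ), mul_comm (B : ℝ)]
        gcongr
        · exact (hB X V h 0 k).1 y
        · exact (hB X V h 1 k).1 y)
    have hle2 := eLpNorm_two_le_add
      (f := fun y => ‖𝓕⁻ (dsym 0 φ) (X y)‖ + ‖𝓕⁻ (dsym 1 φ) (X y)‖)
      (g := fun y => 𝓕⁻ (dsym 0 φ) (X y)) (h := fun y => 𝓕⁻ (dsym 1 φ) (X y)) (c := 1) (d := 1)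
      (hb 0).2.1.1 (hb 1).2.1.1 (Filter.Eventually.of_forall fun y => by
        rw [Real.norm_of_nonneg (by positivity)]; simp)
    simp only [ENNReal.coe_one, one_mul] at hle2
    calc _ ≤ _ := hle
      _ ≤ B * (2 * wn 0 φ) + (B ^ 2 : ℝ≥0) * (14 * wn 1 φ + 14 * wn 1 φ) := by
          gcongr
          exact hle2.trans (add_le_add (hb 0).2.2.2 (hb 1).2.2.2)
      _ = (B * 2) * wn 0 φ + (B ^ 2 * 28) * wn 1 φ := by push_cast; ring
      _ ≤ (B * 2 + B ^ 2 * 28) * wn 0 φ + (B * 2 + B ^ 2 * 28) * wn 1 φ := by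
          gcongr
          · exact le_self_add
          · exact le_add_self
      _ = _ := by ring
  have hPm : ∀ k, MemLp (fun y => fderiv ℝ P y (EuclideanSpace.single k 1)) 2 volume := fun k =>
    ⟨(hPki k).1, (hPkn k).trans_lt (by
      have := wn_schwartz_lt_top zero_le_one φ
      have := wn_schwartz_lt_top le_rfl φ
      finiteness)⟩
  have hfin : ∀ k, wn 0 (dsym k (𝓕 P)) ≤ (B * 2 + B ^ 2 * 28) * (wn 1 φ + wn 0 φ) := by
    intro k
    rw [← fourier_partial hPi hPd hPki k, wn_zero_eq, eLpNorm_fourier_eq (hPki k) (hPm k)]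
    exact hPkn k
  have hw := wn_add_one_le 0 (continuous_fourier_of_integrable hPi).aestronglyMeasurable
  rw [zero_add] at hw
  refine hw.trans ((add_le_add (hfin 0) (hfin 1)).trans (le_of_eq ?_))
  push_cast
  ring

theorem exists_wn_comp_mul_jac_le {s τ θ : ℝ} (hs1 : s < 1) (hτ : 2 < τ) (M : ℝ≥0)
    (h0 : 0 < θ) (h1 : θ ≤ 1) :
    ∃ C : ℝ≥0, ∀ X V, IsDeformation s τ M X V → ∀ (φ : 𝓢(Plane, ℂ)) (a j : Fin 2),
      wn θ (𝓕 fun y => 𝓕⁻ (φ : Plane → ℂ) (X y) * jac X V a j y) ≤ C * (wn θ φ + wn 0 φ) := by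
  rcases h1.lt_or_eq with h1 | rfl
  · exact exists_wn_comp_mul_jac_le_of_lt_one hs1 hτ M h0 h1
  · exact exists_wn_one_comp_mul_jac_le hs1 hτ M

theorem fourier_comp_partial {s τ : ℝ} (hs1 : s < 1) (hτ : 2 < τ) {M : ℝ≥0} {X : Plane → Plane}
    {V : Fin 2 → Fin 2 → Plane → ℂ} (h : IsDeformation s τ M X V) (φ : 𝓢(Plane, ℂ)) (j : Fin 2) :
    dsym j (𝓕 fun y => 𝓕⁻ (φ : Plane → ℂ) (X y)) =
      fun ξ => 𝓕 (fun y => 𝓕⁻ (dsym 0 φ) (X y) * jac X V 0 j y) ξ +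
        𝓕 (fun y => 𝓕⁻ (dsym 1 φ) (X y) * jac X V 1 j y) ξ := by
  obtain ⟨B, hB⟩ := exists_bound_jac hs1 hτ M
  obtain ⟨-, hi, -, -⟩ := comp_schwartz_props h.anti h.lip.continuous φ
  obtain ⟨-, -, -, hd, hd'⟩ := schwartz_spectrum_props φ
  have hb : ∀ b k : Fin 2, Integrable (fun y => 𝓕⁻ (dsym b φ) (X y) * jac X V b k y) := by
    intro b k
    obtain ⟨ψ, hψ⟩ := exists_schwartz_dsym φ b
    have := (comp_schwartz_props h.anti h.lip.continuous ψ).2.1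
    rw [hψ] at this
    exact this.mul_bdd (hB X V h b k).2.1.continuous.aestronglyMeasurable
      (Filter.Eventually.of_forall (hB X V h b k).1)
  have e : ∀ k, (fun y => fderiv ℝ (fun y => 𝓕⁻ (φ : Plane → ℂ) (X y)) y
      (EuclideanSpace.single k 1)) = (fun y => 𝓕⁻ (dsym 0 φ) (X y) * jac X V 0 k y) +
        fun y => 𝓕⁻ (dsym 1 φ) (X y) * jac X V 1 k y := by
    intro k
    funext y
    rw [h.fderiv_comp hd y k, Fin.sum_univ_two, hd', hd']
    rfl
  rw [← fourier_partial hi (hd.comp h.diff) (fun k => by rw [e k]; exact (hb 0 k).add (hb 1 k)) j,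
    e j]
  funext ξ
  exact congrFun (VectorFourier.fourierIntegral_add Real.continuous_fourierChar
    continuous_inner (hb 0 j) (hb 1 j)) ξ

/-- The chain rule reduces to order `θ` for `∂ₐφ` composed with `X` times a Jacobian entry; `wn 1 φ`
is the `L²` norm of the gradient. -/
theorem exists_wn_one_add_comp_schwartz_le {s τ θ : ℝ} (hs1 : s < 1) (hτ : 2 < τ) (M : ℝ≥0)
    (h0 : 0 < θ) (h1 : θ ≤ 1) :
    ∃ C : ℝ≥0, ∀ X V, IsDeformation s τ M X V → ∀ φ : 𝓢(Plane, ℂ),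
      wn (θ + 1) (𝓕 fun y => 𝓕⁻ (φ : Plane → ℂ) (X y)) ≤ C * (wn (θ + 1) φ + wn 1 φ) := by
  obtain ⟨C, hC⟩ := exists_wn_comp_mul_jac_le hs1 hτ M h0 h1
  refine ⟨28 * C, fun X V h φ => ?_⟩
  obtain ⟨-, hi, -, -⟩ := comp_schwartz_props h.anti h.lip.continuous φ
  have key : ∀ a j, wn θ (𝓕 fun y => 𝓕⁻ (dsym a φ) (X y) * jac X V a j y) ≤
      7 * C * (wn (θ + 1) φ + wn 1 φ) := by
    intro a j
    obtain ⟨ψ, hψ⟩ := exists_schwartz_dsym φ a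
    rw [← hψ]
    refine (hC X V h ψ a j).trans ?_
    rw [hψ]
    have e1 := wn_dsym_le θ a φ
    have e2 := wn_dsym_le 0 a φ
    rw [zero_add] at e2
    calc _ ≤ (C : ℝ≥0∞) * (7 * wn (θ + 1) φ + 7 * wn 1 φ) := by gcongr
      _ = _ := by ring
  have hmeas : ∀ a j, AEStronglyMeasurable
      (𝓕 fun y => 𝓕⁻ (dsym a φ) (X y) * jac X V a j y) := by
    intro a j
    obtain ⟨B, hB⟩ := exists_bound_jac hs1 hτ M
    obtain ⟨ψ, hψ⟩ := exists_schwartz_dsym φ a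
    have := (comp_schwartz_props h.anti h.lip.continuous ψ).2.1
    rw [hψ] at this
    exact (continuous_fourier_of_integrable (this.mul_bdd
      (hB X V h a j).2.1.continuous.aestronglyMeasurable
      (Filter.Eventually.of_forall (hB X V h a j).1))).aestronglyMeasurable
  have hw := wn_add_one_le θ (continuous_fourier_of_integrable hi).aestronglyMeasurable
  rw [fourier_comp_partial hs1 hτ h, fourier_comp_partial hs1 hτ h] at hw
  refine hw.trans ((add_le_add (wn_add_le (hmeas 0 0) (hmeas 1 0))
    (wn_add_le (hmeas 0 1) (hmeas 1 1))).trans ?_)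
  calc _ ≤ (7 * C * (wn (θ + 1) φ + wn 1 φ) + 7 * C * (wn (θ + 1) φ + wn 1 φ)) +
      (7 * C * (wn (θ + 1) φ + wn 1 φ) + 7 * C * (wn (θ + 1) φ + wn 1 φ)) := by
        gcongr <;> apply key
    _ = _ := by push_cast; ring

/-! ### From Schwartz spectra to spectra of finite norm. -/

theorem fourierInv_schwartz_sub (φ ψ : 𝓢(Plane, ℂ)) (x : Plane) :
    𝓕⁻ ((φ - ψ : 𝓢(Plane, ℂ)) : Plane → ℂ) x = 𝓕⁻ (φ : Plane → ℂ) x - 𝓕⁻ (ψ : Plane → ℂ) x := by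
  have h := map_sub (FourierTransform.fourierInvCLM ℂ 𝓢(Plane, ℂ)) φ ψ
  simp only [FourierTransform.fourierInvCLM_apply] at h
  rw [← SchwartzMap.fourierInv_coe, ← SchwartzMap.fourierInv_coe, ← SchwartzMap.fourierInv_coe, h]
  rfl

theorem fourier_sub_of_integrable {F G : Plane → ℂ} (hF : Integrable F) (hG : Integrable G)
    (ξ : Plane) : 𝓕 (fun x => F x - G x) ξ = 𝓕 F ξ - 𝓕 G ξ := by
  have h := congrFun (VectorFourier.fourierIntegral_add Real.continuous_fourierChar
    (L := innerₗ Plane) continuous_inner (hF.sub hG) hG) ξ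
  rw [sub_add_cancel] at h
  exact eq_sub_of_add_eq h.symm

/-- Extension of composition estimates from Schwartz spectra to spectra of finite weighted norm. -/
theorem exists_comp_spectrum_of_schwartz {X : Plane → Plane} (hA : AntilipschitzWith 2 X)
    (hX : Continuous X) {b : ℝ} (hb : 1 < b) {w : Plane → ℝ} (hw : Measurable w)
    {C : ℝ} (h1 : ∀ ξ, ‖ξ‖ ^ b ≤ w ξ) (h2 : ∀ ξ, w ξ ≤ C * (1 + ‖ξ‖ ^ b)) (K : ℝ≥0)
    (hi : ∀ φ : 𝓢(Plane, ℂ), Integrable (𝓕 fun y => 𝓕⁻ (φ : Plane → ℂ) (X y)))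
    (hK : ∀ φ : 𝓢(Plane, ℂ), ∫⁻ ξ, ‖𝓕 (fun y => 𝓕⁻ (φ : Plane → ℂ) (X y)) ξ‖ₑ ≤
      K * ((∫⁻ ξ, ‖φ ξ‖ₑ) + eLpNorm (fun ξ => (w ξ : ℂ) * φ ξ) 2 volume))
    {G : Plane → ℂ} (hG : Integrable G)
    (hGw : eLpNorm (fun ξ => (w ξ : ℂ) * G ξ) 2 volume < ∞) :
    ∃ L : Plane → ℂ, Integrable L ∧ (∀ y, 𝓕⁻ L y = 𝓕⁻ G (X y)) ∧
      ∀ (r : ℝ) (c : ℝ≥0) (T : (Plane → ℂ) → ℝ≥0∞),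
        (∀ φ : 𝓢(Plane, ℂ), wn r (𝓕 fun y => 𝓕⁻ (φ : Plane → ℂ) (X y)) ≤ c * T φ) →
        (∀ φ : 𝓢(Plane, ℂ), T φ ≤ T G +
          2 * eLpNorm (fun ξ => (w ξ : ℂ) * (φ ξ - G ξ)) 2 volume) →
        wn r L ≤ c * T G := by
  have hpos : ∀ n : ℕ, (0 : ℝ≥0∞) < 2⁻¹ ^ n := fun n =>
    ENNReal.pow_pos (ENNReal.inv_pos.2 (by simp)) n
  choose φ hφ1 hφ2 using fun n => exists_schwartz_approx hb hw h1 h2 hG hGw (hpos n)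
  have hF : ∀ n, Integrable fun y => 𝓕⁻ (φ n : Plane → ℂ) (X y) := fun n =>
    (comp_schwartz_props hA hX (φ n)).2.1
  obtain ⟨L, hL, hL1, hL2⟩ := exists_limit_spectrum (X := X) hG (g := fun n => φ n)
    (H := fun n => 𝓕 fun y => 𝓕⁻ (φ n : Plane → ℂ) (X y)) (fun n => (φ n).integrable)
    (fun n => hi (φ n)) (fun n y => by
      have := (comp_schwartz_props hA hX (φ n)).1.fourierInv_fourier_eq (hF n) (hi (φ n))
      exact congrFun this y) hφ1 (2 * K) (fun n m => by
      have e : ∀ ξ, 𝓕 (fun y => 𝓕⁻ (φ n : Plane → ℂ) (X y)) ξ -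
          𝓕 (fun y => 𝓕⁻ (φ m : Plane → ℂ) (X y)) ξ =
          𝓕 (fun y => 𝓕⁻ ((φ n - φ m : 𝓢(Plane, ℂ)) : Plane → ℂ) (X y)) ξ := by
        intro ξ
        rw [← fourier_sub_of_integrable (hF n) (hF m)]
        simp only [fourierInv_schwartz_sub]
      simp only [e]
      refine (hK _).trans ?_
      have a1 : ∫⁻ ξ, ‖(φ n - φ m) ξ‖ₑ ≤ 2⁻¹ ^ n + 2⁻¹ ^ m := by
        calc _ ≤ ∫⁻ ξ, (‖φ n ξ - G ξ‖ₑ + ‖φ m ξ - G ξ‖ₑ) := by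
              refine lintegral_mono fun ξ => ?_
              have : (φ n - φ m) ξ = (φ n ξ - G ξ) - (φ m ξ - G ξ) := by
                rw [sub_apply]; ring
              rw [this]
              exact enorm_sub_le
          _ = (∫⁻ ξ, ‖φ n ξ - G ξ‖ₑ) + ∫⁻ ξ, ‖φ m ξ - G ξ‖ₑ :=
              lintegral_add_left' ((φ n).integrable.sub hG).1.enorm _
          _ ≤ _ := add_le_add (hφ1 n) (hφ1 m)
      have a2 : eLpNorm (fun ξ => (w ξ : ℂ) * (φ n - φ m) ξ) 2 volume ≤ 2⁻¹ ^ n + 2⁻¹ ^ m := by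
        have hwm : AEStronglyMeasurable (fun ξ => (w ξ : ℂ)) :=
          (Complex.measurable_ofReal.comp hw).aestronglyMeasurable
        have := eLpNorm_sub_le (μ := volume) (p := 2)
          (f := fun ξ => (w ξ : ℂ) * (φ n ξ - G ξ)) (g := fun ξ => (w ξ : ℂ) * (φ m ξ - G ξ))
          (hwm.mul ((φ n).integrable.sub hG).1) (hwm.mul ((φ m).integrable.sub hG).1) (by norm_num)
        refine le_trans (le_of_eq ?_) (this.trans (add_le_add (hφ2 n) (hφ2 m)))
        congr 1
        funext ξ
        simp only [sub_apply, Pi.sub_apply]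
        ring
      calc _ ≤ (K : ℝ≥0∞) * ((2⁻¹ ^ n + 2⁻¹ ^ m) + (2⁻¹ ^ n + 2⁻¹ ^ m)) := by gcongr
        _ = _ := by push_cast; ring)
  refine ⟨L, hL, hL1, fun r c T hT1 hT2 => ?_⟩
  refine hL2 r (fun n => c * (T G + 2 * 2⁻¹ ^ n)) _ (fun n => (hT1 _).trans ?_) ?_
  · gcongr
    refine (hT2 (φ n)).trans ?_
    gcongr
    exact hφ2 n
  · have := ENNReal.Tendsto.const_mul (a := 2) tendsto_two_inv_pow_ennreal (Or.inr (by simp))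
    have h3 := (tendsto_const_nhds (x := T G)).add this
    have h4 := ENNReal.Tendsto.const_mul (a := (c : ℝ≥0∞)) h3 (Or.inr (by simp))
    simpa using h4

theorem wn_le_wn_add_wn_sub {r : ℝ} {G H : Plane → ℂ} (hG : AEStronglyMeasurable G)
    (hH : AEStronglyMeasurable H) : wn r H ≤ wn r G + wn r (fun ξ => H ξ - G ξ) := by
  have := wn_add_le (r := r) hG (hH.sub hG)
  simp only [Pi.sub_apply, add_sub_cancel] at this
  exact this

/-- Composition with a deformation preserves the norms of order `s` and `b` for `1 < b ≤ 2`. -/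
theorem exists_comp_spectrum_le_two {s τ b : ℝ} (hs0 : 0 < s) (hs1 : s < 1) (hτ : 2 < τ)
    (M : ℝ≥0) (hb : 1 < b) (hb2 : b ≤ 2) :
    ∃ C : ℝ≥0, ∀ X V, IsDeformation s τ M X V → ∀ G : Plane → ℂ, Integrable G → wn s G < ∞ →
      wn b G < ∞ → ∃ H : Plane → ℂ, Integrable H ∧ (∀ y, 𝓕⁻ H y = 𝓕⁻ G (X y)) ∧
        wn s H ≤ C * wn s G ∧ wn b H ≤ C * (wn s G + wn b G) := by
  obtain ⟨C₁, hC₁⟩ := exists_wn_comp_schwartz_le hs0 hs1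
  obtain ⟨C₂, hC₂⟩ := exists_wn_one_add_comp_schwartz_le (θ := b - 1) hs1 hτ M (by linarith)
    (by linarith)
  obtain ⟨K, hK⟩ := exists_lintegral_le_wn hs1 hb
  refine ⟨C₁ + 2 * C₂, fun X V h G hG hGs hGb => ?_⟩
  have hH : ∀ φ : 𝓢(Plane, ℂ), AEStronglyMeasurable (𝓕 fun y => 𝓕⁻ (φ : Plane → ℂ) (X y)) :=
    fun φ => (continuous_fourier_of_integrable
      (comp_schwartz_props h.anti h.lip.continuous φ).2.1).aestronglyMeasurable
  have e1 : ∀ φ : 𝓢(Plane, ℂ), wn s (𝓕 fun y => 𝓕⁻ (φ : Plane → ℂ) (X y)) ≤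
      (C₁ + 2 * C₂ : ℝ≥0) * wn s φ := fun φ => (hC₁ X h.lip h.anti φ).trans (by
    gcongr; exact le_self_add)
  have e2 : ∀ φ : 𝓢(Plane, ℂ), wn b (𝓕 fun y => 𝓕⁻ (φ : Plane → ℂ) (X y)) ≤
      (C₁ + 2 * C₂ : ℝ≥0) * (wn s φ + wn b φ) := fun φ => by
    have := hC₂ X V h φ
    rw [sub_add_cancel] at this
    have h3 := wn_le_wn_add_wn hs1.le hb.le φ.integrable.1
    calc _ ≤ _ := this
      _ ≤ C₂ * (wn b φ + (wn s φ + wn b φ)) := by gcongr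
      _ ≤ C₂ * (2 * (wn s φ + wn b φ)) := by
          gcongr; rw [two_mul]; gcongr; exact le_add_self
      _ = 0 + 2 * C₂ * (wn s φ + wn b φ) := by ring
      _ ≤ C₁ * (wn s φ + wn b φ) + 2 * C₂ * (wn s φ + wn b φ) := by gcongr; exact zero_le
      _ = _ := by push_cast; ring
  -- Approximation in this single weight gives convergence at the orders `s` and `b` simultaneously.
  set w : Plane → ℝ := fun ξ => ‖ξ‖ ^ s + ‖ξ‖ ^ b with hw
  have w1 : ∀ g : Plane → ℂ, wn s g ≤ eLpNorm (fun ξ => (w ξ : ℂ) * g ξ) 2 volume := fun g => by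
    refine eLpNorm_mono fun ξ => ?_
    rw [norm_mul, norm_mul, Complex.norm_of_nonneg (by positivity),
      Complex.norm_of_nonneg (by positivity)]
    gcongr
    simp only [hw]; linarith [Real.rpow_nonneg (norm_nonneg ξ) b]
  have w2 : ∀ g : Plane → ℂ, wn b g ≤ eLpNorm (fun ξ => (w ξ : ℂ) * g ξ) 2 volume := fun g => by
    refine eLpNorm_mono fun ξ => ?_
    rw [norm_mul, norm_mul, Complex.norm_of_nonneg (by positivity),
      Complex.norm_of_nonneg (by positivity)]
    gcongr
    simp only [hw]; linarith [Real.rpow_nonneg (norm_nonneg ξ) s]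
  have w3 : eLpNorm (fun ξ => (w ξ : ℂ) * G ξ) 2 volume < ∞ := by
    refine lt_of_le_of_lt ?_ (ENNReal.add_lt_top.2 ⟨hGs, hGb⟩)
    refine le_trans (le_of_eq ?_) (eLpNorm_add_le (aestronglyMeasurable_weight hG.1)
      (aestronglyMeasurable_weight hG.1) (by norm_num))
    congr 1
    funext ξ
    simp only [hw, Pi.add_apply]
    push_cast
    ring
  obtain ⟨L, hL, hL1, hL2⟩ := exists_comp_spectrum_of_schwartz h.anti h.lip.continuous hb
    (w := w) (by fun_prop) (C := 2) (fun ξ => by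
      simp only [hw]; linarith [Real.rpow_nonneg (norm_nonneg ξ) s])
    (fun ξ => by
      simp only [hw]
      rcases le_total ‖ξ‖ 1 with h1 | h1
      · have := Real.rpow_le_one (norm_nonneg ξ) h1 hs0.le
        linarith [Real.rpow_nonneg (norm_nonneg ξ) b]
      · have := Real.rpow_le_rpow_of_exponent_le h1 (by linarith : s ≤ b)
        linarith)
    (K * (3 * (C₁ + 2 * C₂)))
    (fun φ => integrable_of_wn hs1 hb (hH φ) ((e1 φ).trans_lt (by
      have := wn_schwartz_lt_top hs0.le φ
      finiteness)) ((e2 φ).trans_lt (by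
      have := wn_schwartz_lt_top hs0.le φ
      have := wn_schwartz_lt_top (by linarith : 0 ≤ b) φ
      finiteness)))
    (fun φ => by
      refine (hK _ (hH φ)).trans ?_
      set T := eLpNorm (fun ξ => (w ξ : ℂ) * φ ξ) 2 volume
      calc _ ≤ (K : ℝ≥0∞) * ((C₁ + 2 * C₂ : ℝ≥0) * T + (C₁ + 2 * C₂ : ℝ≥0) * (T + T)) := by
            gcongr
            · exact (e1 φ).trans (by gcongr; exact w1 φ)
            · exact (e2 φ).trans (by gcongr; exacts [w1 φ, w2 φ])
        _ = (K * (3 * (C₁ + 2 * C₂)) : ℝ≥0) * (0 + T) := by push_cast; ring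
        _ ≤ _ := by gcongr; exact zero_le)
    hG w3
  refine ⟨L, hL, hL1, hL2 s _ (wn s) e1 fun φ => ?_, hL2 b _ (fun g => wn s g + wn b g) e2
    fun φ => ?_⟩
  · refine (wn_le_wn_add_wn_sub hG.1 φ.integrable.1).trans ?_
    gcongr
    refine (w1 _).trans ?_
    rw [two_mul]; exact le_self_add
  · calc wn s φ + wn b φ ≤ (wn s G + _) + (wn b G + _) := add_le_add
          ((wn_le_wn_add_wn_sub hG.1 φ.integrable.1).trans (add_le_add le_rfl (w1 _)))
          ((wn_le_wn_add_wn_sub hG.1 φ.integrable.1).trans (add_le_add le_rfl (w2 _)))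
      _ = _ := by ring

/-! ### Induction on the order of the composition estimate. -/

/-- The property that composition with deformations preserves the norms of order `s` and `r`. -/
def CompBounded (s τ : ℝ) (M : ℝ≥0) (r : ℝ) : Prop :=
  ∃ C : ℝ≥0, ∀ X V, IsDeformation s τ M X V → ∀ G : Plane → ℂ, Integrable G → wn s G < ∞ →
    wn r G < ∞ → ∃ H : Plane → ℂ, Integrable H ∧ (∀ y, 𝓕⁻ H y = 𝓕⁻ G (X y)) ∧
      wn s H ≤ C * wn s G ∧ wn r H ≤ C * (wn s G + wn r G)

theorem fourierInv_add_of_integrable {G H : Plane → ℂ} (hG : Integrable G) (hH : Integrable H)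
    (x : Plane) : 𝓕⁻ (fun ξ => G ξ + H ξ) x = 𝓕⁻ G x + 𝓕⁻ H x := by
  rw [Real.fourierInv_eq, Real.fourierInv_eq, Real.fourierInv_eq,
    ← integral_add (integrable_fourierInv_integrand hG x) (integrable_fourierInv_integrand hH x)]
  simp only [smul_add]

theorem fourierInv_const_mul (c : ℂ) (G : Plane → ℂ) (x : Plane) :
    𝓕⁻ (fun ξ => c * G ξ) x = c * 𝓕⁻ G x := by
  rw [Real.fourierInv_eq, Real.fourierInv_eq, ← integral_const_mul]
  simp only [Circle.smul_def, smul_eq_mul]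
  congr 1
  funext v
  ring

theorem wn_const_mul_le {r : ℝ} {c : ℂ} (hc : ‖c‖ ≤ 1) (G : Plane → ℂ) :
    wn r (fun ξ => c * G ξ) ≤ wn r G := by
  have := wn_mono (r := r) (G := fun ξ => c * G ξ) (H := G) 1 (Filter.Eventually.of_forall
    fun ξ => by
      rw [norm_mul]
      exact mul_le_mul_of_nonneg_right hc (norm_nonneg _))
  simpa using this

/-- A spectrum of `(𝓕⁻ G ∘ X) · (δ + 𝓕⁻ V ∘ X)`. -/
theorem CompBounded.exists_comp_mul_jac {s τ r : ℝ} {M : ℝ≥0} (hs1 : s < 1) (hr : 1 < r)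
    (hrτ : r ≤ τ) (hP : CompBounded s τ M r) :
    ∃ D : ℝ≥0, ∀ X V, IsDeformation s τ M X V → ∀ G : Plane → ℂ, Integrable G →
      ∀ N : ℝ≥0∞, wn s G ≤ N → wn r G ≤ N → N < ∞ → ∀ a j, ∃ P : Plane → ℂ, Integrable P ∧
        (∀ y, 𝓕⁻ P y = 𝓕⁻ G (X y) * jac X V a j y) ∧ wn r P ≤ D * N := by
  obtain ⟨C, hC⟩ := hP
  obtain ⟨K, hK⟩ := exists_lintegral_le_wn hs1 hr
  set R : ℝ≥0 := Real.toNNReal (2 ^ r)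
  refine ⟨2 * C + R * (2 * C * (K * (4 * C * M)) + K * (3 * C) * (3 * C * M)),
    fun X V h G hG N hs hrN hN a j => ?_⟩
  obtain ⟨H, hH, hH1, hHs, hHr⟩ := hC X V h G hG (hs.trans_lt hN) (hrN.trans_lt hN)
  -- The entries have order `r` by interpolation between `s` and `τ`; this is what limits the
  -- induction to `r ≤ τ`.
  have hVr : wn r (V a j) ≤ 2 * M := by
    refine (wn_le_wn_add_wn (a := s) (by linarith) hrτ (h.int a j).1).trans ?_
    rw [two_mul]
    exact add_le_add (h.wn_s a j) (h.wn_t a j)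
  obtain ⟨W, hW, hW1, hWs, hWr⟩ := hC X V h (V a j) (h.int a j)
    ((h.wn_s a j).trans_lt ENNReal.coe_lt_top) (hVr.trans_lt (by finiteness))
  have hHs' : wn s H ≤ C * N := hHs.trans (by gcongr)
  have hHr' : wn r H ≤ 2 * C * N := hHr.trans (by
    calc _ ≤ (C : ℝ≥0∞) * (N + N) := by gcongr
      _ = _ := by ring)
  have hWs' : wn s W ≤ C * M := hWs.trans (by gcongr; exact h.wn_s a j)
  have hWr' : wn r W ≤ 3 * C * M := hWr.trans (by
    calc _ ≤ (C : ℝ≥0∞) * (M + 2 * M) := by gcongr; exact h.wn_s a j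
      _ = _ := by ring)
  have hHl : ∫⁻ ξ, ‖H ξ‖ₑ ≤ K * (3 * C) * N := (hK H hH.1).trans (by
    calc _ ≤ (K : ℝ≥0∞) * (C * N + 2 * C * N) := by gcongr
      _ = _ := by ring)
  have hWl : ∫⁻ ξ, ‖W ξ‖ₑ ≤ K * (4 * C * M) := (hK W hW.1).trans (by
    calc _ ≤ (K : ℝ≥0∞) * (C * M + 3 * C * M) := by gcongr
      _ = _ := by ring)
  have hc : ‖(if a = j then (1 : ℂ) else 0)‖ ≤ 1 := by split_ifs <;> simp
  have hi1 : Integrable fun ξ => (if a = j then (1 : ℂ) else 0) * H ξ := hH.const_mul _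
  refine ⟨fun ξ => (if a = j then (1 : ℂ) else 0) * H ξ + sconv H W ξ,
    hi1.add (integrable_sconv hH hW), fun y => ?_, ?_⟩
  · rw [fourierInv_add_of_integrable hi1 (integrable_sconv hH hW), fourierInv_const_mul,
      fourierInv_sconv hH hW, hH1, hW1, jac]
    ring
  · refine (wn_add_le hi1.1 (integrable_sconv hH hW).1).trans ?_
    have e : ENNReal.ofReal (2 ^ r) = (R : ℝ≥0∞) := rfl
    have h3 := wn_sconv_le (r := r) (by linarith) hH.1 hW.1
    rw [e] at h3
    calc _ ≤ 2 * C * N + R * (2 * C * N * (K * (4 * C * M)) + K * (3 * C) * N * (3 * C * M)) := by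
          refine add_le_add ((wn_const_mul_le hc H).trans hHr') (h3.trans ?_)
          gcongr
      _ = _ := by push_cast; ring

/-- By the chain rule, each derivative of the composition is a sum of products with Jacobian
entries. Those products have spectra of order `r`, because for `s < 1 < r` the factors have
integrable spectra and the convolution estimate applies. -/
theorem CompBounded.add_one {s τ r : ℝ} {M : ℝ≥0} (hs0 : 0 < s) (hs1 : s < 1) (hr : 1 < r)
    (hrτ : r ≤ τ) (hP : CompBounded s τ M r) : CompBounded s τ M (r + 1) := by
  obtain ⟨D, hD⟩ := hP.exists_comp_mul_jac hs1 hr hrτ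
  obtain ⟨C, hC⟩ := hP
  refine ⟨C + 28 * D, fun X V h G hG hGs hGr => ?_⟩
  set N := wn s G + wn (r + 1) G with hN
  have hNt : N < ∞ := ENNReal.add_lt_top.2 ⟨hGs, hGr⟩
  have hGr' : wn r G < ∞ := (wn_le_wn_add_wn (a := s) (b := r + 1) (by linarith) (by linarith) hG.1).trans_lt hNt
  obtain ⟨H, hH, hH1, hHs, -⟩ := hC X V h G hG hGs hGr'
  have hGi : ∀ j, Integrable (dsym j G) := fun j =>
    integrable_dsym (by linarith) (by linarith) hG.1 hGs hGr
  have hds : ∀ a, wn s (dsym a G) ≤ 7 * N := fun a => (wn_dsym_le s a G).trans (by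
    gcongr
    exact wn_le_wn_add_wn (by linarith) (by linarith) hG.1)
  have hdr : ∀ a, wn r (dsym a G) ≤ 7 * N := fun a => (wn_dsym_le r a G).trans (by
    gcongr
    exact le_add_self)
  choose P hP1 hP2 hP3 using fun a j =>
    hD X V h (dsym a G) (hGi a) (7 * N) (hds a) (hdr a) (by finiteness) a j
  obtain ⟨hd, hd'⟩ := differentiable_fourierInv hG hGi
  have hHe : 𝓕⁻ H = fun y => 𝓕⁻ G (X y) := funext hH1
  have key : ∀ j, wn r (dsym j H) ≤ 14 * D * N := by
    intro j
    -- Uniqueness identifies the spectrum obtained from the products with the derivative of the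
    -- given `H`.
    have hae : dsym j H =ᵐ[volume] fun ξ => P 0 j ξ + P 1 j ξ := by
      refine dsym_ae_eq_of_fderiv hH ((hP1 0 j).add (hP1 1 j)) ?_ fun x => ?_
      · rw [hHe]; exact hd.comp h.diff
      · rw [hHe, h.fderiv_comp hd, Fin.sum_univ_two, hd', hd', ← hP2, ← hP2]
        exact (fourierInv_add_of_integrable (hP1 0 j) (hP1 1 j) x).symm
    rw [wn_congr_ae hae]
    refine (wn_add_le (hP1 0 j).1 (hP1 1 j).1).trans ((add_le_add (hP3 0 j) (hP3 1 j)).trans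
      (le_of_eq (by ring)))
  refine ⟨H, hH, hH1, hHs.trans (by gcongr; exact le_self_add), ?_⟩
  refine (wn_add_one_le r hH.1).trans ((add_le_add (key 0) (key 1)).trans ?_)
  calc 14 * D * N + 14 * D * N = 0 + 28 * D * N := by ring
    _ ≤ C * N + 28 * D * N := by gcongr; exact zero_le
    _ = _ := by push_cast; ring

/-- The base interval `(1, 2]` has length one and contains its right endpoint, so unit steps reach
every order above 1. -/
theorem compBounded {s τ : ℝ} (hs0 : 0 < s) (hs1 : s < 1) (hτ : 2 < τ) (M : ℝ≥0) (n : ℕ) :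
    ∀ r : ℝ, 1 < r → r ≤ n + 2 → r ≤ τ → CompBounded s τ M r := by
  induction n with
  | zero =>
    intro r h1 h2 _
    exact exists_comp_spectrum_le_two hs0 hs1 hτ M h1 (by simpa using h2)
  | succ n ih =>
    intro r h1 h2 h3
    by_cases h : r ≤ 2
    · exact ih r h1 (by linarith [(n.cast_nonneg : (0 : ℝ) ≤ n)]) h3
    · push_cast at h2
      have := (ih (r - 1) (by linarith) (by linarith) (by linarith)).add_one hs0 hs1
        (by linarith) (by linarith)
      rwa [sub_add_cancel] at this

theorem exists_comp_spectrum {s τ : ℝ} (hs0 : 0 < s) (hs1 : s < 1) (hτ : 2 < τ) (M : ℝ≥0) :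
    CompBounded s τ M τ := by
  obtain ⟨n, hn⟩ := exists_nat_ge τ
  exact compBounded hs0 hs1 hτ M n τ (by linarith) (by linarith) le_rfl

/-! ### The null form at negative order. -/

theorem ae_integrable_sconv {F G : Plane → ℂ} (hF : Integrable F) (hG : Integrable G) :
    ∀ᵐ ξ, Integrable fun η => F η * G (ξ - η) := by
  filter_upwards [hF.ae_convolution_exists (ContinuousLinearMap.mul ℂ ℂ) hG] with ξ h
  exact h

theorem sconv_apply (F G : Plane → ℂ) (ξ : Plane) : sconv F G ξ = ∫ η, F η * G (ξ - η) := rfl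

/-- The null form `∂₁f ∂₂g - ∂₂f ∂₁g` is a sum of derivatives of products. -/
theorem nullForm_ae_eq {F G : Plane → ℂ} (hF : Integrable F) (hF' : ∀ j, Integrable (dsym j F))
    (hG' : ∀ j, Integrable (dsym j G)) :
    (fun ξ => sconv (dsym 0 F) (dsym 1 G) ξ - sconv (dsym 1 F) (dsym 0 G) ξ) =ᵐ[volume]
      fun ξ => dsym 0 (sconv F (dsym 1 G)) ξ - dsym 1 (sconv F (dsym 0 G)) ξ := by
  filter_upwards [ae_integrable_sconv (hF' 0) (hG' 1), ae_integrable_sconv (hF' 1) (hG' 0),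
    ae_integrable_sconv hF (hG' 1), ae_integrable_sconv hF (hG' 0)] with ξ h1 h2 h3 h4
  rw [dsym, dsym, sconv_apply, sconv_apply, sconv_apply, sconv_apply, ← integral_sub h1 h2,
    ← integral_const_mul, ← integral_const_mul, ← integral_sub (h3.const_mul _) (h4.const_mul _)]
  congr 1
  funext η
  -- Writing `ξ = η + (ξ - η)`, the terms in which both derivatives fall on `G` cancel.
  simp only [dsym, PiLp.sub_apply]
  push_cast
  ring

/-- The product estimate needs a nonnegative order. In divergence form the outer derivative raises
the order from `s - 1` to `s`, and `F` enters undifferentiated. -/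
theorem wn_nullForm_le {s : ℝ} (hs : 0 ≤ s) {F G : Plane → ℂ} (hF : Integrable F)
    (hF' : ∀ j, Integrable (dsym j F)) (hG' : ∀ j, Integrable (dsym j G)) {Q : ℝ≥0∞}
    (hQ : ∀ j, wn s F * (∫⁻ ξ, ‖dsym j G ξ‖ₑ) + (∫⁻ ξ, ‖F ξ‖ₑ) * wn s (dsym j G) ≤ Q) :
    wn (s - 1) (fun ξ => sconv (dsym 0 F) (dsym 1 G) ξ - sconv (dsym 1 F) (dsym 0 G) ξ) ≤
      14 * ENNReal.ofReal (2 ^ s) * Q := by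
  rw [wn_congr_ae (nullForm_ae_eq hF hF' hG')]
  have key : ∀ i j, wn (s - 1) (dsym i (sconv F (dsym j G))) ≤
      7 * (ENNReal.ofReal (2 ^ s) * Q) := by
    intro i j
    refine (wn_dsym_le _ _ _).trans ?_
    rw [sub_add_cancel]
    gcongr
    refine (wn_sconv_le hs hF.1 (hG' j).1).trans ?_
    gcongr
    exact hQ j
  refine (wn_sub_le (aestronglyMeasurable_dsym _ (integrable_sconv hF (hG' 1)).1)
    (aestronglyMeasurable_dsym _ (integrable_sconv hF (hG' 0)).1)).trans
      ((add_le_add (key 0 1) (key 1 0)).trans (le_of_eq (by ring)))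

theorem fourierInv_sub_of_integrable {G H : Plane → ℂ} (hG : Integrable G) (hH : Integrable H)
    (x : Plane) : 𝓕⁻ (fun ξ => G ξ - H ξ) x = 𝓕⁻ G x - 𝓕⁻ H x := by
  have h := fourierInv_add_of_integrable (G := fun ξ => G ξ - H ξ) (hG.sub hH) hH x
  simp only [sub_add_cancel] at h
  exact eq_sub_of_add_eq h.symm

theorem fourierInv_nullForm {F G : Plane → ℂ} (hF : ∀ j, Integrable (dsym j F))
    (hG : ∀ j, Integrable (dsym j G)) (x : Plane) :
    𝓕⁻ (fun ξ => sconv (dsym 0 F) (dsym 1 G) ξ - sconv (dsym 1 F) (dsym 0 G) ξ) x =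
      𝓕⁻ (dsym 0 F) x * 𝓕⁻ (dsym 1 G) x - 𝓕⁻ (dsym 1 F) x * 𝓕⁻ (dsym 0 G) x := by
  rw [fourierInv_sub_of_integrable (integrable_sconv (hF 0) (hG 1))
    (integrable_sconv (hF 1) (hG 0)), fourierInv_sconv (hF 0) (hG 1), fourierInv_sconv (hF 1) (hG 0)]

/-! ### Displacements along one axis and low frequencies. -/

/-- The fundamental theorem of calculus on the segment, then Cauchy–Schwarz. Only the derivative in
the direction `e` enters, which is why displacements are split by axis. -/
theorem enorm_shift_sub_sq_le {f : Plane → ℂ} (hf : ContDiff ℝ 1 f) (p e : Plane) (c : ℝ) :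
    ‖f (p + c • e) - f p‖ₑ ^ 2 ≤
      ‖c‖ₑ ^ 2 * ∫⁻ t in Set.Icc (0 : ℝ) 1, ‖fderiv ℝ f (p + (t * c) • e) e‖ₑ ^ 2 := by
  have hd := hf.differentiable one_ne_zero
  have hcd : Continuous fun t : ℝ => fderiv ℝ f (p + (t * c) • e) e :=
    ((hf.continuous_fderiv one_ne_zero).comp (by fun_prop)).clm_apply continuous_const
  have hD : ∀ t : ℝ, HasDerivAt (fun t : ℝ => f (p + (t * c) • e))
      ((c : ℂ) * fderiv ℝ f (p + (t * c) • e) e) t := by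
    intro t
    have h1 : HasDerivAt (fun t : ℝ => p + (t * c) • e) (c • e) t := by
      have := (((hasDerivAt_id t).mul_const c).smul_const e).const_add p
      simpa using this
    have := (hd (p + (t * c) • e)).hasFDerivAt.comp_hasDerivAt t h1
    rw [map_smul, Complex.real_smul] at this
    exact this
  have hint := intervalIntegral.integral_eq_sub_of_hasDerivAt (a := 0) (b := 1)
    (fun t _ => hD t) ((continuous_const.mul hcd).intervalIntegrable _ _)
  simp only [one_mul, zero_mul, zero_smul, add_zero] at hint
  rw [← hint, intervalIntegral.integral_of_le zero_le_one, ← integral_Icc_eq_integral_Ioc]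
  have hc : ‖c‖ₑ = ‖(c : ℂ)‖ₑ := by
    rw [← ofReal_norm, ← ofReal_norm, Complex.norm_real]
  calc _ ≤ (∫⁻ t in Set.Icc (0 : ℝ) 1, ‖(c : ℂ)‖ₑ * ‖fderiv ℝ f (p + (t * c) • e) e‖ₑ) ^ 2 := by
        gcongr
        refine (enorm_integral_le_lintegral_enorm _).trans (le_of_eq ?_)
        simp only [enorm_mul]
    _ ≤ (∫⁻ t in Set.Icc (0 : ℝ) 1, ‖(c : ℂ)‖ₑ ^ 2) *
          ∫⁻ t in Set.Icc (0 : ℝ) 1, ‖fderiv ℝ f (p + (t * c) • e) e‖ₑ ^ 2 :=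
        sq_lintegral_mul_le _ aemeasurable_const hcd.enorm.measurable.aemeasurable
    _ = _ := by simp [hc]

/-- For each intermediate `t` the shifted map is antilipschitz, and substituting it costs the factor
`2 ^ 2`. -/
theorem lintegral_shift_sub_sq_le {f : Plane → ℂ} (hf : ContDiff ℝ 1 f) {p : Plane → Plane}
    {c : Plane → ℝ} (hp : Continuous p) (hc : Continuous c) (e : Plane) {B : ℝ≥0}
    (hB : ∀ y, ‖c y‖ ≤ B)
    (hZ : ∀ t ∈ Set.Icc (0 : ℝ) 1, AntilipschitzWith 2 fun y => p y + (t * c y) • e) :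
    ∫⁻ y, ‖f (p y + c y • e) - f (p y)‖ₑ ^ 2 ≤ 4 * B ^ 2 * ∫⁻ y, ‖fderiv ℝ f y e‖ₑ ^ 2 := by
  have hfc : Continuous fun x => fderiv ℝ f x e :=
    (hf.continuous_fderiv one_ne_zero).clm_apply continuous_const
  calc _ ≤ ∫⁻ y, (B : ℝ≥0∞) ^ 2 *
        ∫⁻ t in Set.Icc (0 : ℝ) 1, ‖fderiv ℝ f (p y + (t * c y) • e) e‖ₑ ^ 2 := by
        refine lintegral_mono fun y => (enorm_shift_sub_sq_le hf _ _ _).trans ?_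
        gcongr
        exact enorm_le_coe.2 (hB y)
    _ = (B : ℝ≥0∞) ^ 2 * ∫⁻ t in Set.Icc (0 : ℝ) 1,
        ∫⁻ y, ‖fderiv ℝ f (p y + (t * c y) • e) e‖ₑ ^ 2 := by
        rw [lintegral_const_mul' _ _ (by finiteness), lintegral_lintegral_swap]
        refine Continuous.aemeasurable ?_
        have : Continuous fun q : Plane × ℝ => fderiv ℝ f (p q.1 + (q.2 * c q.1) • e) e :=
          hfc.comp (by fun_prop)
        exact (ENNReal.continuous_pow 2).comp this.enorm
    _ ≤ (B : ℝ≥0∞) ^ 2 * ∫⁻ t in Set.Icc (0 : ℝ) 1, 4 * ∫⁻ y, ‖fderiv ℝ f y e‖ₑ ^ 2 := by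
        refine mul_le_mul_of_nonneg_left ?_ zero_le
        refine setLIntegral_mono' (measurableSet_Icc (a := (0 : ℝ)) (b := 1)) fun t ht => ?_
        have hZt : Continuous fun y => p y + (t * c y) • e := by fun_prop
        refine (lintegral_comp_le_of_antilipschitz (hZ t ht) hZt.measurable
          (q := fun x => ‖fderiv ℝ f x e‖ₑ ^ 2) (hfc.enorm.measurable.pow_const 2)).trans
            (le_of_eq ?_)
        norm_num
    _ = _ := by
        rw [lintegral_const]
        simp
        ring

/-- Split the increment of the difference at distance `h`. Replacing `c (x + h)` by `c x` costs the
Lipschitz constant times an increment of `c`. What remains is the shift by `c x` of `f (· + h) - f`,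
to which the `L²` bound applies. -/
theorem gag_shift_sub_le (θ : ℝ) {f : Plane → ℂ} (hf : ContDiff ℝ 1 f) {L : ℝ≥0}
    (hL : ∀ x y, ‖f x - f y‖ ≤ L * ‖x - y‖) {c : Plane → ℝ} (hc : Continuous c) {e : Plane}
    (he : ‖e‖ = 1) {B : ℝ≥0} (hB : ∀ y, ‖c y‖ ≤ B)
    (hZ : ∀ t ∈ Set.Icc (0 : ℝ) 1, AntilipschitzWith 2 fun y => y + (t * c y) • e) :
    gag θ (fun y => f (y + c y • e) - f y) ≤
      2 * L ^ 2 * gag θ (fun y => (c y : ℂ)) + 8 * B ^ 2 * gag θ (fun y => fderiv ℝ f y e) := by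
  have hcc : Continuous fun y => (c y : ℂ) := Complex.continuous_ofReal.comp hc
  have hd := hf.differentiable one_ne_zero
  simp only [gag]
  rw [← lintegral_const_mul' _ _ (by finiteness), ← lintegral_const_mul' _ _ (by finiteness),
    ← lintegral_add_left]
  · refine lintegral_mono fun h => ?_
    have hg : ContDiff ℝ 1 fun x => f (x + h) - f x := by fun_prop
    have hgd : ∀ y, fderiv ℝ (fun x => f (x + h) - f x) y e =
        fderiv ℝ f (y + h) e - fderiv ℝ f y e := by
      intro y
      rw [fderiv_fun_sub (by fun_prop) (hd y), fderiv_comp_add_right]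
      rfl
    have hs := lintegral_shift_sub_sq_le hg continuous_id hc e hB hZ
    simp only [hgd, id] at hs
    calc _ ≤ ENNReal.ofReal (‖h‖ ^ (-(2 + 2 * θ))) * ∫⁻ x,
          (2 * L ^ 2 * ‖(c (x + h) : ℂ) - c x‖ₑ ^ 2 + 2 * (1 : ℝ≥0) ^ 2 *
            ‖f (x + c x • e + h) - f (x + c x • e) - (f (x + h) - f x)‖ₑ ^ 2) := by
          gcongr with x
          refine enorm_sq_le_two_mul_add ?_
          have : f (x + h + c (x + h) • e) - f (x + h) - (f (x + c x • e) - f x) =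
            (f (x + h + c (x + h) • e) - f (x + c x • e + h)) +
              (f (x + c x • e + h) - f (x + c x • e) - (f (x + h) - f x)) := by ring
          rw [this, NNReal.coe_one, one_mul]
          refine (norm_add_le _ _).trans (add_le_add ((hL _ _).trans (le_of_eq ?_)) le_rfl)
          have e2 : x + h + c (x + h) • e - (x + c x • e + h) = (c (x + h) - c x) • e := by
            rw [sub_smul]; abel
          rw [e2, norm_smul, he, mul_one, ← Complex.ofReal_sub, Complex.norm_real]
      _ ≤ ENNReal.ofReal (‖h‖ ^ (-(2 + 2 * θ))) *
          (2 * L ^ 2 * (∫⁻ x, ‖(c (x + h) : ℂ) - c x‖ₑ ^ 2) + 2 * (4 * B ^ 2 *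
            ∫⁻ y, ‖fderiv ℝ f (y + h) e - fderiv ℝ f y e‖ₑ ^ 2)) := by
          gcongr
          rw [lintegral_add_left (by fun_prop), lintegral_const_mul' _ _ (by finiteness),
            lintegral_const_mul' _ _ (by finiteness)]
          simp only [ENNReal.coe_one, one_pow, mul_one]
          gcongr
      _ = _ := by ring
  · refine Measurable.const_mul (Measurable.mul (by fun_prop) ?_) _
    exact Measurable.lintegral_prod_right' (f := fun p : Plane × Plane =>
      ‖(c (p.2 + p.1) : ℂ) - c p.2‖ₑ ^ 2) (by fun_prop)

theorem antilipschitzWith_two_id_add {g : Plane → Plane}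
    (hg : ∀ x y, ‖g x - g y‖ ≤ 1 / 2 * ‖x - y‖) : AntilipschitzWith 2 fun y => y + g y := by
  refine AntilipschitzWith.of_le_mul_dist fun x y => ?_
  rw [dist_eq_norm, dist_eq_norm]
  have h : x - y = (x + g x - (y + g y)) - (g x - g y) := by abel
  have h2 := norm_sub_le (x + g x - (y + g y)) (g x - g y)
  rw [← h] at h2
  have := hg x y
  push_cast
  linarith

theorem norm_smul_single_add_le {v : Plane} {a b : ℝ} (ha : |a| ≤ 1) (hb : |b| ≤ 1) :
    ‖(a * v 0) • (EuclideanSpace.single 0 1 : Plane) +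
      (b * v 1) • (EuclideanSpace.single 1 1 : Plane)‖ ≤ ‖v‖ := by
  rw [EuclideanSpace.norm_eq, EuclideanSpace.norm_eq]
  refine Real.sqrt_le_sqrt ?_
  simp only [Fin.sum_univ_two, PiLp.add_apply, PiLp.smul_apply, PiLp.single_apply,
    smul_eq_mul, Real.norm_eq_abs, sq_abs]
  have h1 : a ^ 2 ≤ 1 := (sq_le_one_iff_abs_le_one a).2 ha
  have h2 : b ^ 2 ≤ 1 := (sq_le_one_iff_abs_le_one b).2 hb
  simp
  nlinarith [sq_nonneg (v 0), sq_nonneg (v 1), mul_le_mul_of_nonneg_right h1 (sq_nonneg (v 0)),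
    mul_le_mul_of_nonneg_right h2 (sq_nonneg (v 1))]

theorem exists_norm_partial_schwartz_le {s τ : ℝ} (hs1 : s < 1) (hτ : 2 < τ) :
    ∃ K : ℝ≥0, ∀ (φ : 𝓢(Plane, ℂ)) (n : ℝ≥0), wn (s + 1) φ ≤ n → wn (τ + 1) φ ≤ n →
      ∀ j x, ‖𝓕⁻ (dsym j φ) x‖ ≤ (K * n : ℝ≥0) := by
  obtain ⟨K, hK⟩ := exists_lintegral_le_wn hs1 (by linarith : 1 < τ)
  refine ⟨14 * K, fun φ n h1 h2 j x => ?_⟩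
  obtain ⟨ψ, hψ⟩ := exists_schwartz_dsym φ j
  rw [← hψ]
  refine norm_fourierInv_le_of_lintegral ψ.integrable ((hK ψ ψ.integrable.1).trans ?_) x
  rw [hψ]
  calc _ ≤ (K : ℝ≥0∞) * (7 * n + 7 * n) := by
        gcongr
        · exact (wn_dsym_le s j φ).trans (by gcongr)
        · exact (wn_dsym_le τ j φ).trans (by gcongr)
    _ = _ := by push_cast; ring

/-- `ψt` is controlled only at the orders `s + 1` and `τ + 1`, so a term `wn 1 φ` as in
`exists_wn_one_add_comp_schwartz_le` is not affordable. A sup bound of the gradient and the finite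
seminorm of the Jacobian entries replace it through `gag_mul_le`. -/
theorem exists_wn_add_one_comp_schwartz_le {s τ : ℝ} (hs0 : 0 < s) (hs1 : s < 1) (hτ : 2 < τ)
    (M : ℝ≥0) :
    ∃ C : ℝ≥0, ∀ X V, IsDeformation s τ M X V → ∀ (φ : 𝓢(Plane, ℂ)) (n : ℝ≥0),
      wn (s + 1) φ ≤ n → wn (τ + 1) φ ≤ n →
      wn (s + 1) (𝓕 fun y => 𝓕⁻ (φ : Plane → ℂ) (X y)) ≤ C * n := by
  obtain ⟨B, hB⟩ := exists_bound_jac hs1 hτ M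
  obtain ⟨K, hK⟩ := exists_norm_partial_schwartz_le hs1 hτ
  obtain ⟨C, hC⟩ := exists_gag_comp_schwartz_le hs0 hs1
  have hc := (gagSymbol_pos s).ne'
  set c := (gagSymbol s (EuclideanSpace.single 0 1))⁻¹ with hcdef
  have hct : c ≠ ∞ := by simp [hcdef, hc]
  set D : ℝ≥0∞ := c * (2 * B ^ 2 * (C * 49) + 2 * K ^ 2 * (C * M ^ 2)) + 1 with hD
  have hDt : D ≠ ∞ := by finiteness
  refine ⟨4 * D.toNNReal, fun X V h φ n h1 h2 => ?_⟩
  have hF := comp_schwartz_props h.anti h.lip.continuous φ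
  have hprop : ∀ a j, Integrable (fun y => 𝓕⁻ (dsym a φ) (X y) * jac X V a j y) ∧
      wn s (𝓕 fun y => 𝓕⁻ (dsym a φ) (X y) * jac X V a j y) ≤ D * n := by
    intro a j
    obtain ⟨ψ, hψ⟩ := exists_schwartz_dsym φ a
    have hb := fun x => hK φ n h1 h2 a (X x)
    have hw : wn s (ψ : Plane → ℂ) ≤ 7 * n := by
      rw [hψ]; exact (wn_dsym_le s a φ).trans (by gcongr)
    rw [← hψ] at hb ⊢
    obtain ⟨g1, g2, g3, -⟩ := comp_schwartz_props h.anti h.lip.continuous ψ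
    obtain ⟨b1, b2, -, -⟩ := hB X V h a j
    have hjm := b2.continuous.aestronglyMeasurable (μ := volume)
    have hi := g2.mul_bdd hjm (Filter.Eventually.of_forall b1)
    refine ⟨hi, ?_⟩
    have hgj : gag s (jac X V a j) ≤ C * M ^ 2 := by
      have : gag s (jac X V a j) = gag s fun y => 𝓕⁻ (V a j) (X y) := by
        simp only [gag, jac, add_sub_add_left_eq_sub]
      rw [this]
      refine (hC X h.lip h.anti (V a j) (h.int a j)
        ((h.wn_s a j).trans_lt ENNReal.coe_lt_top)).trans ?_
      gcongr
      exact h.wn_s a j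
    have hgm := (gag_mul_le s g1 b1 hb).trans (add_le_add
      (mul_le_mul' le_rfl ((hC X h.lip h.anti ψ ψ.integrable (wn_schwartz_lt_top hs0.le ψ)).trans
        (mul_le_mul' le_rfl (pow_le_pow_left' hw 2)))) (mul_le_mul' le_rfl hgj))
    have hsq := wn_fourier_sq_le hs0 hs1 hi (MemLp.mul (p := 2) (q := ∞)
      (memLp_top_of_bound hjm B (Filter.Eventually.of_forall b1)) g3) hgm
    have := le_mul_add_of_sq_le (y := (n : ℝ≥0∞)) (z := 0) (B := 0)
      (A := c * (2 * B ^ 2 * (C * 49) + 2 * K ^ 2 * (C * M ^ 2))) (hsq.trans (le_of_eq (by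
        rw [← hcdef]
        push_cast
        ring)))
    simpa only [add_zero] using this
  have hm := fun a j => (continuous_fourier_of_integrable (hprop a j).1).aestronglyMeasurable
    (μ := volume)
  have hw := wn_add_one_le s (continuous_fourier_of_integrable hF.2.1).aestronglyMeasurable
  rw [fourier_comp_partial hs1 hτ h, fourier_comp_partial hs1 hτ h] at hw
  refine hw.trans ((add_le_add (wn_add_le (hm 0 0) (hm 1 0))
    (wn_add_le (hm 0 1) (hm 1 1))).trans ?_)
  calc _ ≤ (D * n + D * n) + (D * n + D * n) := by
        gcongr
        exacts [(hprop 0 0).2, (hprop 1 0).2, (hprop 0 1).2, (hprop 1 1).2]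
    _ = _ := by push_cast; rw [ENNReal.coe_toNNReal hDt]; ring

theorem fourier_add_of_integrable {F G : Plane → ℂ} (hF : Integrable F) (hG : Integrable G)
    (ξ : Plane) : 𝓕 (fun x => F x + G x) ξ = 𝓕 F ξ + 𝓕 G ξ := by
  have h := congrFun (VectorFourier.fourierIntegral_add Real.continuous_fourierChar
    (L := innerₗ Plane) continuous_inner hF hG) ξ
  exact h

/-- Low frequencies of a composition with a displacement whose second component has finite
Gagliardo seminorm. -/
theorem exists_lintegral_ball_comp_schwartz_le {s τ : ℝ} (hs0 : 0 < s) (hs1 : s < 1) (hτ : 2 < τ)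
    {X : Plane → Plane} (hY : ∀ x y, ‖X x - x - (X y - y)‖ ≤ 1 / 2 * ‖x - y‖)
    (hXc : Continuous X) {B : ℝ≥0} (hB : ∀ y i, ‖(X y - y) i‖ ≤ B)
    (hg : gag s (fun y => (((X y - y) 1 : ℝ) : ℂ)) < ∞) :
    ∃ C : ℝ≥0, ∀ (φ : 𝓢(Plane, ℂ)) (n : ℝ≥0), wn (s + 1) φ ≤ n → wn (τ + 1) φ ≤ n →
      wn 0 (dsym 0 φ) ≤ n →
      ∫⁻ ξ in Metric.ball (0 : Plane) 1, ‖𝓕 (fun y => 𝓕⁻ (φ : Plane → ℂ) (X y)) ξ‖ₑ ≤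
        (∫⁻ ξ, ‖φ ξ‖ₑ) + C * n := by
  obtain ⟨K, hK⟩ := exists_norm_partial_schwartz_le hs1 hτ
  obtain ⟨K₀, hK₀⟩ := exists_lintegral_ball_le_wn zero_lt_one
  obtain ⟨K₁, hK₁⟩ := exists_lintegral_ball_le_wn hs1
  have hc := (gagSymbol_pos s).ne'
  have hct' := (gagSymbol_lt_top hs0 hs1).ne
  set γ := gagSymbol s (EuclideanSpace.single 0 1) with hγ
  have hct : γ⁻¹ ≠ ∞ := by simp [hc]
  set g₀ := gag s (fun y => (((X y - y) 1 : ℝ) : ℂ)) with hg₀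
  set D : ℝ≥0∞ := γ⁻¹ * (2 * (2 * K) ^ 2 * g₀ + 8 * B ^ 2 * (γ * 49)) + 1 with hD
  have hDt : D ≠ ∞ := by finiteness
  refine ⟨K₀ * (2 * B + 1) ^ 2 + K₁ * D.toNNReal, fun φ n h1 h2 h3 => ?_⟩
  set e : Fin 2 → Plane := fun j => EuclideanSpace.single j 1 with he
  set c : Fin 2 → Plane → ℝ := fun i y => (X y - y) i with hcc
  have hXe : ∀ y, X y = y + c 1 y • e 1 + c 0 y • e 0 := by
    intro y
    ext i
    fin_cases i <;> simp [hcc, he]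
  have hcont : ∀ i, Continuous (c i) := fun i => by
    simp only [hcc]; fun_prop
  -- Shrinking the components of the displacement keeps it Lipschitz with constant one half, so all
  -- intermediate maps remain antilipschitz.
  have hshift : ∀ a b : ℝ, |a| ≤ 1 → |b| ≤ 1 → AntilipschitzWith 2 fun y =>
      y + ((a * c 0 y) • e 0 + (b * c 1 y) • e 1) := by
    intro a b ha hb
    refine antilipschitzWith_two_id_add fun x y => ?_
    refine le_trans (le_of_eq ?_) ((norm_smul_single_add_le (v := X x - x - (X y - y)) ha hb).trans
      (hY x y))
    congr 1
    simp only [hcc, he, PiLp.sub_apply, mul_sub, sub_smul]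
    abel
  -- Only the displacement along `e 1` is applied. From `Z` to `X` the shift is along `e 0` and is
  -- bounded in `L²` by `∂₀f`. From the identity to `Z` it is bounded at order `s`, because `c 1`
  -- has finite seminorm.
  set Z : Plane → Plane := fun y => y + c 1 y • e 1 with hZ
  have hZc : Continuous Z := by
    have := hcont 1
    simp only [hZ]; fun_prop
  have hZA : AntilipschitzWith 2 Z := by
    simpa using hshift 0 1 (by simp) (by simp)
  have hXA : AntilipschitzWith 2 X := by
    have := hshift 1 1 (by simp) (by simp)
    convert this using 2 with y
    rw [hXe]
    simp only [one_mul]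
    abel
  obtain ⟨f1, f2, f3, f4, f5⟩ := schwartz_spectrum_props φ
  set f : Plane → ℂ := 𝓕⁻ (φ : Plane → ℂ) with hf
  have hd : ∀ j, ∃ ψ : 𝓢(Plane, ℂ), (ψ : Plane → ℂ) = dsym j φ := exists_schwartz_dsym φ
  have hdi : ∀ j, Integrable (dsym j φ) := fun j => by
    obtain ⟨ψ, hψ⟩ := hd j
    rw [← hψ]; exact ψ.integrable
  have hfC : ContDiff ℝ 1 f := contDiff_fourierInv φ.integrable hdi
  have hfp : ∀ j, (fun y => fderiv ℝ f y (e j)) = 𝓕⁻ (dsym j φ) := fun j =>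
    funext fun x => f5 x j
  have hLip : ∀ x y, ‖f x - f y‖ ≤ (2 * (K * n) : ℝ≥0) * ‖x - y‖ := by
    have := lipschitzWith_of_partials (f := f) f4 (B := K * n) fun x j => by
      rw [f5]; exact hK φ n h1 h2 j x
    exact fun x y => this.norm_sub_le x y
  obtain ⟨-, x2, x3, -⟩ := comp_schwartz_props hXA hXc φ
  obtain ⟨-, z2, z3, -⟩ := comp_schwartz_props hZA hZc φ
  set D₁ : Plane → ℂ := fun y => f (X y) - f (Z y) with hD₁
  set D₂ : Plane → ℂ := fun y => f (Z y) - f y with hD₂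
  have i1 : Integrable D₁ := x2.sub z2
  have i2 : Integrable D₂ := z2.sub f2
  have m1 : MemLp D₁ 2 volume := x3.sub z3
  have m2 : MemLp D₂ 2 volume := z3.sub f3
  have hsum : ∀ ξ, 𝓕 (fun y => f (X y)) ξ = φ ξ + (𝓕 D₁ ξ + 𝓕 D₂ ξ) := by
    intro ξ
    have e1 : 𝓕 f = φ := φ.continuous.fourier_fourierInv_eq φ.integrable (by
      rw [← SchwartzMap.fourier_coe]; exact (𝓕 φ).integrable)
    rw [← e1, ← fourier_add_of_integrable i1 i2, ← fourier_add_of_integrable (G := fun x => D₁ x + D₂ x) f2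
      (i1.add i2)]
    have e2 : (fun y => f (X y)) = fun x => f x + (D₁ x + D₂ x) := by
      funext x
      simp only [hD₁, hD₂]
      ring
    rw [e2]
  have w1 : wn 0 (𝓕 D₁) ≤ (2 * B + 1 : ℝ≥0) ^ 2 * n := by
    rw [wn_zero_eq, eLpNorm_fourier_eq i1 m1]
    have hA := lintegral_shift_sub_sq_le hfC hZc (hcont 0) (e 0) (B := B) (fun y => hB y 0)
      (fun t ht => by
        have := hshift t 1 (abs_le.2 ⟨by linarith [ht.1], ht.2⟩) (by simp)
        convert this using 2 with y
        simp only [hZ, one_mul]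
        abel)
    have hA' : eLpNorm D₁ 2 volume ^ 2 ≤ (4 * B ^ 2) * (n : ℝ≥0∞) ^ 2 + 0 * 0 ^ 2 := by
      rw [eLpNorm_two_sq]
      have : ∀ y, D₁ y = f (Z y + c 0 y • e 0) - f (Z y) := fun y => by
        simp only [hD₁, hZ, ← hXe]
      simp only [this]
      refine hA.trans ?_
      obtain ⟨ψ, hψ⟩ := hd 0
      have e2 := eLpNorm_two_sq (fun y => fderiv ℝ f y (e 0))
      rw [← e2, hfp 0, ← hψ, eLpNorm_fourierInv_eq ψ.integrable (ψ.memLp 2 volume), hψ,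
        ← wn_zero_eq]
      simp only [zero_mul, add_zero]
      gcongr
    have := le_mul_add_of_sq_le hA'
    simp only [add_zero] at this
    refine this.trans ?_
    gcongr
    push_cast
    calc (4 * B ^ 2 + 1 : ℝ≥0∞) ≤ (4 * B ^ 2 + 1) + 4 * B := le_self_add
      _ = _ := by ring
  have w2 : wn s (𝓕 D₂) ≤ D * n := by
    have hA := gag_shift_sub_le s hfC hLip (hcont 1) (e := e 1) (by simp [he]) (B := B)
      (fun y => hB y 1) (fun t ht => by
        have := hshift 0 t (by simp) (abs_le.2 ⟨by linarith [ht.1], ht.2⟩)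
        simpa using this)
    have hA2 : gag s (fun y => fderiv ℝ f y (e 1)) ≤ γ * (7 * n) ^ 2 := by
      obtain ⟨ψ, hψ⟩ := hd 1
      rw [hfp, ← hψ, gag_fourierInv_eq hs0 hs1 ψ.integrable (wn_schwartz_lt_top hs0.le ψ), hψ]
      gcongr
      exact (wn_dsym_le s 1 φ).trans (by gcongr)
    have hsq := wn_fourier_sq_le hs0 hs1 i2 m2 (hA.trans (add_le_add le_rfl
      (mul_le_mul' le_rfl hA2)))
    have := le_mul_add_of_sq_le (y := (n : ℝ≥0∞)) (z := 0) (B := 0)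
      (A := γ⁻¹ * (2 * (2 * K) ^ 2 * g₀ + 8 * B ^ 2 * (γ * 49))) (hsq.trans (le_of_eq (by
        push_cast
        rw [← hγ]
        ring)))
    simpa only [add_zero] using this
  have l1 := (hK₀ _ (continuous_fourier_of_integrable i1).aestronglyMeasurable).trans
    (mul_le_mul' le_rfl w1)
  have l2 := (hK₁ _ (continuous_fourier_of_integrable i2).aestronglyMeasurable).trans
    (mul_le_mul' le_rfl w2)
  calc _ ≤ ∫⁻ ξ in Metric.ball (0 : Plane) 1, (‖φ ξ‖ₑ + (‖𝓕 D₁ ξ‖ₑ + ‖𝓕 D₂ ξ‖ₑ)) := by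
        refine lintegral_mono fun ξ => ?_
        rw [hsum]
        exact (enorm_add_le _ _).trans (add_le_add le_rfl (enorm_add_le _ _))
    _ = (∫⁻ ξ in Metric.ball (0 : Plane) 1, ‖φ ξ‖ₑ) +
        ((∫⁻ ξ in Metric.ball (0 : Plane) 1, ‖𝓕 D₁ ξ‖ₑ) +
          ∫⁻ ξ in Metric.ball (0 : Plane) 1, ‖𝓕 D₂ ξ‖ₑ) := by
        rw [lintegral_add_left φ.continuous.enorm.measurable, lintegral_add_left
          (continuous_fourier_of_integrable i1).enorm.measurable]
    _ ≤ (∫⁻ ξ, ‖φ ξ‖ₑ) + (K₀ * ((2 * B + 1 : ℝ≥0) ^ 2 * n) + K₁ * (D * n)) := by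
        gcongr
        exact Measure.restrict_le_self
    _ = _ := by push_cast; rw [ENNReal.coe_toNNReal hDt]; ring

/-- A composition with a deformation has an integrable spectrum, without a bound on the norm of
order `s`, if the displacement has one component of finite Gagliardo seminorm. -/
theorem exists_integrable_comp_spectrum {s τ : ℝ} (hs0 : 0 < s) (hs1 : s < 1) (hτ : 2 < τ)
    {M : ℝ≥0} {X : Plane → Plane} {V : Fin 2 → Fin 2 → Plane → ℂ} (h : IsDeformation s τ M X V)
    (hY : ∀ x y, ‖X x - x - (X y - y)‖ ≤ 1 / 2 * ‖x - y‖) {B : ℝ≥0}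
    (hB : ∀ y i, ‖(X y - y) i‖ ≤ B) (hg : gag s (fun y => (((X y - y) 1 : ℝ) : ℂ)) < ∞)
    {G : Plane → ℂ} (hG : Integrable G) (h1 : wn (s + 1) G < ∞) (h2 : wn (τ + 1) G < ∞)
    (h3 : wn 0 (dsym 0 G) < ∞) :
    ∃ L : Plane → ℂ, Integrable L ∧ ∀ y, 𝓕⁻ L y = 𝓕⁻ G (X y) := by
  obtain ⟨C₁, hC₁⟩ := exists_wn_add_one_comp_schwartz_le hs0 hs1 hτ M
  obtain ⟨C₂, hC₂⟩ := exists_lintegral_ball_comp_schwartz_le hs0 hs1 hτ hY h.lip.continuous hB hg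
  obtain ⟨K, hK⟩ := exists_lintegral_compl_ball_le_wn (b := s + 1) (by linarith)
  -- The weight dominates the three available norms; its first term is the modulus of the symbol of
  -- `∂₀`.
  set w : Plane → ℝ := fun ξ => 2 * Real.pi * |ξ 0| + (‖ξ‖ ^ (s + 1) + ‖ξ‖ ^ (τ + 1)) with hw
  have hp := Real.pi_pos
  have hle : ∀ (g : Plane → ℂ) (v : Plane → ℝ), (∀ ξ, 0 ≤ v ξ) → (∀ ξ, v ξ ≤ w ξ) →
      eLpNorm (fun ξ => (v ξ : ℂ) * g ξ) 2 volume ≤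
        eLpNorm (fun ξ => (w ξ : ℂ) * g ξ) 2 volume := fun g v h0 hv => by
    refine eLpNorm_mono fun ξ => ?_
    rw [norm_mul, norm_mul, Complex.norm_of_nonneg (h0 ξ),
      Complex.norm_of_nonneg ((h0 ξ).trans (hv ξ))]
    gcongr
    exact hv ξ
  have hr : ∀ (r : ℝ) (ξ : Plane), 0 ≤ ‖ξ‖ ^ r := fun r ξ => Real.rpow_nonneg (norm_nonneg ξ) r
  have w1 : ∀ g : Plane → ℂ, wn (s + 1) g ≤ eLpNorm (fun ξ => (w ξ : ℂ) * g ξ) 2 volume := fun g =>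
    hle g (fun ξ => ‖ξ‖ ^ (s + 1)) (hr _) fun ξ => by
      simp only [hw]; linarith [hr (τ + 1) ξ, mul_nonneg (mul_nonneg zero_le_two hp.le)
        (abs_nonneg (ξ 0))]
  have w2 : ∀ g : Plane → ℂ, wn (τ + 1) g ≤ eLpNorm (fun ξ => (w ξ : ℂ) * g ξ) 2 volume := fun g =>
    hle g (fun ξ => ‖ξ‖ ^ (τ + 1)) (hr _) fun ξ => by
      simp only [hw]; linarith [hr (s + 1) ξ, mul_nonneg (mul_nonneg zero_le_two hp.le)
        (abs_nonneg (ξ 0))]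
  have hds : ∀ g : Plane → ℂ, wn 0 (dsym 0 g) =
      eLpNorm (fun ξ => ((2 * Real.pi * |ξ 0| : ℝ) : ℂ) * g ξ) 2 volume := fun g => by
    rw [wn_zero_eq]
    refine eLpNorm_congr_norm_ae (Filter.Eventually.of_forall fun ξ => ?_)
    rw [norm_dsym, norm_mul, Complex.norm_of_nonneg (by positivity)]
  have w3 : ∀ g : Plane → ℂ, wn 0 (dsym 0 g) ≤ eLpNorm (fun ξ => (w ξ : ℂ) * g ξ) 2 volume :=
    fun g => by
      rw [hds]
      exact hle g _ (fun ξ => by positivity) fun ξ => by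
        simp only [hw]; linarith [hr (s + 1) ξ, hr (τ + 1) ξ]
  have hGw : eLpNorm (fun ξ => (w ξ : ℂ) * G ξ) 2 volume < ∞ := by
    rw [hds] at h3
    have m1 : AEStronglyMeasurable (fun ξ : Plane => ((2 * Real.pi * |ξ 0| : ℝ) : ℂ) * G ξ) := by
      refine AEStronglyMeasurable.mul (Continuous.aestronglyMeasurable ?_) hG.1
      fun_prop
    have m2 := aestronglyMeasurable_weight (r := s + 1) hG.1
    have m3 := aestronglyMeasurable_weight (r := τ + 1) hG.1
    have e := (eLpNorm_add_le (p := 2) m1 (m2.add m3) (by norm_num)).trans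
      (add_le_add le_rfl (eLpNorm_add_le m2 m3 (by norm_num)))
    refine lt_of_le_of_lt (le_trans (le_of_eq ?_) e)
      (ENNReal.add_lt_top.2 ⟨h3, ENNReal.add_lt_top.2 ⟨h1, h2⟩⟩)
    congr 1
    funext ξ
    simp only [hw, Pi.add_apply]
    push_cast
    ring
  have key : ∀ φ : 𝓢(Plane, ℂ), ∃ n : ℝ≥0, (n : ℝ≥0∞) ≤
      3 * eLpNorm (fun ξ => (w ξ : ℂ) * φ ξ) 2 volume ∧
      ∫⁻ ξ, ‖𝓕 (fun y => 𝓕⁻ (φ : Plane → ℂ) (X y)) ξ‖ₑ ≤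
        (∫⁻ ξ, ‖φ ξ‖ₑ) + (C₂ + K * C₁ : ℝ≥0) * n := by
    intro φ
    have f1 := wn_schwartz_lt_top (r := s + 1) (by linarith) φ
    have f2 := wn_schwartz_lt_top (r := τ + 1) (by linarith) φ
    have f3 : wn 0 (dsym 0 φ) < ∞ := by
      obtain ⟨ψ, hψ⟩ := exists_schwartz_dsym φ 0
      rw [← hψ]
      exact wn_schwartz_lt_top le_rfl ψ
    set N := wn (s + 1) φ + (wn (τ + 1) φ + wn 0 (dsym 0 φ)) with hN
    have hNt : N ≠ ∞ := by finiteness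
    have hNc : (N.toNNReal : ℝ≥0∞) = N := ENNReal.coe_toNNReal hNt
    have n1 : wn (s + 1) φ ≤ N.toNNReal := by rw [hNc]; exact le_self_add
    have n2 : wn (τ + 1) φ ≤ N.toNNReal := by
      rw [hNc]; exact le_add_left le_self_add
    have n3 : wn 0 (dsym 0 φ) ≤ N.toNNReal := by
      rw [hNc]; exact le_add_left le_add_self
    refine ⟨N.toNNReal, ?_, ?_⟩
    · rw [hNc]
      refine (add_le_add (w1 φ) (add_le_add (w2 φ) (w3 φ))).trans (le_of_eq (by ring))
    · have hF := (continuous_fourier_of_integrable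
        (comp_schwartz_props h.anti h.lip.continuous φ).2.1).aestronglyMeasurable (μ := volume)
      rw [← lintegral_add_compl _ (measurableSet_ball (x := (0 : Plane)) (ε := 1))]
      calc _ ≤ ((∫⁻ ξ, ‖φ ξ‖ₑ) + C₂ * N.toNNReal) + K * (C₁ * N.toNNReal) :=
            add_le_add (hC₂ φ _ n1 n2 n3) ((hK _ hF).trans
              (mul_le_mul' le_rfl (hC₁ X V h φ _ n1 n2)))
        _ = _ := by push_cast; ring
  obtain ⟨L, hL, hL1, -⟩ := exists_comp_spectrum_of_schwartz h.anti h.lip.continuous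
    (b := τ + 1) (by linarith) (w := w) (by fun_prop) (C := 2 * Real.pi + 3)
    (fun ξ => by
      simp only [hw]; linarith [hr (s + 1) ξ, mul_nonneg (mul_nonneg zero_le_two hp.le)
        (abs_nonneg (ξ 0))])
    (fun ξ => by
      have hab : ∀ r : ℝ, 0 ≤ r → r ≤ τ + 1 → ‖ξ‖ ^ r ≤ 1 + ‖ξ‖ ^ (τ + 1) := fun r r0 r1 => by
        rcases le_total ‖ξ‖ 1 with h1 | h1
        · have := Real.rpow_le_one (norm_nonneg ξ) h1 r0
          linarith [hr (τ + 1) ξ]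
        · have := Real.rpow_le_rpow_of_exponent_le h1 r1
          linarith
      have a1 := hab 1 zero_le_one (by linarith)
      rw [Real.rpow_one] at a1
      have a2 := hab (s + 1) (by linarith) (by linarith)
      have a3 : |ξ 0| ≤ ‖ξ‖ := PiLp.norm_apply_le ξ 0
      have a4 := mul_le_mul_of_nonneg_left (a3.trans a1) (mul_nonneg zero_le_two hp.le)
      simp only [hw]
      nlinarith [hr (τ + 1) ξ])
    (1 + 3 * (C₂ + K * C₁))
    (fun φ => by
      obtain ⟨n, -, hn⟩ := key φ
      refine ⟨(continuous_fourier_of_integrable (comp_schwartz_props h.anti h.lip.continuous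
        φ).2.1).aestronglyMeasurable, hn.trans_lt (ENNReal.add_lt_top.2 ⟨?_, by finiteness⟩)⟩
      exact φ.integrable.2)
    (fun φ => by
      obtain ⟨n, hn1, hn⟩ := key φ
      set I := ∫⁻ ξ, ‖φ ξ‖ₑ
      set E := eLpNorm (fun ξ => (w ξ : ℂ) * φ ξ) 2 volume
      calc _ ≤ I + (C₂ + K * C₁ : ℝ≥0) * n := hn
        _ ≤ I + (C₂ + K * C₁ : ℝ≥0) * (3 * E) := by gcongr
        _ ≤ (I + (C₂ + K * C₁ : ℝ≥0) * (3 * E)) + (E + 3 * (C₂ + K * C₁ : ℝ≥0) * I) := le_self_add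
        _ = _ := by push_cast; ring)
    hG hGw
  exact ⟨L, hL, hL1⟩

/-! ### Passage to functions and inversion of the displacement. -/

/-- Low frequencies are integrable because the space requires a locally integrable transform, high
ones because `b > 1`. Continuity of `f` upgrades almost everywhere equality to equality. -/
theorem MemHomSobolev.exists_integrable_spectrum {b : ℝ} (hb : 1 < b) {f : Plane → ℝ}
    (hf : Continuous f) (h : MemHomSobolev b f) :
    ∃ G : Plane → ℂ, Integrable G ∧ (fun x => (f x : ℂ)) = 𝓕⁻ G ∧
      ∀ t, homSobolevNorm t f = wn t G := by
  obtain ⟨u, G, hu, hG, huG, hn⟩ := h.exists_spectrum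
  obtain ⟨K, hK⟩ := exists_lintegral_compl_ball_le_wn hb
  have hGm : AEStronglyMeasurable G := hG.aestronglyMeasurable
  have hwb : wn b G < ∞ := by rw [← hn]; exact h
  have hi : Integrable G := by
    rw [← integrableOn_univ, ← Set.union_compl_self (Metric.ball (0 : Plane) 1)]
    refine IntegrableOn.union ?_ ⟨hGm.restrict, (hK G hGm).trans_lt (by finiteness)⟩
    exact (hG.integrableOn_isCompact (isCompact_closedBall (0 : Plane) 1)).mono_set
      Metric.ball_subset_closedBall
  have hfc : Continuous fun x => (f x : ℂ) := Complex.continuous_ofReal.comp hf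
  have hc := continuous_fourierInv_of_integrable hi
  refine ⟨G, hi, ?_, hn⟩
  exact Continuous.ae_eq_iff_eq volume hfc hc |>.1
    (hu.ae_eq (isGivenBy_fourierInv hi huG) hfc.locallyIntegrable hc.locallyIntegrable)

theorem contDiff_of_ofReal_eq_fourierInv {f : Plane → ℝ} {G : Plane → ℂ}
    (hf : (fun x => (f x : ℂ)) = 𝓕⁻ G) (hG : Integrable G) (h : ∀ j, Integrable (dsym j G)) :
    ContDiff ℝ 1 f := by
  have := Complex.reCLM.contDiff.comp (contDiff_fourierInv hG h)
  rw [← hf] at this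
  exact this

theorem ofReal_partialDeriv {f : Plane → ℝ} {x : Plane} (hf : DifferentiableAt ℝ f x) (j : Fin 2) :
    (partialDeriv j f x : ℂ) = fderiv ℝ (fun x => (f x : ℂ)) x (EuclideanSpace.single j 1) := by
  have := (Complex.ofRealCLM.hasFDerivAt (x := f x)).comp x hf.hasFDerivAt
  rw [show (fun x => (f x : ℂ)) = Complex.ofRealCLM ∘ f from rfl, this.fderiv]
  rfl

/-- The essential bound holds on a dense set, which is closed because the gradient is continuous. -/
theorem lipschitzWith_of_eLpNorm_gradient_le {f : Plane → ℝ} (hf : ContDiff ℝ 1 f) {c : ℝ≥0}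
    (h : eLpNorm (∇ f) ∞ volume ≤ c) : LipschitzWith c f := by
  have hd := hf.differentiable one_ne_zero
  have hn : ∀ x, ‖∇ f x‖ = ‖fderiv ℝ f x‖ := fun x => by simp [gradient]
  have hcont : Continuous fun x => ‖∇ f x‖ := by
    simp only [hn]
    exact (hf.continuous_fderiv one_ne_zero).norm
  have hae : ∀ᵐ x, ‖∇ f x‖ ≤ c := by
    rw [eLpNorm_exponent_top] at h
    filter_upwards [ae_le_eLpNormEssSup (f := ∇ f) (μ := volume)] with x hx
    exact enorm_le_coe.1 (hx.trans h)
  refine lipschitzWith_of_nnnorm_fderiv_le hd fun x => ?_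
  rw [← NNReal.coe_le_coe, coe_nnnorm, ← hn]
  have hcl : IsClosed {x | ‖∇ f x‖ ≤ c} := isClosed_le hcont continuous_const
  have hdense : Dense {x | ‖∇ f x‖ ≤ c} := Measure.dense_of_ae hae
  have := hdense.closure_eq
  rw [hcl.closure_eq] at this
  exact (this ▸ Set.mem_univ x : x ∈ {x | ‖∇ f x‖ ≤ c})

theorem fderiv_apply_component {X : Plane → Plane} {y : Plane} (hX : DifferentiableAt ℝ X y)
    (i j : Fin 2) :
    partialDeriv j (fun z => X z i) y = fderiv ℝ X y (EuclideanSpace.single j 1) i := by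
  have := ((EuclideanSpace.proj i : Plane →L[ℝ] ℝ).hasFDerivAt (x := X y)).comp y hX.hasFDerivAt
  have h2 : (fun z => X z i) = (EuclideanSpace.proj i : Plane →L[ℝ] ℝ) ∘ X := rfl
  rw [partialDeriv, h2, this.fderiv]
  rfl

/-- Inversion of the map `x ↦ x + (-ψt x, ψ x)`. -/
theorem exists_inverse_displacement {ψ ψt : Plane → ℝ} (h1 : ContDiff ℝ 1 ψ) (h2 : ContDiff ℝ 1 ψt)
    (l1 : LipschitzWith (1 / 8) ψ) (l2 : LipschitzWith (1 / 8) ψt)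
    (hdet : ∀ x, (initialDeformation ψ ψt x).det = 1) :
    ∃ X : Plane → Plane, (∀ y, (X y - y) 0 = ψt (X y)) ∧ (∀ y, (X y - y) 1 = -ψ (X y)) ∧
      LipschitzWith 2 X ∧ (∀ x y, ‖X x - x - (X y - y)‖ ≤ 1 / 2 * ‖x - y‖) ∧
      Differentiable ℝ X ∧ ∀ y a j, fderiv ℝ X y (EuclideanSpace.single j 1) a =
        initialDeformation ψ ψt (X y) a j := by
  set e : Fin 2 → Plane := fun j => EuclideanSpace.single j 1 with he
  set b : Plane → Plane := fun x => ψ x • e 1 - ψt x • e 0 with hb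
  have hbl : LipschitzWith (1 / 4) b := by
    refine LipschitzWith.of_dist_le_mul fun x y => ?_
    have a1 := l1.norm_sub_le x y
    have a2 := l2.norm_sub_le x y
    rw [dist_eq_norm, dist_eq_norm]
    have : b x - b y = (ψ x - ψ y) • e 1 - (ψt x - ψt y) • e 0 := by
      simp only [hb, sub_smul]; abel
    rw [this]
    refine (norm_sub_le _ _).trans ?_
    rw [norm_smul, norm_smul]
    have n0 : ∀ j, ‖e j‖ = 1 := fun j => by simp [he]
    rw [n0, n0]
    push_cast at a1 a2 ⊢
    linarith
  have hbd : ContDiff ℝ 1 b := by fun_prop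
  have hbd' := hbd.differentiable one_ne_zero
  -- The fixed point solves `z + b z = y`, so it is the value at `y` of the inverse map.
  have hcontr : ∀ y, ContractingWith (1 / 4) fun z => y - b z := fun y =>
    ⟨by rw [← NNReal.coe_lt_coe]; norm_num, LipschitzWith.of_dist_le_mul fun x z => by
      rw [dist_sub_left]; exact hbl.dist_le_mul x z⟩
  set X : Plane → Plane := fun y => (hcontr y).fixedPoint _ with hX
  have hXe : ∀ y, X y - y = -b (X y) := fun y => by
    have : y - b (X y) = X y := (hcontr y).fixedPoint_isFixedPt
    nth_rw 1 [← this]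
    abel
  have hXl : ∀ x y, ‖X x - X y‖ ≤ 4 / 3 * ‖x - y‖ := fun x y => by
    have a1 := hbl.norm_sub_le (X x) (X y)
    have : X x - X y = (x - y) - (b (X x) - b (X y)) := by
      have e1 := hXe x
      have e2 := hXe y
      rw [sub_eq_iff_eq_add] at e1 e2
      nth_rw 1 [e1, e2]
      abel
    have a2 := norm_sub_le (x - y) (b (X x) - b (X y))
    rw [← this] at a2
    push_cast at a1
    linarith
  have hXL : LipschitzWith 2 X := LipschitzWith.of_dist_le_mul fun x y => by
    rw [dist_eq_norm, dist_eq_norm]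
    have := hXl x y
    push_cast
    linarith [norm_nonneg (x - y)]
  -- The derivative of `id + b` is invertible, its perturbation of the identity having norm below 1.
  have hXd : ∀ y, DifferentiableAt ℝ X y := fun y => by
    have hnorm : ‖-fderiv ℝ b (X y)‖ < 1 := by
      rw [norm_neg]
      refine (norm_fderiv_le_of_lipschitz ℝ hbl).trans_lt ?_
      norm_num
    have hA : HasFDerivAt (fun z => z + b z)
        ((ContinuousLinearEquiv.unitsEquiv ℝ Plane (Units.oneSub _ hnorm) : Plane ≃L[ℝ] Plane) :
          Plane →L[ℝ] Plane) (X y) := by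
      have := (hasFDerivAt_id (X y)).add (hbd' (X y)).hasFDerivAt
      refine this.congr_fderiv ?_
      ext v
      simp [ContinuousLinearEquiv.unitsEquiv_apply]
    refine (HasFDerivAt.of_local_left_inverse hXL.continuous.continuousAt hA
      (Filter.Eventually.of_forall fun z => ?_)).differentiableAt
    have := hXe z
    rw [sub_eq_iff_eq_add] at this
    change X z + b (X z) = z
    nth_rw 1 [this]
    abel
  refine ⟨X, fun y => ?_, fun y => ?_, hXL, fun x y => ?_, hXd, fun y a j => ?_⟩
  · rw [hXe]; simp [hb, he]
  · rw [hXe]; simp [hb, he]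
  · rw [hXe, hXe, neg_sub_neg, norm_sub_rev]
    have a1 := hbl.norm_sub_le (X x) (X y)
    have a2 := hXl x y
    push_cast at a1
    linarith [norm_nonneg (x - y)]
  · set v := fderiv ℝ X y (EuclideanSpace.single j 1) with hv
    have hψd := h1.differentiable one_ne_zero (X y)
    have hψtd := h2.differentiable one_ne_zero (X y)
    have hlin : ∀ f : Plane → ℝ, fderiv ℝ f (X y) v =
        v 0 * partialDeriv 0 f (X y) + v 1 * partialDeriv 1 f (X y) := by
      intro f
      conv_lhs => rw [← (EuclideanSpace.basisFun (Fin 2) ℝ).sum_repr v]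
      simp only [EuclideanSpace.basisFun_repr, EuclideanSpace.basisFun_apply, Fin.sum_univ_two,
        partialDeriv]
      rw [map_add, map_smul, map_smul, smul_eq_mul, smul_eq_mul]
    have hid : v + (fderiv ℝ ψ (X y) v • e 1 - fderiv ℝ ψt (X y) v • e 0) =
        EuclideanSpace.single j 1 := by
      have hD := ((hasFDerivAt_id (X y)).add ((hψd.hasFDerivAt.smul_const (e 1)).sub
        (hψtd.hasFDerivAt.smul_const (e 0)))).comp y (hXd y).hasFDerivAt
      have hfun : ((id + ((fun x => ψ x • e 1) - fun x => ψt x • e 0)) ∘ X) = id := by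
        funext z
        have := hXe z
        rw [sub_eq_iff_eq_add] at this
        change X z + b (X z) = z
        nth_rw 1 [this]
        abel
      rw [hfun] at hD
      have := DFunLike.congr_fun (hD.unique (hasFDerivAt_id y)) (EuclideanSpace.single j 1)
      simpa using this
    have q0 := congrArg (fun w : Plane => w 0) hid
    have q1 := congrArg (fun w : Plane => w 1) hid
    have hd := hdet (X y)
    rw [Matrix.det_fin_two] at hd
    simp [he, initialDeformation, hlin] at q0 q1 hd ⊢
    generalize partialDeriv 0 ψ (X y) = p0 at *
    generalize partialDeriv 1 ψ (X y) = p1 at *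
    generalize partialDeriv 0 ψt (X y) = r0 at *
    generalize partialDeriv 1 ψt (X y) = r1 at *
    -- Cramer's rule for the differentiated equation `X + b ∘ X = id`: the rows of `U₀` are the
    -- coefficients, and the determinant is 1.
    fin_cases j <;> fin_cases a <;> simp at q0 q1 ⊢
    · linear_combination (1 + p1) * q0 + r1 * q1 - v 0 * hd
    · linear_combination (-p0) * q0 + (1 - r0) * q1 - v 1 * hd
    · linear_combination (1 + p1) * q0 + r1 * q1 - v 0 * hd
    · linear_combination (-p0) * q0 + (1 - r0) * q1 - v 1 * hd

/-! ### Estimates of the displacement. -/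

theorem ofReal_partialDeriv_eq_fourierInv {f : Plane → ℝ} {G : Plane → ℂ}
    (hf : (fun x => (f x : ℂ)) = 𝓕⁻ G) (hG : Integrable G) (h : ∀ j, Integrable (dsym j G))
    (j : Fin 2) (x : Plane) : (partialDeriv j f x : ℂ) = 𝓕⁻ (dsym j G) x := by
  rw [ofReal_partialDeriv ((contDiff_of_ofReal_eq_fourierInv hf hG h).differentiable
    one_ne_zero x), hf, (differentiable_fourierInv hG h).2]

/-- The spectra of the entries of `initialDeformation ψ ψt - 1`. -/
noncomputable def deformationSpectrum (G Gt : Plane → ℂ) (a j : Fin 2) : Plane → ℂ :=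
  ![![dsym 1 G, dsym 1 Gt], ![fun ξ => -1 * dsym 0 G ξ, fun ξ => -1 * dsym 0 Gt ξ]] a j

theorem integrable_deformationSpectrum {G Gt : Plane → ℂ} (h : ∀ j, Integrable (dsym j G))
    (ht : ∀ j, Integrable (dsym j Gt)) (a j : Fin 2) :
    Integrable (deformationSpectrum G Gt a j) := by
  fin_cases a <;> fin_cases j
  exacts [h 1, ht 1, (h 0).const_mul _, (ht 0).const_mul _]

theorem wn_deformationSpectrum_le {G Gt : Plane → ℂ} {r : ℝ} {T : ℝ≥0∞} (h : wn (r + 1) G ≤ T)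
    (ht : wn (r + 1) Gt ≤ T) (a j : Fin 2) : wn r (deformationSpectrum G Gt a j) ≤ 7 * T := by
  have k : ∀ j, wn r (dsym j G) ≤ 7 * T := fun j => (wn_dsym_le r j G).trans (by gcongr)
  have kt : ∀ j, wn r (dsym j Gt) ≤ 7 * T := fun j => (wn_dsym_le r j Gt).trans (by gcongr)
  fin_cases a <;> fin_cases j
  exacts [k 1, kt 1, (wn_const_mul_le (by simp) _).trans (k 0),
    (wn_const_mul_le (by simp) _).trans (kt 0)]

theorem ofReal_initialDeformation {ψ ψt : Plane → ℝ} {G Gt : Plane → ℂ}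
    (hψ : (fun x => (ψ x : ℂ)) = 𝓕⁻ G) (hψt : (fun x => (ψt x : ℂ)) = 𝓕⁻ Gt)
    (hG : Integrable G) (hGt : Integrable Gt) (h : ∀ j, Integrable (dsym j G))
    (ht : ∀ j, Integrable (dsym j Gt)) (x : Plane) (a j : Fin 2) :
    (initialDeformation ψ ψt x a j : ℂ) =
      (if a = j then 1 else 0) + 𝓕⁻ (deformationSpectrum G Gt a j) x := by
  have k := fun j => ofReal_partialDeriv_eq_fourierInv hψ hG h j x
  have kt := fun j => ofReal_partialDeriv_eq_fourierInv hψt hGt ht j x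
  fin_cases a <;> fin_cases j <;>
    simp [initialDeformation, deformationSpectrum, k, kt, fourierInv_const_mul, sub_eq_add_neg,
      -neg_mul, -one_mul] <;> simp

/-- By `det = 1`, the derivative `∂₁ψt` is square integrable. -/
theorem wn_zero_dsym_lt_top {s : ℝ} (hs0 : 0 < s) (hs1 : s < 1) {ψ ψt : Plane → ℝ}
    {G Gt : Plane → ℂ} (hψ : (fun x => (ψ x : ℂ)) = 𝓕⁻ G) (hψt : (fun x => (ψt x : ℂ)) = 𝓕⁻ Gt)
    (hG : Integrable G) (hGt : Integrable Gt) (h : ∀ j, Integrable (dsym j G))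
    (ht : ∀ j, Integrable (dsym j Gt)) (hw : wn s G < ∞) (hwt : wn (s + 1) Gt < ∞)
    (hdet : ∀ x, (initialDeformation ψ ψt x).det = 1) : wn 0 (dsym 0 Gt) < ∞ := by
  set NF : Plane → ℂ := fun ξ => sconv (dsym 0 G) (dsym 1 Gt) ξ - sconv (dsym 1 G) (dsym 0 Gt) ξ
    with hNF
  have hNFi : Integrable NF := (integrable_sconv (h 0) (ht 1)).sub (integrable_sconv (h 1) (ht 0))
  -- Expanded, `det U₀ = 1` reads `∂₀ψt = ∂₁ψ + (∂₀ψ ∂₁ψt - ∂₁ψ ∂₀ψt)`.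
  have hae : dsym 0 Gt =ᵐ[volume] fun ξ => dsym 1 G ξ + NF ξ := by
    refine ae_eq_of_fourierInv_eq (ht 0) ((h 1).add hNFi) (funext fun x => ?_)
    have hd := hdet x
    rw [Matrix.det_fin_two] at hd
    simp [initialDeformation] at hd
    rw [fourierInv_add_of_integrable (h 1) hNFi, fourierInv_nullForm h ht,
      ← ofReal_partialDeriv_eq_fourierInv hψ hG h, ← ofReal_partialDeriv_eq_fourierInv hψ hG h,
      ← ofReal_partialDeriv_eq_fourierInv hψt hGt ht,
      ← ofReal_partialDeriv_eq_fourierInv hψt hGt ht]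
    norm_cast
    linear_combination -hd
  have hwd : ∀ j, wn s (dsym j Gt) < ∞ := fun j =>
    (wn_dsym_le s j Gt).trans_lt (by finiteness)
  have h1 : wn (s - 1) (dsym 0 Gt) < ∞ := by
    rw [wn_congr_ae hae]
    refine (wn_add_le (h 1).1 hNFi.1).trans_lt (ENNReal.add_lt_top.2 ⟨?_, ?_⟩)
    · refine (wn_dsym_le _ _ _).trans_lt ?_
      rw [sub_add_cancel]
      finiteness
    · have f1 : ∀ j, ∫⁻ ξ, ‖dsym j Gt ξ‖ₑ < ∞ := fun j => (ht j).2
      have f2 : ∫⁻ ξ, ‖G ξ‖ₑ < ∞ := hG.2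
      have q : ∀ j, wn s G * (∫⁻ ξ, ‖dsym j Gt ξ‖ₑ) + (∫⁻ ξ, ‖G ξ‖ₑ) * wn s (dsym j Gt) < ∞ :=
        fun j => by
          have := f1 j
          have := hwd j
          finiteness
      have q0 := q 0
      have q1 := q 1
      refine (wn_nullForm_le hs0.le hG h ht (Q := (wn s G * (∫⁻ ξ, ‖dsym 0 Gt ξ‖ₑ) +
        (∫⁻ ξ, ‖G ξ‖ₑ) * wn s (dsym 0 Gt)) + (wn s G * (∫⁻ ξ, ‖dsym 1 Gt ξ‖ₑ) +
        (∫⁻ ξ, ‖G ξ‖ₑ) * wn s (dsym 1 Gt))) fun j => ?_).trans_lt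
          (ENNReal.mul_lt_top (by finiteness) (ENNReal.add_lt_top.2 ⟨q0, q1⟩))
      fin_cases j
      exacts [le_self_add, le_add_self]
  -- Order zero lies between `s - 1` and `s`.
  refine (wn_le_wn_add_wn (a := s - 1) (b := s) (by linarith) hs0.le (ht 0).1).trans_lt
    (ENNReal.add_lt_top.2 ⟨h1, hwd 0⟩)

theorem partialDeriv_sub_coord {X : Plane → Plane} {y : Plane} (hX : DifferentiableAt ℝ X y)
    (i j : Fin 2) : partialDeriv j (fun z => (X z - z) i) y =
      fderiv ℝ X y (EuclideanSpace.single j 1) i - if i = j then 1 else 0 := by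
  rw [fderiv_apply_component (X := fun z => X z - z) (by fun_prop), fderiv_fun_sub hX
    (by fun_prop), fderiv_fun_id]
  simp

/-- Bounds for the spectra of the displacement of the inverse map. -/
theorem exists_displacement_spectra {s τ : ℝ} (hs0 : 0 < s) (hs1 : s < 1) (hτ : 2 < τ)
    (n : ℝ≥0) :
    ∃ C : ℝ≥0, ∀ (ψ ψt : Plane → ℝ) (G Gt : Plane → ℂ) (T : ℝ≥0∞) (X : Plane → Plane),
      Integrable G → Integrable Gt → (fun x => (ψ x : ℂ)) = 𝓕⁻ G → (fun x => (ψt x : ℂ)) = 𝓕⁻ Gt →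
      wn s G ≤ T → wn (τ + 1) G ≤ T → wn (s + 1) Gt ≤ T → wn (τ + 1) Gt ≤ T → T ≤ n →
      (∀ x, (initialDeformation ψ ψt x).det = 1) →
      (∀ y, (X y - y) 0 = ψt (X y)) → (∀ y, (X y - y) 1 = -ψ (X y)) → LipschitzWith 2 X →
      (∀ x y, ‖X x - x - (X y - y)‖ ≤ 1 / 2 * ‖x - y‖) → Differentiable ℝ X →
      (∀ y a j, fderiv ℝ X y (EuclideanSpace.single j 1) a = initialDeformation ψ ψt (X y) a j) →
      ∃ H : Fin 2 → Plane → ℂ, (∀ i, Integrable (H i)) ∧ (∀ i j, Integrable (dsym j (H i))) ∧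
        (∀ i, (fun y => (((X y - y) i : ℝ) : ℂ)) = 𝓕⁻ (H i)) ∧
        (∀ i, wn (s + 1) (H i) ≤ C * T) ∧ (∀ i, wn (τ + 1) (H i) ≤ C * T) ∧
        ∀ i, wn (s - 1) (dsym 0 (H i)) ≤ C * T := by
  -- The entries of `U₀ - I` will be bounded by `7 * S` with `S = 2 * T ≤ 2 * n`.
  obtain ⟨C, hC⟩ := exists_comp_spectrum hs0 hs1 hτ (14 * n)
  obtain ⟨K, hK⟩ := exists_lintegral_le_wn hs1 (by linarith : 1 < τ)
  obtain ⟨C', hC'⟩ := exists_gag_comp_schwartz_le hs0 hs1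
  set R : ℝ≥0 := Real.toNNReal (2 ^ s)
  refine ⟨70 * C + 2352 * R * K * C ^ 2 * n, fun ψ ψt G Gt T X hG hGt hψ hψt w1 w2 w3 w4 hTn hdet
    hX0 hX1 hXL hXY hXd hXj => ?_⟩
  have hTt : T < ∞ := hTn.trans_lt ENNReal.coe_lt_top
  have hdG : ∀ j, Integrable (dsym j G) := fun j => integrable_dsym (a := s) (b := τ + 1)
    (by linarith) (by linarith) hG.1 (w1.trans_lt hTt) (w2.trans_lt hTt)
  have hdGt : ∀ j, Integrable (dsym j Gt) := fun j => integrable_dsym (a := s + 1) (b := τ + 1)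
    (by linarith) (by linarith) hGt.1 (w3.trans_lt hTt) (w4.trans_lt hTt)
  set S : ℝ≥0∞ := 2 * T with hS
  have hTS : T ≤ S := by rw [hS, two_mul]; exact le_self_add
  have hSt : S < ∞ := by finiteness
  have hSn : S ≤ 2 * n := by rw [hS]; gcongr
  have hint : ∀ r, s ≤ r → r ≤ τ + 1 → wn r G ≤ S := fun r h1 h2 => by
    rw [hS, two_mul]
    exact (wn_le_wn_add_wn h1 h2 hG.1).trans (add_le_add w1 w2)
  set V := deformationSpectrum G Gt with hV
  have hVi := integrable_deformationSpectrum hdG hdGt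
  have hVs : ∀ a j, wn s (V a j) ≤ 7 * S := wn_deformationSpectrum_le
    (hint _ (by linarith) (by linarith)) (w3.trans hTS)
  have hVt : ∀ a j, wn τ (V a j) ≤ 7 * S := wn_deformationSpectrum_le
    (w2.trans hTS) (w4.trans hTS)
  have hU : ∀ x a j, (initialDeformation ψ ψt x a j : ℂ) =
      (if a = j then 1 else 0) + 𝓕⁻ (V a j) x :=
    ofReal_initialDeformation hψ hψt hG hGt hdG hdGt
  have hM : 7 * S ≤ ((14 * n : ℝ≥0) : ℝ≥0∞) := by
    calc 7 * S ≤ 7 * (2 * n) := by gcongr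
      _ = _ := by push_cast; ring
  have hXA : AntilipschitzWith 2 X := by
    have := antilipschitzWith_two_id_add hXY
    simpa using this
  have hdef : IsDeformation s τ (14 * n) X V :=
    ⟨hXL, hXA, hXd, hVi, fun a j => (hVs a j).trans hM, fun a j => (hVt a j).trans hM,
      fun y a j => by rw [hXj, hU]⟩
  have hG2 : Integrable fun ξ => -1 * G ξ := hG.const_mul _
  have hG2w : ∀ r, wn r (fun ξ => -1 * G ξ) ≤ wn r G := fun r => wn_const_mul_le (by simp) G
  obtain ⟨H₁, hH₁, hH₁e, hH₁s, hH₁t⟩ := hC X V hdef _ hG2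
    ((hG2w s).trans_lt (w1.trans_lt hTt)) ((hG2w τ).trans_lt
      ((hint τ (by linarith) (by linarith)).trans_lt hSt))
  have hY1 : (fun y => (((X y - y) 1 : ℝ) : ℂ)) = 𝓕⁻ H₁ := by
    funext y
    rw [hH₁e, fourierInv_const_mul, ← hψ, hX1]
    push_cast
    ring
  have hgag : gag s (fun y => (((X y - y) 1 : ℝ) : ℂ)) < ∞ := by
    rw [hY1, funext hH₁e]
    have := (hG2w s).trans_lt (w1.trans_lt hTt)
    exact (hC' X hXL hXA _ hG2 this).trans_lt (by finiteness)
  have hbd : ∀ (f : Plane → ℝ) (F : Plane → ℂ), (fun x => (f x : ℂ)) = 𝓕⁻ F →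
      ∀ x, ‖f x‖ ≤ ∫ ξ, ‖F ξ‖ := fun f F h x => by
    rw [← Complex.norm_real]
    exact (le_of_eq (congrArg norm (congrFun h x))).trans (norm_fourierInv_le x)
  have hB : ∀ y i, ‖(X y - y) i‖ ≤ (Real.toNNReal ((∫ ξ, ‖G ξ‖) + ∫ ξ, ‖Gt ξ‖) : ℝ≥0) := by
    intro y i
    refine le_trans ?_ (Real.le_coe_toNNReal _)
    have p1 : 0 ≤ ∫ ξ, ‖G ξ‖ := integral_nonneg fun _ => norm_nonneg _
    have p2 : 0 ≤ ∫ ξ, ‖Gt ξ‖ := integral_nonneg fun _ => norm_nonneg _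
    have := hbd ψ G hψ (X y)
    have := hbd ψt Gt hψt (X y)
    fin_cases i
    · change ‖(X y - y) 0‖ ≤ _
      rw [hX0]; linarith
    · change ‖(X y - y) 1‖ ≤ _
      rw [hX1, norm_neg]; linarith
  -- Only the existence of this spectrum is used. Its norms come from the gradient, compared with
  -- the spectra `W` below.
  obtain ⟨H₀, hH₀, hH₀e⟩ := exists_integrable_comp_spectrum hs0 hs1 hτ hdef hXY hB hgag hGt
    (w3.trans_lt hTt) (w4.trans_lt hTt) (wn_zero_dsym_lt_top hs0 hs1 hψ hψt hG hGt hdG hdGt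
      (w1.trans_lt hTt) (w3.trans_lt hTt) hdet)
  have hY0 : (fun y => (((X y - y) 0 : ℝ) : ℂ)) = 𝓕⁻ H₀ := by
    funext y
    rw [hH₀e, ← hψt, hX0]
  choose W hWi hWe hWs hWt using fun a j => hC X V hdef (V a j) (hVi a j)
    ((hVs a j).trans_lt (by finiteness)) ((hVt a j).trans_lt (by finiteness))
  have hWs' : ∀ a j, wn s (W a j) ≤ 7 * C * S := fun a j => (hWs a j).trans (by
    calc (C : ℝ≥0∞) * wn s (V a j) ≤ C * (7 * S) := by gcongr; exact hVs a j
      _ = _ := by ring)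
  have hWt' : ∀ a j, wn τ (W a j) ≤ 14 * C * S := fun a j => (hWt a j).trans (by
    calc _ ≤ (C : ℝ≥0∞) * (7 * S + 7 * S) := by gcongr; exacts [hVs a j, hVt a j]
      _ = _ := by ring)
  set H : Fin 2 → Plane → ℂ := ![H₀, H₁] with hHdef
  have hHi : ∀ i, Integrable (H i) := fun i => by fin_cases i; exacts [hH₀, hH₁]
  have hHe : ∀ i, (fun y => (((X y - y) i : ℝ) : ℂ)) = 𝓕⁻ (H i) := fun i => by
    fin_cases i; exacts [hY0, hY1]
  have hHd : ∀ i, Differentiable ℝ fun y => (X y - y) i := fun i => by fun_prop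
  have hHp : ∀ i j, dsym j (H i) =ᵐ[volume] W i j := by
    intro i j
    have hcd : Differentiable ℝ (𝓕⁻ (H i)) := by
      rw [← hHe]
      exact Complex.ofRealCLM.differentiable.comp (hHd i)
    refine dsym_ae_eq_of_fderiv (hHi i) (hWi i j) hcd fun y => ?_
    rw [← hHe, ← ofReal_partialDeriv (hHd i y), partialDeriv_sub_coord (hXd y), hXj, hWe]
    push_cast
    rw [hU]
    split_ifs <;> simp
  have hHdi : ∀ i j, Integrable (dsym j (H i)) := fun i j => (hWi i j).congr (hHp i j).symm
  have hW1 : ∀ i j, ∫⁻ ξ, ‖dsym j (H i) ξ‖ₑ ≤ 21 * K * C * S := fun i j => by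
    refine (hK _ (hHdi i j).1).trans ?_
    rw [wn_congr_ae (hHp i j), wn_congr_ae (hHp i j)]
    calc _ ≤ (K : ℝ≥0∞) * (7 * C * S + 14 * C * S) := by gcongr; exacts [hWs' i j, hWt' i j]
      _ = _ := by ring
  have hA : ∀ r (D : ℝ≥0∞), (∀ i j, wn r (W i j) ≤ D) → ∀ i, wn (r + 1) (H i) ≤ 2 * D := by
    intro r D hD i
    refine (wn_add_one_le r (hHi i).1).trans ?_
    rw [wn_congr_ae (hHp i 0), wn_congr_ae (hHp i 1), two_mul]
    exact add_le_add (hD i 0) (hD i 1)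
  have hH1s : wn s H₁ ≤ C * S := hH₁s.trans (by
    gcongr; exact (hG2w s).trans (w1.trans hTS))
  have hH1t : wn τ H₁ ≤ 2 * C * S := hH₁t.trans (by
    calc _ ≤ (C : ℝ≥0∞) * (S + S) := by
          gcongr
          · exact (hG2w s).trans (w1.trans hTS)
          · exact (hG2w τ).trans (hint τ (by linarith) (by linarith))
      _ = _ := by ring)
  have hH1l : ∫⁻ ξ, ‖H₁ ξ‖ₑ ≤ 3 * K * C * S := (hK _ hH₁.1).trans (by
    calc _ ≤ (K : ℝ≥0∞) * (C * S + 2 * C * S) := by gcongr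
      _ = _ := by ring)
  have hd1 : ∀ j, wn (s - 1) (dsym j H₁) ≤ 7 * C * S := fun j => by
    refine (wn_dsym_le _ _ _).trans ?_
    rw [sub_add_cancel, mul_assoc]
    exact mul_le_mul' le_rfl hH1s
  set NF : Plane → ℂ := fun ξ => sconv (dsym 0 H₁) (dsym 1 H₀) ξ - sconv (dsym 1 H₁) (dsym 0 H₀) ξ
    with hNF
  have hNFi : Integrable NF := (integrable_sconv (hHdi 1 0) (hHdi 0 1)).sub
    (integrable_sconv (hHdi 1 1) (hHdi 0 0))
  have hi1 : Integrable fun ξ => -1 * dsym 1 H₁ ξ := (hHdi 1 1).const_mul _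
  have hNFw : wn (s - 1) NF ≤ 1176 * R * K * C ^ 2 * n * S := by
    refine (wn_nullForm_le hs0.le hH₁ (hHdi 1) (hHdi 0) (Q := 84 * K * C ^ 2 * n * S)
      fun j => ?_).trans (le_of_eq ?_)
    · have e1 : wn s (dsym j H₀) ≤ 7 * C * S := by
        have := hWs' 0 j
        rwa [← wn_congr_ae (hHp 0 j)] at this
      calc _ ≤ C * S * (21 * K * C * S) + 3 * K * C * S * (7 * C * S) := by
            gcongr
            exacts [hW1 0 j, e1]
        _ = 42 * K * C ^ 2 * S * S := by ring
        _ ≤ 42 * K * C ^ 2 * (2 * n) * S := by gcongr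
        _ = _ := by ring
    · have e : ENNReal.ofReal (2 ^ s) = (R : ℝ≥0∞) := rfl
      rw [e]
      ring
  -- This is `det (I + ∇Y) = 1` solved for `∂₀Y⁰`; both terms on the right are controlled at order
  -- `s - 1`.
  have hae : dsym 0 H₀ =ᵐ[volume] fun ξ => -1 * dsym 1 H₁ ξ + NF ξ := by
    refine ae_eq_of_fourierInv_eq (hHdi 0 0) (hi1.add hNFi) (funext fun y => ?_)
    have hp : ∀ i j, 𝓕⁻ (dsym j (H i)) y = (partialDeriv j (fun z => (X z - z) i) y : ℂ) :=
      fun i j => (ofReal_partialDeriv_eq_fourierInv (hHe i) (hHi i) (hHdi i) j y).symm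
    have hd := hdet (X y)
    rw [Matrix.det_fin_two] at hd
    simp only [← hXj] at hd
    have p00 := hp 0 0
    have p01 := hp 0 1
    have p10 := hp 1 0
    have p11 := hp 1 1
    simp only [partialDeriv_sub_coord (hXd y)] at p00 p01 p10 p11
    simp [hHdef] at p00 p01 p10 p11
    rw [fourierInv_add_of_integrable hi1 hNFi, fourierInv_const_mul,
      fourierInv_nullForm (F := H₁) (G := H₀) (hHdi 1) (hHdi 0), p00, p01, p10, p11, neg_one_mul]
    norm_cast
    linear_combination hd
  refine ⟨H, hHi, hHdi, hHe, fun i => ?_, fun i => ?_, fun i => ?_⟩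
  · refine (hA s _ hWs' i).trans ?_
    calc 2 * (7 * C * S) = 28 * C * T := by rw [hS]; ring
      _ ≤ 28 * C * T + (42 * C + 2352 * R * K * C ^ 2 * n) * T := le_self_add
      _ = _ := by push_cast; ring
  · refine (hA τ _ hWt' i).trans ?_
    calc 2 * (14 * C * S) = 56 * C * T := by rw [hS]; ring
      _ ≤ 56 * C * T + (14 * C + 2352 * R * K * C ^ 2 * n) * T := le_self_add
      _ = _ := by push_cast; ring
  · fin_cases i
    · change wn (s - 1) (dsym 0 H₀) ≤ _
      rw [wn_congr_ae hae]
      refine (wn_add_le hi1.1 hNFi.1).trans ?_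
      calc _ ≤ 7 * C * S + 1176 * R * K * C ^ 2 * n * S :=
            add_le_add ((wn_const_mul_le (by simp) _).trans (hd1 1)) hNFw
        _ = (14 * C + 2352 * R * K * C ^ 2 * n) * T := by rw [hS]; ring
        _ ≤ (14 * C + 2352 * R * K * C ^ 2 * n) * T + 56 * C * T := le_self_add
        _ = _ := by push_cast; ring
    · refine (hd1 0).trans ?_
      calc 7 * C * S = 14 * C * T := by rw [hS]; ring
        _ ≤ 14 * C * T + (56 * C + 2352 * R * K * C ^ 2 * n) * T := le_self_add
        _ = _ := by push_cast; ring

/-! ### The main theorem. -/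

theorem mainTheorem7 :
    ∃ ε₀ : ℝ≥0, 0 < ε₀ ∧
      ∀ τ₁ τ₂ : ℝ, 2 < τ₁ → -1 < τ₂ → τ₂ < 0 →
        ∃ C : ℝ≥0 → ℝ≥0 → ℝ≥0,
          (∀ a a' b b' : ℝ≥0, a ≤ a' → b ≤ b' → C a b ≤ C a' b') ∧
          ∀ ψ ψt : Plane → ℝ,
            Continuous ψ → Continuous ψt →
            MemHomSobolev (τ₁ + 1) ψ → MemHomSobolev (τ₂ + 1) ψ →
            MemHomSobolev (τ₁ + 1) ψt → MemHomSobolev (τ₂ + 2) ψt →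
            eLpNorm (∇ ψ) ∞ volume + eLpNorm (∇ ψt) ∞ volume ≤ (ε₀ : ℝ≥0∞) →
            (∀ x, (initialDeformation ψ ψt x).det = 1) →
            ∃ Y : Plane → Plane,
              ContDiff ℝ 1 Y ∧
              (∀ i, MemHomSobolev (τ₁ + 1) (fun y => Y y i)) ∧
              (∀ i, MemHomSobolev (τ₂ + 2) (fun y => Y y i)) ∧
              (∀ i, MemHomSobolev τ₂ (partialDeriv 0 (fun y => Y y i))) ∧
              (∀ y, initialDeformation ψ ψt (y + Y y) = jacobian (fun z => z + Y z) y ∧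
                jacobian (fun z => z + Y z) y = 1 + jacobian Y y) ∧
              (∑ i, homSobolevNorm₂ (τ₁ + 1) (τ₂ + 2) (fun y => Y y i)) +
                  (∑ i, homSobolevNorm τ₂ (partialDeriv 0 (fun y => Y y i))) ≤
                (C (homSobolevNorm₂ (τ₁ + 1) (τ₂ + 1) ψ).toNNReal
                    (homSobolevNorm₂ (τ₁ + 1) (τ₂ + 2) ψt).toNNReal : ℝ≥0∞) *
                  (homSobolevNorm₂ (τ₁ + 1) (τ₂ + 1) ψ +
                    homSobolevNorm₂ (τ₁ + 1) (τ₂ + 2) ψt) := by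
  -- Two components with Lipschitz constant `1 / 8` give a contraction with constant `1 / 4`.
  refine ⟨1 / 8, by norm_num, fun τ₁ τ₂ hτ₁ hτ₂ hτ₂' => ?_⟩
  have e1 : τ₂ + 1 + 1 = τ₂ + 2 := by ring
  have e2 : τ₂ + 1 - 1 = τ₂ := by ring
  choose K hK using fun n : ℕ => exists_displacement_spectra (s := τ₂ + 1) (τ := τ₁)
    (by linarith) (by linarith) hτ₁ (n : ℝ≥0)
  simp only [e1, e2] at hK
  -- Summing over all integer bounds up to the ceiling makes `C` monotone without monotonicity of
  -- `K`. The factor 6 counts the norms on the left: three for each component.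
  set C : ℝ≥0 → ℝ≥0 → ℝ≥0 := fun a b => ∑ k ∈ Finset.range (⌈a + b⌉₊ + 1), 6 * K k with hC
  refine ⟨C, fun a a' b b' ha hb => ?_, fun ψ ψt hψc hψtc m1 m2 m3 m4 hgrad hdet => ?_⟩
  · refine Finset.sum_le_sum_of_subset (Finset.range_mono ?_)
    have := Nat.ceil_mono (add_le_add ha hb)
    omega
  obtain ⟨G, hG, hψ, hGn⟩ := m1.exists_integrable_spectrum (by linarith) hψc
  obtain ⟨Gt, hGt, hψt, hGtn⟩ := m3.exists_integrable_spectrum (by linarith) hψtc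
  set a := homSobolevNorm₂ (τ₁ + 1) (τ₂ + 1) ψ with ha
  set b := homSobolevNorm₂ (τ₁ + 1) (τ₂ + 2) ψt with hb
  have hat : a ≠ ∞ := (ENNReal.add_lt_top.2 ⟨m1, m2⟩).ne
  have hbt : b ≠ ∞ := (ENNReal.add_lt_top.2 ⟨m3, m4⟩).ne
  set n := ⌈a.toNNReal + b.toNNReal⌉₊ with hn
  have hTn : a + b ≤ ((n : ℝ≥0) : ℝ≥0∞) := by
    rw [← ENNReal.coe_toNNReal hat, ← ENNReal.coe_toNNReal hbt, ← ENNReal.coe_add]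
    exact ENNReal.coe_le_coe.2 (Nat.le_ceil _)
  have w1 : wn (τ₂ + 1) G ≤ a + b := by
    rw [← hGn]; exact le_self_add.trans' le_add_self
  have w2 : wn (τ₁ + 1) G ≤ a + b := by
    rw [← hGn]; exact le_self_add.trans' le_self_add
  have w3 : wn (τ₂ + 2) Gt ≤ a + b := by
    rw [← hGtn]; exact le_add_self.trans' le_add_self
  have w4 : wn (τ₁ + 1) Gt ≤ a + b := by
    rw [← hGtn]; exact le_add_self.trans' le_self_add
  have hTt : a + b < ∞ := by finiteness
  have hψ1 := contDiff_of_ofReal_eq_fourierInv hψ hG fun j =>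
    integrable_dsym (a := τ₂ + 1) (b := τ₁ + 1) (by linarith) (by linarith) hG.1
      (w1.trans_lt hTt) (w2.trans_lt hTt)
  have hψt1 := contDiff_of_ofReal_eq_fourierInv hψt hGt fun j =>
    integrable_dsym (a := τ₂ + 2) (b := τ₁ + 1) (by linarith) (by linarith) hGt.1
      (w3.trans_lt hTt) (w4.trans_lt hTt)
  obtain ⟨X, hX0, hX1, hXL, hXY, hXd, hXj⟩ := exists_inverse_displacement hψ1 hψt1
    (lipschitzWith_of_eLpNorm_gradient_le hψ1 (le_self_add.trans hgrad))
    (lipschitzWith_of_eLpNorm_gradient_le hψt1 (le_add_self.trans hgrad)) hdet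
  obtain ⟨H, hH, hHd, hHe, hHs, hHt, hHp⟩ := hK n ψ ψt G Gt (a + b) X hG hGt hψ hψt w1 w2 w3 w4
    hTn hdet hX0 hX1 hXL hXY hXd hXj
  have hXeq : (fun z => z + (X z - z)) = X := by funext z; abel
  have hYd : Differentiable ℝ fun z => X z - z := hXd.sub differentiable_id
  have n1 : ∀ i, homSobolevNorm (τ₁ + 1) (fun y => (X y - y) i) ≤ K n * (a + b) := fun i =>
    (homSobolevNorm_le_wn _ (hH i) (hHe i)).trans (hHt i)
  have n2 : ∀ i, homSobolevNorm (τ₂ + 2) (fun y => (X y - y) i) ≤ K n * (a + b) := fun i =>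
    (homSobolevNorm_le_wn _ (hH i) (hHe i)).trans (hHs i)
  have n3 : ∀ i, homSobolevNorm τ₂ (partialDeriv 0 fun y => (X y - y) i) ≤ K n * (a + b) :=
    fun i => (homSobolevNorm_le_wn _ (hHd i 0) (funext fun y =>
      ofReal_partialDeriv_eq_fourierInv (hHe i) (hH i) (hHd i) 0 y)).trans (hHp i)
  have hfin : K n * (a + b) < ∞ := by finiteness
  refine ⟨fun z => X z - z, ?_, fun i => (n1 i).trans_lt hfin, fun i => (n2 i).trans_lt hfin,
    fun i => (n3 i).trans_lt hfin, fun y => ⟨?_, ?_⟩, ?_⟩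
  · exact contDiff_euclidean.2 fun i => contDiff_of_ofReal_eq_fourierInv (hHe i) (hH i) (hHd i)
  · rw [hXeq, add_sub_cancel]
    ext i j
    rw [← hXj, jacobian, Matrix.of_apply, fderiv_apply_component (hXd y)]
  · rw [hXeq]
    ext i j
    rw [Matrix.add_apply, jacobian, jacobian, Matrix.of_apply, Matrix.of_apply,
      fderiv_apply_component (hXd y), partialDeriv_sub_coord (hXd y), Matrix.one_apply]
    ring
  · have hKC : 6 * K n ≤ C a.toNNReal b.toNNReal :=
      Finset.single_le_sum (f := fun k => 6 * K k) (fun _ _ => zero_le)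
        (Finset.mem_range.2 (Nat.lt_succ_self n))
    simp only [Fin.sum_univ_two, homSobolevNorm₂]
    calc _ ≤ ((K n * (a + b) + K n * (a + b)) + (K n * (a + b) + K n * (a + b))) +
          (K n * (a + b) + K n * (a + b)) := by
          gcongr
          exacts [n1 0, n2 0, n1 1, n2 1, n3 0, n3 1]
      _ = (6 * K n : ℝ≥0) * (a + b) := by push_cast; ring
      _ ≤ _ := by gcongr
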